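/- Let $K\in\mathbb R$, $N\in(-\infty,0]\cup[2,\infty]$, $D\in(0,\infty]$. Put $\delta=K/(N-1)$ ($\delta=0$ if $N=\infty$) and $l_\delta=\pi/\sqrt\delta$ if $\delta>0$, $l_\delta=\infty$ otherwise. Assume that $D<l_\delta$ if $\delta>0$ and $K<0$. **Means.** For real $n$, $t\in[0,1]$ and $\theta\ge0$ let $\sigma^{(t)}_{K,n}(\theta)$ be $\frac{\sin(t\theta\sqrt{K/n})}{\sin(\theta\sqrt{K/n})}$, $t$, $\frac{\sinh(t\theta\sqrt{-K/n})}{\sinh(\theta\sqrt{-K/n})}$ according as $0<\frac Kn\theta^2<\pi^2$, $\frac Kn\theta^2=0$, $\frac Kn\theta^2<0$, and $\tau^{(t)}_{K,n}(\theta)=t^{1/n}\sigma^{(t)}_{K,n-1}(\theta)^{1-1/n}$, with the limiting value $\tau^{(0)}_{K,n}(\theta)=0$. For $a,b,d\ge 0$ define $M^{(t)}_{K,n}[d](a,b)$ and $\tilde M^{(t)}_{K,N}[d](a,b)$ in $[0,\infty]$ to be $0$ if $ab=0$, and for $ab>0$ as follows. * $M^{(t)}_{K,\infty}[d](a,b)=\tilde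 M^{(t)}_{K,\infty}[d](a,b)=a^{1-t}b^te^{Kt(1-t)d^2/2}$. * For finite $n\in(-\infty,-1]\cup[1,\infty)$: $M^{(t)}_{K,n}[d](a,b)=\big(\sigma^{(1-t)}_{K,n}(d)a^{1/n}+\sigma^{(t)}_{K,n}(d)b^{1/n}\big)^n$ if $\frac Knd^2<\pi^2$; if $\frac Knd^2\ge\pi^2$ it is $+\infty$ for $K>0$ and $0$ for $K<0$. * For finite $N$: if $\delta d^2\ge\pi^2$, then $\tilde M^{(t)}_{K,N}[d](a,b)$ is $+\infty$ for $K>0$ and $0$ for $K<0$. If $\delta d^2<\pi^2$, it is $\big(\tau^{(1-t)}_{K,N}(d)a^{1/N}+\tau^{(t)}_{K,N}(d)b^{1/N}\big)^N$ for $N\ne0$, and $\min\big((1-t)\sigma^{(1-t)}_{K,-1}(d)^{-1}a,\;t\,\sigma^{(t)}_{K,-1}(d)^{-1}b\big)$ for $N=0$ (a factor $0\cdot 0^{-1}$, occurring at $t\in\{0,1\}$, being read as $0$). **Measures.** Let $\mathcal M_{[K,N,D]}$ be the class of finite Borel measures $\xi$ on $\mathbb R$ with $\operatorname{diam}(\operatorname{supp}\xi)\le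 D$ such that for all compact $A_0,A_1\subset\mathbb R$ and $t\in[0,1]$ $$\xi\big((1-t)A_0+tA_1\big)\ \ge\ \tilde M^{(t)}_{K,N}[\theta_K(A_0,A_1)]\big(\xi(A_0),\xi(A_1)\big),$$ where $\theta_K(A_0,A_1)$ is the infimum (if $K\ge0$) or the supremum (if $K<0$) of $|x-y|$ over $x\in A_0$, $y\in A_1$. Let $\mathcal M^M_{[K,N,D]}$ (model measures) be the class of nonzero finite measures $d\xi=J\,dx$, with $J\ge 0$ measurable, whose support is an interval of length at most $D$ and which satisfy $$J\big((1-t)x_0+tx_1\big)=M^{(t)}_{K,N-1}[|x_1-x_0|]\big(J(x_0),J(x_1)\big)\qquad\text{for all }x_0,x_1\in\operatorname{int}(\operatorname{supp}\xi),\ t\in[0,1].$$ **Constants.** Consider either of the following two problems: * $p$-Poincaré ($1<p<\infty$; Poincaré is $p=2$): $u_f=|f'|^p$, $v_f=|f|^p$, $h_f=f|f|^{p-2}$; * log-Sobolev: $u_f=2(f')^2$, $v_f=f^2\log f^2$, $h_f=f^2-1$ (with $h_f=0$, respectively $v_f=0$, where $f=0$). Let $\mathcal F_*(\xi)$ be the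 set of $f\in C^\infty(\mathbb R)$, $f\not\equiv0$, with $h_f\in C_c(\mathbb R)$ and $\int h_f\,d\xi=0$. Let $\Phi_f(\xi)=\int u_f\,d\xi\big/\int v_f\,d\xi$, which is $+\infty$ if $\int v_f\,d\xi=0$, and put $$\Lambda_*(\xi)=\inf_{f\in\mathcal F_*(\xi)}\Phi_f(\xi),\qquad \alpha_{K,N,D}=\inf_{0\ne\xi\in\mathcal M_{[K,N,D]}}\ \inf_{f\in\mathcal F_*(\xi)}\Phi_f(\xi),$$ where an infimum over the empty set is $+\infty$. **Statement.** For each of these problems (every $p\in(1,\infty)$, and log-Sobolev), $$\alpha_{K,N,D}=\inf_{\xi\in\mathcal M^M_{[K,N,D]}}\Lambda_*(\xi).$$ -/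

import Mathlib

open MeasureTheory Set
open scoped ENNReal Pointwise

noncomputable section

namespace CDD

/-! Curvature parameters. The dimension parameter ranges over `WithTop ℝ`, i.e. over `(-∞, ∞]`. -/

/-- `δ = K / (N - 1)`, with the value `0` for `N = 1` and for `N = ∞`. -/
def delta (K : ℝ) : WithTop ℝ → ℝ
  | ⊤ => 0
  | (n : ℝ) => K / (n - 1)

/-- `l_δ = π / √δ` if `δ > 0`, and `∞` otherwise. -/
def lDelta (K : ℝ) (N : WithTop ℝ) : ℝ≥0∞ :=
  if 0 < delta K N then ENNReal.ofReal (Real.pi / √(delta K N)) else ⊤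

/-! Distortion coefficients and distorted means. -/

/-- The distortion coefficient `σ_{K,n}^{(t)}(θ)` where it is finite, i.e. for `(K / n) θ² < π²`.
(Where `(K / n) θ² ≥ π²` its value is `∞`; the distorted means below are given separately there.)
For `n = 0` the value is `t`, since `K / 0 = 0`. -/
def sigma (K n t θ : ℝ) : ℝ :=
  if 0 < K / n * θ ^ 2 then Real.sin (t * θ * √(K / n)) / Real.sin (θ * √(K / n))
  else if K / n * θ ^ 2 = 0 then t
  else Real.sinh (t * θ * √(-(K / n))) / Real.sinh (θ * √(-(K / n)))

/-- The distortion coefficient `τ_{K,n}^{(t)}(θ) = t^{1/n} σ_{K,n-1}^{(t)}(θ)^{1 - 1/n}`. -/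
def tau (K n t θ : ℝ) : ℝ :=
  t ^ (1 / n) * sigma K (n - 1) t θ ^ (1 - 1 / n)

/-- The distorted mean `M_{K,n}^{(t)}[d](a, b)` used for densities. -/
def distortedMean (K : ℝ) (n : WithTop ℝ) (t d a b : ℝ) : ℝ≥0∞ :=
  if a * b = 0 then 0 else
    match n with
    | ⊤ => ENNReal.ofReal (a ^ (1 - t) * b ^ t * Real.exp (K * t * (1 - t) * d ^ 2 / 2))
    | (n : ℝ) =>
      if n = 0 then ENNReal.ofReal (max a b)
      else if Real.pi ^ 2 ≤ K / n * d ^ 2 then (if 0 < K then ⊤ else 0)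
      else ENNReal.ofReal
        ((sigma K n (1 - t) d * a ^ (1 / n) + sigma K n t d * b ^ (1 / n)) ^ n)

/-- The distorted mean `M̃_{K,N}^{(t)}[d](a, b)` used for measures of sets. In the case `N = 0`,
`K < 0`, `-K d² ≥ π²`, where the coefficients `σ_{K,-1}` are infinite, the value is `0`. -/
def distortedMeasureMean (K : ℝ) (N : WithTop ℝ) (t d a b : ℝ) : ℝ≥0∞ :=
  if a * b = 0 then 0 else
    match N with
    | ⊤ => ENNReal.ofReal (a ^ (1 - t) * b ^ t * Real.exp (K * t * (1 - t) * d ^ 2 / 2))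
    | (n : ℝ) =>
      if Real.pi ^ 2 ≤ K / (n - 1) * d ^ 2 then (if 0 < K then ⊤ else 0)
      else if n = 0 then ENNReal.ofReal
        (min ((1 - t) * (sigma K (-1) (1 - t) d)⁻¹ * a) (t * (sigma K (-1) t d)⁻¹ * b))
      else ENNReal.ofReal
        ((tau K n (1 - t) d * a ^ (1 / n) + tau K n t d * b ^ (1 / n)) ^ n)

/-- `θ_K(A₀, A₁)`: the infimum of the distances between points of `A₀` and points of `A₁` if
`K ≥ 0`, their supremum if `K < 0`. -/
def theta (K : ℝ) (A₀ A₁ : Set ℝ) : ℝ :=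
  if 0 ≤ K then sInf (image2 (fun x y : ℝ => |x - y|) A₀ A₁)
  else sSup (image2 (fun x y : ℝ => |x - y|) A₀ A₁)

/-! The classes of measures. -/

/-- The class `M_{[K,N,D]}(ℝ)` of finite measures on `ℝ` that satisfy the synthetic
curvature-dimension-diameter condition. -/
def measureClass (K : ℝ) (N : WithTop ℝ) (D : ℝ≥0∞) : Set (Measure ℝ) :=
  {ξ | IsFiniteMeasure ξ ∧
    (∀ A₀ A₁ : Set ℝ, IsCompact A₀ → IsCompact A₁ → ∀ t ∈ Icc (0 : ℝ) 1,
      distortedMeasureMean K N t (theta K A₀ A₁) (ξ.real A₀) (ξ.real A₁)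
        ≤ ξ ((1 - t) • A₀ + t • A₁)) ∧
    Metric.ediam ξ.support ≤ D}

/-- The class `M^M_{[K,N,D]}(ℝ)` of model measures: nonzero finite measures `ξ = J · m`, supported
on an interval of length at most `D`, whose density satisfies the curvature-dimension inequality
with equality in the interior of the support. -/
def modelClass (K : ℝ) (N : WithTop ℝ) (D : ℝ≥0∞) : Set (Measure ℝ) :=
  {ξ | IsFiniteMeasure ξ ∧ ξ ≠ 0 ∧ ξ.support.OrdConnected ∧
    (∃ J : ℝ → ℝ, Measurable J ∧ (∀ x, 0 ≤ J x) ∧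
      ξ = volume.withDensity (fun x => ENNReal.ofReal (J x)) ∧
      ∀ x₀ ∈ interior ξ.support, ∀ x₁ ∈ interior ξ.support, ∀ t ∈ Icc (0 : ℝ) 1,
        ENNReal.ofReal (J ((1 - t) * x₀ + t * x₁)) =
          distortedMean K (N.map (fun n => n - 1)) t |x₁ - x₀| (J x₀) (J x₁)) ∧
    Metric.ediam ξ.support ≤ D}

/-! The functional inequalities and their constants. -/

/-- The functional inequalities under consideration. The Poincaré inequality is `pPoincare 2`. -/
inductive Problem where
  | pPoincare (p : ℝ)
  | logSobolev

/-- The integrand `u_f` of the numerator. -/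
def Problem.u : Problem → (ℝ → ℝ) → ℝ → ℝ
  | pPoincare p, f, x => |deriv f x| ^ p
  | logSobolev, f, x => 2 * deriv f x ^ 2

/-- The integrand `v_f` of the denominator. -/
def Problem.v : Problem → (ℝ → ℝ) → ℝ → ℝ
  | pPoincare p, f, x => |f x| ^ p
  | logSobolev, f, x => f x ^ 2 * Real.log (f x ^ 2)

/-- The integrand `h_f` of the constraint. -/
def Problem.h : Problem → (ℝ → ℝ) → ℝ → ℝ
  | pPoincare p, f, x => f x * |f x| ^ (p - 2)
  | logSobolev, f, x => f x ^ 2 - 1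

/-- The function space `F_*(ξ)`: smooth `f ≢ 0` with `h_f` continuous of compact support and
`∫ h_f dξ = 0`. -/
def Problem.functionSpace (P : Problem) (ξ : Measure ℝ) : Set (ℝ → ℝ) :=
  {f | ContDiff ℝ ((⊤ : ℕ∞) : WithTop ℕ∞) f ∧ f ≠ 0 ∧ Continuous (P.h f) ∧
    HasCompactSupport (P.h f) ∧ ∫ x, P.h f x ∂ξ = 0}

/-- The quotient `∫ u_f dξ / ∫ v_f dξ`, equal to `+∞` if the denominator vanishes. -/
def Problem.quotient (P : Problem) (f : ℝ → ℝ) (ξ : Measure ℝ) : EReal :=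
  if ∫ x, P.v f x ∂ξ = 0 then ⊤
  else (((∫ x, P.u f x ∂ξ) / ∫ x, P.v f x ∂ξ : ℝ) : EReal)

/-- The functional constant `Λ_*(ξ)`. -/
def Problem.Lambda (P : Problem) (ξ : Measure ℝ) : EReal :=
  ⨅ f ∈ P.functionSpace ξ, P.quotient f ξ

/-- The one-dimensional optimization constant `α_{K,N,D}`. -/
def Problem.alpha (P : Problem) (K : ℝ) (N : WithTop ℝ) (D : ℝ≥0∞) : EReal :=
  ⨅ ξ ∈ {ξ ∈ measureClass K N D | ξ ≠ 0}, ⨅ f ∈ P.functionSpace ξ, P.quotient f ξ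

end CDD

end

/-!
The theorem is a localization statement: an inequality between integrals that fails for some measure
of the class already fails for a model measure.

Every model measure belongs to the class (`mem_measureClass_of_mem_modelClass`, by the
one-dimensional Borell–Brascamp–Lieb inequality `borellBrascampLieb`), so `α` is at most the infimum
over the models. For the other inequality, let `Q` be the quotient of a test function `f` for a
measure `ξ` of the class, let `c > Q`, and put `g = u_f - c v_f`. Then `∫ g dξ < 0` and
`∫ h_f dξ = 0`, and it is enough to find a model measure with the same two properties. Both problems
enter only through the properties collected in `Problem.IsLocalizable`.

After restriction to a compact interval and normalization, `ξ` is a probability measure satisfying a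
Brunn–Minkowski inequality for intervals (`IntervalBM`). This condition is stable under weak
convergence, so the probability measures on the interval that satisfy it together with `∫ h_f = 0`
form a weakly compact set. Among the minimizers of `∫ g` in that set, the Krein–Milman theorem
provides one, `μ`, that is an extreme point: it admits no nontrivial decomposition into measures of
the set (`exists_indecomposable`).

By `IntervalBM.dirac_or_density`, `μ` is a point mass or has a density `J` that satisfies the
curvature-dimension inequality pointwise: near a point of infinite density the inequality would
force a singularity of order `1 / |z - x₀|`, which is not integrable. A point mass is excluded,
since `h_f(x) = 0` implies `v_f(x) = 0` and hence `g(x) ≥ 0`.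

Finally, the subgraph of `J` is cut along a model density `E`. The part `min(J, E)` below the model
satisfies the curvature-dimension inequality, because the means are monotone
(`IsCDDensity.cutBelow`), and so does the part above, `J - min(J, E)`, because they are
superadditive (`IsCDDensity.sub_cutBelow`); here it matters that `N - 1` is negative or at least
`1`, so that the power `N - 1` is convex. The models through a fixed point below the graph of `J`
form a one-parameter family whose two ends are the two vertical cuts through that point. A vertical
cut is never a multiple of `J`, so the integrals of `h_f` over the parts below are nonzero at both
ends. They have opposite signs there, so the integral vanishes for some slope. As `μ` is
indecomposable, `min(J, E)` is then a multiple `c J` with `c < 1`, that is, `E = c J` where `J > 0`,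
and `μ` is a model measure (`exists_isCDExact_ae_eq`, `densityMeasure_mem_modelClass`).
-/

open scoped BoundedContinuousFunction
open Filter Topology

namespace CDD

/-! ### Distortion coefficients -/

theorem sigma_of_mul_sq_eq_zero {K n t θ : ℝ} (h : K / n * θ ^ 2 = 0) : sigma K n t θ = t := by
  simp [sigma, h]

theorem sigma_of_pos {K n θ : ℝ} (t : ℝ) (hκ : 0 < K / n) (hθ : 0 < θ) :
    sigma K n t θ = Real.sin (t * (θ * √(K / n))) / Real.sin (θ * √(K / n)) := by
  have : 0 < K / n * θ ^ 2 := by positivity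
  simp [sigma, this, mul_assoc]

theorem sigma_of_neg {K n θ : ℝ} (t : ℝ) (hκ : K / n < 0) (hθ : 0 < θ) :
    sigma K n t θ = Real.sinh (t * (θ * √(-(K / n)))) / Real.sinh (θ * √(-(K / n))) := by
  have h : K / n * θ ^ 2 < 0 := mul_neg_of_neg_of_pos hκ (by positivity)
  simp only [sigma, h.not_gt, h.ne, if_false, mul_assoc]

theorem angle_mem_Ioo {κ θ : ℝ} (hκ : 0 < κ) (hθ : 0 < θ) (h : κ * θ ^ 2 < Real.pi ^ 2) :
    θ * √κ ∈ Ioo 0 Real.pi := by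
  refine ⟨by positivity, ?_⟩
  refine lt_of_pow_lt_pow_left₀ 2 Real.pi_pos.le ?_
  rw [mul_pow, Real.sq_sqrt hκ.le, mul_comm]
  exact h

theorem sigma_pos {K n t θ : ℝ} (ht : 0 < t) (ht1 : t ≤ 1) (hθ : 0 ≤ θ)
    (h : K / n * θ ^ 2 < Real.pi ^ 2) : 0 < sigma K n t θ := by
  rcases hθ.eq_or_lt with rfl | hθ
  · rw [sigma_of_mul_sq_eq_zero (by simp)]; exact ht
  rcases lt_trichotomy (K / n) 0 with hκ | hκ | hκ
  · rw [sigma_of_neg t hκ hθ]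
    have : 0 < √(-(K / n)) := Real.sqrt_pos.2 (by linarith)
    exact div_pos (Real.sinh_pos_iff.2 (by positivity)) (Real.sinh_pos_iff.2 (by positivity))
  · rw [sigma_of_mul_sq_eq_zero (by simp [hκ])]; exact ht
  · rw [sigma_of_pos t hκ hθ]
    obtain ⟨h0, h1⟩ := angle_mem_Ioo hκ hθ h
    refine div_pos (Real.sin_pos_of_pos_of_lt_pi (by positivity) ?_)
      (Real.sin_pos_of_pos_of_lt_pi h0 h1)
    nlinarith

theorem monotoneOn_sin_mul_div_sin {t : ℝ} (ht : 0 ≤ t) (ht1 : t ≤ 1) :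
    MonotoneOn (fun α => Real.sin (t * α) / Real.sin α) (Ioo 0 Real.pi) := by
  have hG : ∀ α ∈ Ico 0 Real.pi,
      0 ≤ t * Real.cos (t * α) * Real.sin α - Real.sin (t * α) * Real.cos α := by
    have hmono : MonotoneOn
        (fun α => t * Real.cos (t * α) * Real.sin α - Real.sin (t * α) * Real.cos α)
        (Ico 0 Real.pi) := by
      refine monotoneOn_of_deriv_nonneg (convex_Ico _ _) (by fun_prop) (by fun_prop) ?_
      intro α hα
      rw [interior_Ico] at hα
      have h1 : HasDerivAt (fun α => t * α) t α := by simpa using (hasDerivAt_id α).const_mul t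
      have h2 := ((h1.cos.const_mul t).mul (Real.hasDerivAt_sin α)).sub
        (h1.sin.mul (Real.hasDerivAt_cos α))
      refine le_of_le_of_eq ?_ h2.deriv.symm
      have e1 : 0 ≤ Real.sin (t * α) := Real.sin_nonneg_of_nonneg_of_le_pi
        (mul_nonneg ht hα.1.le) (by nlinarith [hα.1, hα.2])
      have e2 : 0 ≤ Real.sin α := Real.sin_nonneg_of_nonneg_of_le_pi hα.1.le hα.2.le
      have e3 : 0 ≤ (1 - t ^ 2) * (Real.sin (t * α) * Real.sin α) :=
        mul_nonneg (by nlinarith) (mul_nonneg e1 e2)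
      nlinarith
    intro α hα
    have := hmono ⟨le_rfl, Real.pi_pos⟩ hα hα.1
    simpa using this
  refine monotoneOn_of_deriv_nonneg (convex_Ioo _ _) ?_ ?_ ?_
  · exact ContinuousOn.div (by fun_prop) (by fun_prop)
      fun α hα => (Real.sin_pos_of_pos_of_lt_pi hα.1 hα.2).ne'
  · rw [interior_Ioo]
    exact DifferentiableOn.div (by fun_prop) (by fun_prop)
      fun α hα => (Real.sin_pos_of_pos_of_lt_pi hα.1 hα.2).ne'
  · intro α hα
    rw [interior_Ioo] at hα
    have h1 : HasDerivAt (fun α => t * α) t α := by simpa using (hasDerivAt_id α).const_mul t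
    have h2 := h1.sin.div (Real.hasDerivAt_sin α) (Real.sin_pos_of_pos_of_lt_pi hα.1 hα.2).ne'
    refine le_of_le_of_eq ?_ h2.deriv.symm
    refine div_nonneg ?_ (sq_nonneg _)
    have := hG α ⟨hα.1.le, hα.2⟩
    linarith

theorem antitoneOn_sinh_mul_div_sinh {t : ℝ} (ht : 0 ≤ t) (ht1 : t ≤ 1) :
    AntitoneOn (fun α => Real.sinh (t * α) / Real.sinh α) (Ioi 0) := by
  have hG : ∀ α ∈ Ici (0 : ℝ),
      t * Real.cosh (t * α) * Real.sinh α - Real.sinh (t * α) * Real.cosh α ≤ 0 := by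
    have hanti : AntitoneOn
        (fun α => t * Real.cosh (t * α) * Real.sinh α - Real.sinh (t * α) * Real.cosh α)
        (Ici 0) := by
      refine antitoneOn_of_deriv_nonpos (convex_Ici _) (by fun_prop) (by fun_prop) ?_
      intro α hα
      rw [interior_Ici] at hα
      have h1 : HasDerivAt (fun α => t * α) t α := by simpa using (hasDerivAt_id α).const_mul t
      have h2 := ((h1.cosh.const_mul t).mul (Real.hasDerivAt_sinh α)).sub
        (h1.sinh.mul (Real.hasDerivAt_cosh α))
      refine le_of_eq_of_le h2.deriv ?_
      have hα' : 0 < α := hα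
      have e1 : 0 ≤ Real.sinh (t * α) := Real.sinh_nonneg_iff.2 (mul_nonneg ht hα'.le)
      have e2 : 0 ≤ Real.sinh α := Real.sinh_nonneg_iff.2 hα'.le
      have e3 : 0 ≤ (1 - t ^ 2) * (Real.sinh (t * α) * Real.sinh α) :=
        mul_nonneg (by nlinarith) (mul_nonneg e1 e2)
      nlinarith
    intro α hα
    have := hanti self_mem_Ici hα hα
    simpa using this
  refine antitoneOn_of_deriv_nonpos (convex_Ioi _) ?_ ?_ ?_
  · exact ContinuousOn.div (by fun_prop) (by fun_prop)
      fun α hα => (Real.sinh_pos_iff.2 hα).ne'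
  · rw [interior_Ioi]
    exact DifferentiableOn.div (by fun_prop) (by fun_prop)
      fun α hα => (Real.sinh_pos_iff.2 hα).ne'
  · intro α hα
    rw [interior_Ioi] at hα
    have hα' : 0 < α := hα
    have h1 : HasDerivAt (fun α => t * α) t α := by simpa using (hasDerivAt_id α).const_mul t
    have h2 := h1.sinh.div (Real.hasDerivAt_sinh α) (Real.sinh_pos_iff.2 hα').ne'
    refine le_of_eq_of_le h2.deriv ?_
    refine div_nonpos_of_nonpos_of_nonneg ?_ (sq_nonneg _)
    have := hG α hα'.le
    linarith

theorem mul_sin_le_sin_mul {t α : ℝ} (ht : 0 ≤ t) (ht1 : t ≤ 1) (h0 : 0 ≤ α) (h1 : α ≤ Real.pi) :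
    t * Real.sin α ≤ Real.sin (t * α) := by
  have hc := strictConcaveOn_sin_Icc.concaveOn.2
  have := hc (x := 0) ⟨le_rfl, Real.pi_pos.le⟩ (y := α) ⟨h0, h1⟩ (a := 1 - t) (b := t)
    (by linarith) ht (by ring)
  simpa using this

theorem sinh_mul_le_mul_sinh {t α : ℝ} (ht : 0 ≤ t) (ht1 : t ≤ 1) (h0 : 0 ≤ α) :
    Real.sinh (t * α) ≤ t * Real.sinh α := by
  have hanti : MonotoneOn (fun α => t * Real.sinh α - Real.sinh (t * α)) (Ici 0) := by
    refine monotoneOn_of_deriv_nonneg (convex_Ici _) (by fun_prop) (by fun_prop) ?_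
    intro α hα
    rw [interior_Ici] at hα
    have hα' : 0 < α := hα
    have h1 : HasDerivAt (fun α => t * α) t α := by simpa using (hasDerivAt_id α).const_mul t
    have h2 := ((Real.hasDerivAt_sinh α).const_mul t).sub h1.sinh
    refine le_of_le_of_eq ?_ h2.deriv.symm
    have : Real.cosh (t * α) ≤ Real.cosh α := by
      rw [Real.cosh_le_cosh, abs_of_nonneg (by positivity), abs_of_pos hα']
      nlinarith
    nlinarith
  have := hanti self_mem_Ici h0 h0
  simpa using this

/-- Where `K / n ≥ 0`, the distortion coefficient increases with the distance. -/
theorem sigma_le_sigma_of_nonneg {K n t θ θ' : ℝ} (hκ : 0 ≤ K / n) (ht : 0 ≤ t) (ht1 : t ≤ 1)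
    (hθ : 0 ≤ θ) (hle : θ ≤ θ') (h : K / n * θ' ^ 2 < Real.pi ^ 2) :
    sigma K n t θ ≤ sigma K n t θ' := by
  rcases hκ.eq_or_lt with hκ | hκ
  · rw [sigma_of_mul_sq_eq_zero (by simp [← hκ]), sigma_of_mul_sq_eq_zero (by simp [← hκ])]
  rcases (hθ.trans hle).eq_or_lt with rfl | hθ'
  · rw [le_antisymm hle hθ]
  have hmem' := angle_mem_Ioo hκ hθ' h
  rw [sigma_of_pos t hκ hθ']
  rcases hθ.eq_or_lt with rfl | hθ
  · rw [sigma_of_mul_sq_eq_zero (by simp),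
      le_div_iff₀ (Real.sin_pos_of_pos_of_lt_pi hmem'.1 hmem'.2)]
    exact mul_sin_le_sin_mul ht ht1 hmem'.1.le hmem'.2.le
  · rw [sigma_of_pos t hκ hθ]
    have hmem := angle_mem_Ioo hκ hθ (lt_of_le_of_lt (by gcongr) h)
    exact monotoneOn_sin_mul_div_sin ht ht1 hmem hmem' (by gcongr)

/-- Where `K / n ≤ 0`, the distortion coefficient decreases with the distance. -/
theorem sigma_le_sigma_of_nonpos {K n t θ θ' : ℝ} (hκ : K / n ≤ 0) (ht : 0 ≤ t) (ht1 : t ≤ 1)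
    (hθ : 0 ≤ θ) (hle : θ ≤ θ') : sigma K n t θ' ≤ sigma K n t θ := by
  rcases hκ.eq_or_lt with hκ | hκ
  · rw [sigma_of_mul_sq_eq_zero (by simp [hκ]), sigma_of_mul_sq_eq_zero (by simp [hκ])]
  rcases (hθ.trans hle).eq_or_lt with rfl | hθ'
  · rw [le_antisymm hle hθ]
  have hs : 0 < √(-(K / n)) := Real.sqrt_pos.2 (by linarith)
  rw [sigma_of_neg t hκ hθ']
  rcases hθ.eq_or_lt with rfl | hθ
  · rw [sigma_of_mul_sq_eq_zero (by simp), div_le_iff₀ (Real.sinh_pos_iff.2 (by positivity))]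
    exact sinh_mul_le_mul_sinh ht ht1 (by positivity)
  · rw [sigma_of_neg t hκ hθ]
    exact antitoneOn_sinh_mul_div_sinh ht ht1 (mul_pos hθ hs) (mul_pos hθ' hs) (by gcongr)

/-- The coefficient `σ^{(t)}` vanishes at least linearly as `t → 0`. -/
theorem exists_sigma_le_mul {K n θ : ℝ} (hθ : 0 ≤ θ) (h : K / n * θ ^ 2 < Real.pi ^ 2) :
    ∃ A : ℝ, 0 < A ∧ ∀ t ∈ Ioo (0 : ℝ) 1, sigma K n t θ ≤ A * t := by
  rcases le_or_gt (K / n) 0 with hκ | hκ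
  · refine ⟨1, one_pos, fun t ht => ?_⟩
    have := sigma_le_sigma_of_nonpos (t := t) hκ ht.1.le ht.2.le le_rfl hθ
    rw [one_mul]
    rwa [sigma_of_mul_sq_eq_zero (θ := 0) (by simp)] at this
  rcases hθ.eq_or_lt with rfl | hθ
  · exact ⟨1, one_pos, fun t ht => by rw [sigma_of_mul_sq_eq_zero (by simp), one_mul]⟩
  obtain ⟨h0, h1⟩ := angle_mem_Ioo hκ hθ h
  have hs := Real.sin_pos_of_pos_of_lt_pi h0 h1
  refine ⟨θ * √(K / n) / Real.sin (θ * √(K / n)), by positivity, fun t ht => ?_⟩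
  rw [sigma_of_pos t hκ hθ, div_mul_eq_mul_div, mul_comm _ t]
  gcongr
  exact Real.sin_le (mul_nonneg ht.1.le h0.le)

theorem continuousAt_sigma {K n t θ : ℝ} (hθ : 0 < θ) (h : K / n * θ ^ 2 < Real.pi ^ 2) :
    ContinuousAt (fun θ => sigma K n t θ) θ := by
  rcases lt_trichotomy (K / n) 0 with hκ | hκ | hκ
  · have hs : 0 < √(-(K / n)) := Real.sqrt_pos.2 (by linarith)
    refine ContinuousAt.congr (f := fun θ => Real.sinh (t * (θ * √(-(K / n)))) /
      Real.sinh (θ * √(-(K / n)))) ?_ ?_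
    · exact ContinuousAt.div (by fun_prop) (by fun_prop) (Real.sinh_pos_iff.2 (by positivity)).ne'
    · filter_upwards [lt_mem_nhds hθ] with x hx using (sigma_of_neg t hκ hx).symm
  · refine ContinuousAt.congr (f := fun _ => t) continuousAt_const ?_
    exact Eventually.of_forall fun x => (sigma_of_mul_sq_eq_zero (by simp [hκ])).symm
  · obtain ⟨h0, h1⟩ := angle_mem_Ioo hκ hθ h
    refine ContinuousAt.congr (f := fun θ => Real.sin (t * (θ * √(K / n))) /
      Real.sin (θ * √(K / n))) ?_ ?_
    · exact ContinuousAt.div (by fun_prop) (by fun_prop) (Real.sin_pos_of_pos_of_lt_pi h0 h1).ne'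
    · filter_upwards [lt_mem_nhds hθ] with x hx using (sigma_of_pos t hκ hx).symm

theorem continuous_sigma_left {K n θ : ℝ} : Continuous (fun t => sigma K n t θ) := by
  unfold sigma
  split_ifs
  · fun_prop
  · fun_prop
  · fun_prop

theorem sigma_zero_left {K n θ : ℝ} : sigma K n 0 θ = 0 := by
  unfold sigma; split_ifs <;> simp

theorem sigma_one_left {K n θ : ℝ} (hθ : 0 ≤ θ) (h : K / n * θ ^ 2 < Real.pi ^ 2) :
    sigma K n 1 θ = 1 := by
  rcases hθ.eq_or_lt with rfl | hθ
  · rw [sigma_of_mul_sq_eq_zero (by simp)]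
  rcases lt_trichotomy (K / n) 0 with hκ | hκ | hκ
  · have hs : 0 < √(-(K / n)) := Real.sqrt_pos.2 (by linarith)
    rw [sigma_of_neg 1 hκ hθ, one_mul, div_self (Real.sinh_pos_iff.2 (by positivity)).ne']
  · rw [sigma_of_mul_sq_eq_zero (by simp [hκ])]
  · obtain ⟨h0, h1⟩ := angle_mem_Ioo hκ hθ h
    rw [sigma_of_pos 1 hκ hθ, one_mul, div_self (Real.sin_pos_of_pos_of_lt_pi h0 h1).ne']

/-- The midpoint coefficient is unbounded as `θ` increases to the conjugate distance. -/
theorem exists_lt_sigma_half {K n d : ℝ} (hκ : 0 < K / n) (hd0 : 0 ≤ d)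
    (hd : Real.pi ^ 2 ≤ K / n * d ^ 2) (C : ℝ) :
    ∃ θ, 0 ≤ θ ∧ θ < d ∧ K / n * θ ^ 2 < Real.pi ^ 2 ∧ C < sigma K n (1 / 2) θ := by
  have hs : 0 < √(K / n) := Real.sqrt_pos.2 hκ
  have hcos : Tendsto (fun α : ℝ => 2 * Real.cos (α / 2)) (𝓝[<] Real.pi) (𝓝[>] 0) := by
    refine tendsto_nhdsWithin_iff.2 ⟨?_, ?_⟩
    · have : Continuous (fun α : ℝ => 2 * Real.cos (α / 2)) := by fun_prop
      have h := (this.tendsto Real.pi).mono_left (nhdsWithin_le_nhds (s := Iio Real.pi))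
      simpa using h
    · filter_upwards [Ioo_mem_nhdsLT Real.pi_pos] with α hα
      have : 0 < Real.cos (α / 2) :=
        Real.cos_pos_of_mem_Ioo ⟨by linarith [hα.1, Real.pi_pos], by linarith [hα.2]⟩
      simp [this]
  have hinv := tendsto_inv_nhdsGT_zero.comp hcos
  have hev : ∀ᶠ α in 𝓝[<] Real.pi, α ∈ Ioo 0 Real.pi := Ioo_mem_nhdsLT Real.pi_pos
  obtain ⟨α, hα, hC⟩ := (hev.and (hinv.eventually_gt_atTop C)).exists
  have hθ : 0 < α / √(K / n) := div_pos hα.1 hs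
  have hval : K / n * (α / √(K / n)) ^ 2 = α ^ 2 := by
    have hne := hκ.ne'
    rw [div_pow, Real.sq_sqrt hκ.le]
    generalize K / n = κ at hne
    field_simp
  have hlt : K / n * (α / √(K / n)) ^ 2 < Real.pi ^ 2 := by
    rw [hval]; exact pow_lt_pow_left₀ hα.2 hα.1.le two_ne_zero
  refine ⟨α / √(K / n), hθ.le, ?_, hlt, ?_⟩
  · refine lt_of_pow_lt_pow_left₀ 2 hd0 ?_
    exact lt_of_mul_lt_mul_left (hlt.trans_le hd) hκ.le
  · rw [sigma_of_pos _ hκ hθ, div_mul_cancel₀ _ hs.ne']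
    have hc : 0 < Real.cos (α / 2) :=
      Real.cos_pos_of_mem_Ioo ⟨by linarith [hα.1, Real.pi_pos], by linarith [hα.2]⟩
    have hsn : 0 < Real.sin (α / 2) :=
      Real.sin_pos_of_pos_of_lt_pi (by linarith [hα.1]) (by linarith [hα.2, hα.1])
    have e : Real.sin α = 2 * Real.sin (α / 2) * Real.cos (α / 2) := by
      rw [← Real.sin_two_mul]; congr 1; ring
    have e2 : Real.sin (1 / 2 * α) / Real.sin α = (2 * Real.cos (α / 2))⁻¹ := by
      rw [e, show 1 / 2 * α = α / 2 by ring]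
      field_simp
    rw [e2]
    exact hC

/-! ### Weighted power means -/

/-- Jensen's inequality for the convex powers `x ^ p`, `p ≥ 1` or `p < 0`. -/
theorem rpow_add_le_add_rpow_of_convex {p w₀ w₁ x y : ℝ} (hp : 1 ≤ p ∨ p < 0) (hw₀ : 0 ≤ w₀)
    (hw₁ : 0 ≤ w₁) (hw : w₀ + w₁ = 1) (hx : 0 < x) (hy : 0 < y) :
    (w₀ * x + w₁ * y) ^ p ≤ w₀ * x ^ p + w₁ * y ^ p := by
  rcases hp with hp | hp
  · exact (convexOn_rpow hp).2 (mem_Ici.2 hx.le) (mem_Ici.2 hy.le) hw₀ hw₁ hw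
  · have h1 := Real.geom_mean_le_arith_mean2_weighted hw₀ hw₁ hx.le hy.le hw
    have h2 := Real.geom_mean_le_arith_mean2_weighted hw₀ hw₁ (Real.rpow_nonneg hx.le p)
      (Real.rpow_nonneg hy.le p) hw
    refine le_trans (Real.rpow_le_rpow_of_nonpos (by positivity) h1 hp.le) (le_trans ?_ h2)
    rw [Real.mul_rpow (by positivity) (by positivity), ← Real.rpow_mul hx.le,
      ← Real.rpow_mul hy.le, ← Real.rpow_mul hx.le, ← Real.rpow_mul hy.le, mul_comm w₀ p,
      mul_comm w₁ p]

/-- The two-point power mean `(s₀ a^{1/n} + s₁ b^{1/n})^n` with unnormalized coefficients. -/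
noncomputable def powMean (n s₀ s₁ a b : ℝ) : ℝ := (s₀ * a ^ (1 / n) + s₁ * b ^ (1 / n)) ^ n

section PowMean

variable {n s₀ s₁ a b : ℝ}

theorem powMean_pos (hs₀ : 0 < s₀) (hs₁ : 0 < s₁) (ha : 0 < a) (hb : 0 < b) :
    0 < powMean n s₀ s₁ a b := by unfold powMean; positivity

theorem powMean_smul (hn : n ≠ 0) (hs₀ : 0 < s₀) (hs₁ : 0 < s₁) (ha : 0 < a) (hb : 0 < b) {c : ℝ}
    (hc : 0 < c) : powMean n s₀ s₁ (c * a) (c * b) = c * powMean n s₀ s₁ a b := by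
  unfold powMean
  rw [Real.mul_rpow hc.le ha.le, Real.mul_rpow hc.le hb.le,
    show s₀ * (c ^ (1 / n) * a ^ (1 / n)) + s₁ * (c ^ (1 / n) * b ^ (1 / n)) =
      c ^ (1 / n) * (s₀ * a ^ (1 / n) + s₁ * b ^ (1 / n)) by ring,
    Real.mul_rpow (by positivity) (by positivity), ← Real.rpow_mul hc.le, one_div_mul_cancel hn,
    Real.rpow_one]

theorem powMean_mono (hn : n ≠ 0) (hs₀ : 0 < s₀) (hs₁ : 0 < s₁) (ha : 0 < a) (hb : 0 < b)
    {a' b' : ℝ} (haa : a ≤ a') (hbb : b ≤ b') :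
    powMean n s₀ s₁ a b ≤ powMean n s₀ s₁ a' b' := by
  unfold powMean
  have ha' := ha.trans_le haa
  have hb' := hb.trans_le hbb
  rcases hn.lt_or_gt with hn | hn
  · have h0 : 1 / n ≤ 0 := one_div_nonpos.2 hn.le
    refine Real.rpow_le_rpow_of_nonpos (by positivity) ?_ hn.le
    have h1 := Real.rpow_le_rpow_of_nonpos ha haa h0
    have h2 := Real.rpow_le_rpow_of_nonpos hb hbb h0
    gcongr
  · gcongr

theorem powMean_le_of_coeff_le (hn : 0 ≤ n) {s₀' s₁' : ℝ} (hs₀ : 0 < s₀) (hs₁ : 0 < s₁)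
    (ha : 0 < a) (hb : 0 < b) (h₀ : s₀ ≤ s₀') (h₁ : s₁ ≤ s₁') :
    powMean n s₀ s₁ a b ≤ powMean n s₀' s₁' a b := by
  unfold powMean; gcongr

theorem powMean_le_of_le_coeff (hn : n ≤ 0) {s₀' s₁' : ℝ} (hs₀ : 0 < s₀') (hs₁ : 0 < s₁')
    (ha : 0 < a) (hb : 0 < b) (h₀ : s₀' ≤ s₀) (h₁ : s₁' ≤ s₁) :
    powMean n s₀ s₁ a b ≤ powMean n s₀' s₁' a b := by
  unfold powMean
  refine Real.rpow_le_rpow_of_nonpos (by positivity) (by gcongr) hn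

/-- The mean lies below its tangent plane at `(a, b)`. -/
theorem exists_powMean_le_mul (hn : 1 ≤ n ∨ n < 0) (hs₀ : 0 < s₀) (hs₁ : 0 < s₁) (ha : 0 < a)
    (hb : 0 < b) : ∃ w₀ w₁ : ℝ, 0 ≤ w₀ ∧ 0 ≤ w₁ ∧ w₀ + w₁ = 1 ∧ ∀ x y, 0 < x → 0 < y →
      powMean n s₀ s₁ (x * a) (y * b) ≤ powMean n s₀ s₁ a b * (w₀ * x + w₁ * y) := by
  have hn0 : n ≠ 0 := by rcases hn with h | h <;> linarith
  set P := s₀ * a ^ (1 / n) + s₁ * b ^ (1 / n) with hP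
  have hPpos : 0 < P := by positivity
  refine ⟨s₀ * a ^ (1 / n) / P, s₁ * b ^ (1 / n) / P, by positivity, by positivity, ?_, ?_⟩
  · rw [← add_div, div_self hPpos.ne']
  intro x y hx hy
  have key := rpow_add_le_add_rpow_of_convex hn
    (show 0 ≤ s₀ * a ^ (1 / n) / P by positivity) (show 0 ≤ s₁ * b ^ (1 / n) / P by positivity)
    (by rw [← add_div, div_self hPpos.ne']) (Real.rpow_pos_of_pos hx (1 / n))
    (Real.rpow_pos_of_pos hy (1 / n))
  rw [← Real.rpow_mul hx.le, ← Real.rpow_mul hy.le, one_div_mul_cancel hn0, Real.rpow_one,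
    Real.rpow_one] at key
  have e : powMean n s₀ s₁ (x * a) (y * b) =
      P ^ n * (s₀ * a ^ (1 / n) / P * x ^ (1 / n) + s₁ * b ^ (1 / n) / P * y ^ (1 / n)) ^ n := by
    rw [← Real.mul_rpow hPpos.le (by positivity), powMean, Real.mul_rpow hx.le ha.le,
      Real.mul_rpow hy.le hb.le]
    congr 1
    field_simp
  rw [e, powMean]
  gcongr

/-- Hölder's inequality, in the form that passes from the density mean to the measure mean. -/
theorem powMean_le_powMean_mul {N : ℝ} (hN : 1 ≤ N ∨ N < 0) (hn : n ≠ 0) (hnN : n = N - 1)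
    {t₀ t₁ q₀ q₁ : ℝ} (hs₀ : 0 < s₀) (hs₁ : 0 < s₁) (ha : 0 < a) (hb : 0 < b)
    (ht₀ : 0 < t₀) (ht₁ : 0 < t₁) (hq₀ : 0 < q₀) (hq₁ : 0 < q₁) :
    powMean N (t₀ ^ (1 / N) * s₀ ^ (1 - 1 / N)) (t₁ ^ (1 / N) * s₁ ^ (1 - 1 / N)) q₀ q₁ ≤
      powMean n s₀ s₁ a b * (t₀ * q₀ / a + t₁ * q₁ / b) := by
  have hN0 : N ≠ 0 := by rcases hN with h | h <;> linarith
  set p₀ := s₀ * a ^ (1 / n) with hp₀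
  set p₁ := s₁ * b ^ (1 / n) with hp₁
  have hp₀' : 0 < p₀ := by positivity
  have hp₁' : 0 < p₁ := by positivity
  set P := p₀ + p₁ with hP
  have hPpos : 0 < P := by positivity
  have term : ∀ {s a t q : ℝ}, 0 < s → 0 < a → 0 < t → 0 < q →
      t ^ (1 / N) * s ^ (1 - 1 / N) * q ^ (1 / N) =
        s * a ^ (1 / n) * (t * q / a / (s * a ^ (1 / n))) ^ (1 / N) := by
    intro s a t q hs ha ht hq
    apply Real.log_injOn_pos (mem_Ioi.2 (by positivity)) (mem_Ioi.2 (by positivity))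
    have h1 : 0 < a ^ (1 / n) := by positivity
    rw [Real.log_mul (by positivity) (by positivity), Real.log_mul (by positivity) (by positivity),
      Real.log_mul (by positivity) (by positivity), Real.log_mul hs.ne' h1.ne',
      Real.log_rpow (by positivity), Real.log_rpow (by positivity),
      Real.log_rpow (by positivity), Real.log_rpow (by positivity), Real.log_rpow (by positivity),
      Real.log_div (by positivity) (by positivity), Real.log_div (by positivity) (by positivity),
      Real.log_mul (by positivity) (by positivity), Real.log_mul hs.ne' h1.ne',
      Real.log_rpow (by positivity)]
    have hN1 : N = n + 1 := by linarith
    subst hN1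
    field_simp
    ring
  have key := rpow_add_le_add_rpow_of_convex hN (show 0 ≤ p₀ / P by positivity)
    (show 0 ≤ p₁ / P by positivity) (by rw [← add_div, div_self hPpos.ne'])
    (show 0 < (t₀ * q₀ / a / p₀) ^ (1 / N) by positivity)
    (show 0 < (t₁ * q₁ / b / p₁) ^ (1 / N) by positivity)
  rw [← Real.rpow_mul (by positivity), ← Real.rpow_mul (by positivity), one_div_mul_cancel hN0,
    Real.rpow_one, Real.rpow_one] at key
  have e : powMean N (t₀ ^ (1 / N) * s₀ ^ (1 - 1 / N)) (t₁ ^ (1 / N) * s₁ ^ (1 - 1 / N)) q₀ q₁ =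
      P ^ N * (p₀ / P * (t₀ * q₀ / a / p₀) ^ (1 / N) +
        p₁ / P * (t₁ * q₁ / b / p₁) ^ (1 / N)) ^ N := by
    rw [← Real.mul_rpow hPpos.le (by positivity), powMean, term hs₀ ha ht₀ hq₀,
      term hs₁ hb ht₁ hq₁, ← hp₀, ← hp₁]
    congr 1
    field_simp
  have e2 : powMean n s₀ s₁ a b * (t₀ * q₀ / a + t₁ * q₁ / b) =
      P ^ N * (p₀ / P * (t₀ * q₀ / a / p₀) + p₁ / P * (t₁ * q₁ / b / p₁)) := by
    have : P ^ N = P ^ n * P := by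
      rw [← Real.rpow_add_one hPpos.ne', hnN, sub_add_cancel]
    rw [this, powMean, ← hp₀, ← hp₁, ← hP]
    field_simp
  rw [e, e2]
  gcongr

/-- Equality in Hölder's inequality for suitable weights. -/
theorem powMean_eq_powMean_mul {N : ℝ} (hN : N ≠ 0) (hn : n ≠ 0) (hnN : n = N - 1)
    {t₀ t₁ : ℝ} (hs₀ : 0 < s₀) (hs₁ : 0 < s₁) (ha : 0 < a) (hb : 0 < b)
    (ht₀ : 0 < t₀) (ht₁ : 0 < t₁) :
    powMean N (t₀ ^ (1 / N) * s₀ ^ (1 - 1 / N)) (t₁ ^ (1 / N) * s₁ ^ (1 - 1 / N))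
        (s₀ * a ^ (1 / n) / t₀ * a) (s₁ * b ^ (1 / n) / t₁ * b) =
      powMean n s₀ s₁ a b *
        (t₀ * (s₀ * a ^ (1 / n) / t₀) + t₁ * (s₁ * b ^ (1 / n) / t₁)) := by
  have term : ∀ {s a t : ℝ}, 0 < s → 0 < a → 0 < t →
      t ^ (1 / N) * s ^ (1 - 1 / N) * (s * a ^ (1 / n) / t * a) ^ (1 / N) = s * a ^ (1 / n) := by
    intro s a t hs ha ht
    apply Real.log_injOn_pos (mem_Ioi.2 (by positivity)) (mem_Ioi.2 (by positivity))
    have h1 : 0 < a ^ (1 / n) := by positivity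
    rw [Real.log_mul (by positivity) (by positivity), Real.log_mul (by positivity) (by positivity),
      Real.log_rpow (by positivity), Real.log_rpow (by positivity), Real.log_rpow (by positivity),
      Real.log_mul (by positivity) (by positivity), Real.log_div (by positivity) (by positivity),
      Real.log_mul hs.ne' h1.ne', Real.log_rpow (by positivity)]
    have hN1 : N = n + 1 := by linarith
    subst hN1
    field_simp
    ring
  rw [powMean, term hs₀ ha ht₀, term hs₁ hb ht₁, powMean, mul_div_cancel₀ _ ht₀.ne',
    mul_div_cancel₀ _ ht₁.ne', ← Real.rpow_add_one (by positivity), hnN, sub_add_cancel]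

end PowMean

/-! ### The two distorted means as real functions -/

/-- The distances at which the distortion coefficients are finite. -/
def Valid (K : ℝ) (N : WithTop ℝ) (d : ℝ) : Prop := delta K N * d ^ 2 < Real.pi ^ 2

/-- The values of `distortedMean K (N - 1)` on positive arguments at a valid distance. -/
noncomputable def dMean (K : ℝ) (N : WithTop ℝ) (t d a b : ℝ) : ℝ :=
  match N with
  | ⊤ => a ^ (1 - t) * b ^ t * Real.exp (K * t * (1 - t) * d ^ 2 / 2)
  | (n : ℝ) => powMean (n - 1) (sigma K (n - 1) (1 - t) d) (sigma K (n - 1) t d) a b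

/-- The values of `distortedMeasureMean K N` on positive arguments at a valid distance. -/
noncomputable def mMean (K : ℝ) (N : WithTop ℝ) (t d a b : ℝ) : ℝ :=
  match N with
  | ⊤ => a ^ (1 - t) * b ^ t * Real.exp (K * t * (1 - t) * d ^ 2 / 2)
  | (n : ℝ) => if n = 0 then
      min ((1 - t) * (sigma K (-1) (1 - t) d)⁻¹ * a) (t * (sigma K (-1) t d)⁻¹ * b)
    else powMean n (tau K n (1 - t) d) (tau K n t d) a b

/-- `CompareDist K θ d`: replacing the distance `d` by `θ` weakens the curvature condition. -/
def CompareDist (K θ d : ℝ) : Prop := (0 ≤ K → θ ≤ d) ∧ (K < 0 → d ≤ θ)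

theorem coe_le_zero_or_two_le {n : ℝ} :
    ((n : WithTop ℝ) ≤ 0 ∨ 2 ≤ (n : WithTop ℝ)) ↔ (n ≤ 0 ∨ 2 ≤ n) :=
  or_congr (by norm_cast) (by rw [← WithTop.coe_ofNat 2, WithTop.coe_le_coe])

theorem valid_coe {K n d : ℝ} : Valid K (n : WithTop ℝ) d ↔ K / (n - 1) * d ^ 2 < Real.pi ^ 2 :=
  Iff.rfl

theorem valid_top {K d : ℝ} : Valid K ⊤ d := by
  have : 0 < Real.pi ^ 2 := by positivity
  simpa [Valid, delta] using this

theorem valid_zero {K : ℝ} {N : WithTop ℝ} : Valid K N 0 := by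
  have : 0 < Real.pi ^ 2 := by positivity
  simpa [Valid] using this

theorem Valid.of_le {K d d' : ℝ} {N : WithTop ℝ} (h : Valid K N d') (hd : 0 ≤ d) (hle : d ≤ d') :
    Valid K N d := by
  unfold Valid at *
  rcases le_or_gt (delta K N) 0 with hδ | hδ
  · exact lt_of_le_of_lt (mul_nonpos_of_nonpos_of_nonneg hδ (sq_nonneg d)) (by positivity)
  · exact lt_of_le_of_lt (by gcongr) h

section

variable {K : ℝ} {N : WithTop ℝ} {t d a b : ℝ}

theorem sigma_pos_of_valid {n : ℝ} (ht : t ∈ Ioo (0 : ℝ) 1) (hd : 0 ≤ d)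
    (hv : Valid K (n : WithTop ℝ) d) :
    0 < sigma K (n - 1) t d := sigma_pos ht.1 ht.2.le hd hv

theorem one_sub_mem (ht : t ∈ Ioo (0 : ℝ) 1) : 1 - t ∈ Ioo (0 : ℝ) 1 :=
  ⟨by linarith [ht.2], by linarith [ht.1]⟩

/-- For the dimension parameters under consideration, `x ^ (N - 1)` is convex. -/
theorem dim_sub_one {n : ℝ} (hN : n ≤ 0 ∨ 2 ≤ n) : (1 ≤ n - 1 ∨ n - 1 < 0) ∧ n - 1 ≠ 0 := by
  rcases hN with h | h
  · exact ⟨Or.inr (by linarith), by linarith⟩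
  · exact ⟨Or.inl (by linarith), by linarith⟩

theorem tau_pos_of_valid {n : ℝ} (ht : t ∈ Ioo (0 : ℝ) 1) (hd : 0 ≤ d)
    (hv : Valid K (n : WithTop ℝ) d) : 0 < tau K n t d :=
  mul_pos (Real.rpow_pos_of_pos ht.1 _) (Real.rpow_pos_of_pos (sigma_pos_of_valid ht hd hv) _)

theorem dMean_pos (ht : t ∈ Ioo (0 : ℝ) 1) (hd : 0 ≤ d) (hv : Valid K N d) (ha : 0 < a)
    (hb : 0 < b) : 0 < dMean K N t d a b := by
  induction N using WithTop.recTopCoe with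
  | top => simp only [dMean]; positivity
  | coe n =>
    exact powMean_pos (sigma_pos_of_valid (one_sub_mem ht) hd hv)
      (sigma_pos_of_valid ht hd hv) ha hb

theorem dMean_smul (hN : N ≤ 0 ∨ 2 ≤ N) (ht : t ∈ Ioo (0 : ℝ) 1) (hd : 0 ≤ d)
    (hv : Valid K N d) (ha : 0 < a) (hb : 0 < b) {c : ℝ} (hc : 0 < c) :
    dMean K N t d (c * a) (c * b) = c * dMean K N t d a b := by
  induction N using WithTop.recTopCoe with
  | top =>
    simp only [dMean]
    rw [Real.mul_rpow hc.le ha.le, Real.mul_rpow hc.le hb.le]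
    have : c ^ (1 - t) * c ^ t = c := by
      rw [← Real.rpow_add hc, sub_add_cancel, Real.rpow_one]
    linear_combination (a ^ (1 - t) * b ^ t * Real.exp (K * t * (1 - t) * d ^ 2 / 2)) * this
  | coe n =>
    exact powMean_smul (dim_sub_one (coe_le_zero_or_two_le.1 hN)).2
      (sigma_pos_of_valid (one_sub_mem ht) hd hv) (sigma_pos_of_valid ht hd hv) ha hb hc

theorem dMean_mono (hN : N ≤ 0 ∨ 2 ≤ N) (ht : t ∈ Ioo (0 : ℝ) 1) (hd : 0 ≤ d)
    (hv : Valid K N d) (ha : 0 < a) (hb : 0 < b) {a' b' : ℝ} (haa : a ≤ a') (hbb : b ≤ b') :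
    dMean K N t d a b ≤ dMean K N t d a' b' := by
  induction N using WithTop.recTopCoe with
  | top =>
    simp only [dMean]
    have h0 := ht.1.le
    have h1 : 0 ≤ 1 - t := by linarith [ht.2]
    have := ha.trans_le haa
    gcongr
  | coe n =>
    exact powMean_mono (dim_sub_one (coe_le_zero_or_two_le.1 hN)).2
      (sigma_pos_of_valid (one_sub_mem ht) hd hv) (sigma_pos_of_valid ht hd hv) ha hb haa hbb

/-- The density mean lies below its tangent plane at `(a, b)`, by concavity and homogeneity. -/
theorem exists_dMean_le_mul (hN : N ≤ 0 ∨ 2 ≤ N) (ht : t ∈ Ioo (0 : ℝ) 1) (hd : 0 ≤ d)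
    (hv : Valid K N d) (ha : 0 < a) (hb : 0 < b) :
    ∃ w₀ w₁ : ℝ, 0 ≤ w₀ ∧ 0 ≤ w₁ ∧ w₀ + w₁ = 1 ∧ ∀ x y, 0 < x → 0 < y →
      dMean K N t d (x * a) (y * b) ≤ dMean K N t d a b * (w₀ * x + w₁ * y) := by
  induction N using WithTop.recTopCoe with
  | top =>
    refine ⟨1 - t, t, by linarith [ht.2], ht.1.le, by ring, fun x y hx hy => ?_⟩
    have h := Real.geom_mean_le_arith_mean2_weighted (by linarith [ht.2] : 0 ≤ 1 - t) ht.1.le hx.le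
      hy.le (by ring)
    simp only [dMean]
    rw [Real.mul_rpow hx.le ha.le, Real.mul_rpow hy.le hb.le]
    have h2 : 0 ≤ a ^ (1 - t) * b ^ t * Real.exp (K * t * (1 - t) * d ^ 2 / 2) := by positivity
    have := mul_le_mul_of_nonneg_left h h2
    linarith
  | coe n =>
    exact exists_powMean_le_mul (dim_sub_one (coe_le_zero_or_two_le.1 hN)).1
      (sigma_pos_of_valid (one_sub_mem ht) hd hv) (sigma_pos_of_valid ht hd hv) ha hb

/-- The density mean is superadditive, being concave and positively homogeneous. -/
theorem dMean_add_le (hN : N ≤ 0 ∨ 2 ≤ N) (ht : t ∈ Ioo (0 : ℝ) 1) (hd : 0 ≤ d)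
    (hv : Valid K N d) {a' b' : ℝ} (ha : 0 < a) (hb : 0 < b) (ha' : 0 < a') (hb' : 0 < b') :
    dMean K N t d a b + dMean K N t d a' b' ≤ dMean K N t d (a + a') (b + b') := by
  obtain ⟨w₀, w₁, -, -, hw, h⟩ := exists_dMean_le_mul hN ht hd hv (add_pos ha ha') (add_pos hb hb')
  have h1 := h (a / (a + a')) (b / (b + b')) (by positivity) (by positivity)
  have h2 := h (a' / (a + a')) (b' / (b + b')) (by positivity) (by positivity)
  rw [div_mul_cancel₀ _ (by positivity), div_mul_cancel₀ _ (by positivity)] at h1 h2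
  refine (add_le_add h1 h2).trans (le_of_eq ?_)
  rw [← mul_add]
  have : w₀ * (a / (a + a')) + w₁ * (b / (b + b')) +
    (w₀ * (a' / (a + a')) + w₁ * (b' / (b + b'))) = 1 := by
    have h3 : a / (a + a') + a' / (a + a') = 1 := by rw [← add_div, div_self (by positivity)]
    have h4 : b / (b + b') + b' / (b + b') = 1 := by rw [← add_div, div_self (by positivity)]
    linear_combination w₀ * h3 + w₁ * h4 + hw
  rw [this, mul_one]

theorem mMean_smul (ht : t ∈ Ioo (0 : ℝ) 1) (hd : 0 ≤ d)
    (hv : Valid K N d) (ha : 0 < a) (hb : 0 < b) {c : ℝ} (hc : 0 < c) :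
    mMean K N t d (c * a) (c * b) = c * mMean K N t d a b := by
  induction N using WithTop.recTopCoe with
  | top => exact dMean_smul (N := ⊤) (Or.inr le_top) ht hd hv ha hb hc
  | coe n =>
    simp only [mMean]
    split_ifs with hn
    · rw [mul_min_of_nonneg _ _ hc.le]; congr 1 <;> ring
    · exact powMean_smul hn
        (tau_pos_of_valid (one_sub_mem ht) hd hv) (tau_pos_of_valid ht hd hv) ha hb hc

theorem mMean_mono (ht : t ∈ Ioo (0 : ℝ) 1) (hd : 0 ≤ d)
    (hv : Valid K N d) (ha : 0 < a) (hb : 0 < b) {a' b' : ℝ} (haa : a ≤ a') (hbb : b ≤ b') :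
    mMean K N t d a b ≤ mMean K N t d a' b' := by
  induction N using WithTop.recTopCoe with
  | top => exact dMean_mono (N := ⊤) (Or.inr le_top) ht hd hv ha hb haa hbb
  | coe n =>
    simp only [mMean]
    split_ifs with hn
    · subst hn
      have h0 := sigma_pos_of_valid (one_sub_mem ht) hd hv
      have h1 := sigma_pos_of_valid ht hd hv
      rw [zero_sub] at h0 h1
      have := ht.1
      have := (one_sub_mem ht).1
      gcongr
    · exact powMean_mono hn
        (tau_pos_of_valid (one_sub_mem ht) hd hv) (tau_pos_of_valid ht hd hv) ha hb haa hbb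

/-- Hölder's inequality relating the two means: `A, B` are values of a density, and `a / A`, `b / B`
play the role of lengths, which combine linearly. -/
theorem mMean_le_dMean_mul (hN : N ≤ 0 ∨ 2 ≤ N) (ht : t ∈ Ioo (0 : ℝ) 1) (hd : 0 ≤ d)
    (hv : Valid K N d) {A B : ℝ} (ha : 0 < a) (hb : 0 < b) (hA : 0 < A) (hB : 0 < B) :
    mMean K N t d a b ≤ dMean K N t d A B * ((1 - t) * a / A + t * b / B) := by
  have ht0 := ht.1
  have ht1 := (one_sub_mem ht).1
  induction N using WithTop.recTopCoe with
  | top =>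
    simp only [dMean, mMean]
    have h := Real.geom_mean_le_arith_mean2_weighted ht1.le ht0.le (div_pos ha hA).le
      (div_pos hb hB).le (by ring)
    rw [Real.div_rpow ha.le hA.le, Real.div_rpow hb.le hB.le] at h
    have h2 : 0 ≤ A ^ (1 - t) * B ^ t * Real.exp (K * t * (1 - t) * d ^ 2 / 2) := by positivity
    refine le_of_eq_of_le ?_ (le_trans (mul_le_mul_of_nonneg_left h h2) (le_of_eq ?_))
    · field_simp
    · ring
  | coe n =>
    have h0 := sigma_pos_of_valid (one_sub_mem ht) hd hv
    have h1 := sigma_pos_of_valid ht hd hv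
    rw [coe_le_zero_or_two_le] at hN
    simp only [dMean, mMean]
    split_ifs with hn
    · subst hn
      rw [zero_sub] at *
      rw [powMean, Real.rpow_neg_one, ← div_eq_inv_mul, le_div_iff₀ (by positivity), mul_add]
      norm_num [Real.rpow_neg_one]
      gcongr ?_ + ?_
      · calc _ ≤ ((1 - t) * (sigma K (-1) (1 - t) d)⁻¹ * a) * (sigma K (-1) (1 - t) d * A⁻¹) := by
              gcongr; exact min_le_left _ _
          _ = _ := by field_simp
      · calc _ ≤ (t * (sigma K (-1) t d)⁻¹ * b) * (sigma K (-1) t d * B⁻¹) := by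
              gcongr; exact min_le_right _ _
          _ = _ := by field_simp
    · refine powMean_le_powMean_mul ?_ (dim_sub_one hN).2 rfl h0 h1 hA hB ht1 ht0 ha hb
      rcases hN with h | h
      · exact Or.inr (lt_of_le_of_ne h hn)
      · exact Or.inl (by linarith)

/-- The lengths `r₀, r₁` for which Hölder's inequality between the two means is an equality. -/
theorem exists_mMean_eq_dMean_mul (hN : N ≤ 0 ∨ 2 ≤ N) (ht : t ∈ Ioo (0 : ℝ) 1) (hd : 0 ≤ d)
    (hv : Valid K N d) (ha : 0 < a) (hb : 0 < b) :
    ∃ r₀ r₁ : ℝ, 0 < r₀ ∧ 0 < r₁ ∧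
      mMean K N t d (r₀ * a) (r₁ * b) = dMean K N t d a b * ((1 - t) * r₀ + t * r₁) := by
  have ht0 := ht.1
  have ht1 := (one_sub_mem ht).1
  induction N using WithTop.recTopCoe with
  | top =>
    refine ⟨1, 1, one_pos, one_pos, ?_⟩
    simp only [dMean, mMean, one_mul]
    ring
  | coe n =>
    have h0 := sigma_pos_of_valid (one_sub_mem ht) hd hv
    have h1 := sigma_pos_of_valid ht hd hv
    rw [coe_le_zero_or_two_le] at hN
    refine ⟨sigma K (n - 1) (1 - t) d * a ^ (1 / (n - 1)) / (1 - t),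
      sigma K (n - 1) t d * b ^ (1 / (n - 1)) / t, by positivity, by positivity, ?_⟩
    simp only [dMean, mMean]
    split_ifs with hn
    · subst hn
      rw [zero_sub] at *
      have e : (1 : ℝ) / (-1) = -1 := by norm_num
      rw [powMean, e]
      simp only [Real.rpow_neg_one]
      rw [mul_div_cancel₀ _ ht1.ne', mul_div_cancel₀ _ ht0.ne', inv_mul_cancel₀ (by positivity)]
      have e0 : (1 - t) * (sigma K (-1) (1 - t) d)⁻¹ *
        (sigma K (-1) (1 - t) d * a⁻¹ / (1 - t) * a) = 1 := by
        field_simp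
      have e1 : t * (sigma K (-1) t d)⁻¹ * (sigma K (-1) t d * b⁻¹ / t * b) = 1 := by
        field_simp
      rw [e0, e1, min_self]
    · exact powMean_eq_powMean_mul hn (dim_sub_one hN).2 rfl h0 h1 ha hb ht1 ht0

/-- The monotonicity in the distance has opposite directions for positive and negative dimensions;
the negative exponent of the mean compensates for it. -/
theorem sigma_le_sigma_of_compareDist {n θ : ℝ} (ht : t ∈ Ioo (0 : ℝ) 1) (hd : 0 ≤ d)
    (hθ : 0 ≤ θ) (hv : Valid K (n : WithTop ℝ) d) (hvθ : Valid K (n : WithTop ℝ) θ)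
    (h : CompareDist K θ d) :
    (0 < n - 1 → sigma K (n - 1) t θ ≤ sigma K (n - 1) t d) ∧
    (n - 1 < 0 → sigma K (n - 1) t d ≤ sigma K (n - 1) t θ) := by
  rcases le_or_gt 0 K with hK | hK
  · have hle := h.1 hK
    exact ⟨fun hn => sigma_le_sigma_of_nonneg (div_nonneg hK hn.le) ht.1.le ht.2.le hθ hle hv,
      fun hn => sigma_le_sigma_of_nonpos (div_nonpos_of_nonneg_of_nonpos hK hn.le) ht.1.le
        ht.2.le hθ hle⟩
  · have hle := h.2 hK
    exact ⟨fun hn => sigma_le_sigma_of_nonpos (div_nonpos_of_nonpos_of_nonneg hK.le hn.le) ht.1.le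
        ht.2.le hd hle,
      fun hn => sigma_le_sigma_of_nonneg (div_nonneg_of_nonpos hK.le hn.le) ht.1.le
        ht.2.le hd hle hvθ⟩

theorem top_mean_le_of_compareDist {θ : ℝ} (ht : t ∈ Ioo (0 : ℝ) 1) (hd : 0 ≤ d) (hθ : 0 ≤ θ)
    (h : CompareDist K θ d) (ha : 0 < a) (hb : 0 < b) :
    dMean K ⊤ t θ a b ≤ dMean K ⊤ t d a b := by
  simp only [dMean]
  have ht0 := ht.1
  have ht1 := (one_sub_mem ht).1
  have : K * θ ^ 2 ≤ K * d ^ 2 := by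
    rcases le_or_gt 0 K with hK | hK
    · have := h.1 hK; gcongr
    · have := h.2 hK
      exact mul_le_mul_of_nonpos_left (by gcongr) hK.le
  have h2 : t * (1 - t) * (K * θ ^ 2) ≤ t * (1 - t) * (K * d ^ 2) := by gcongr
  have : K * t * (1 - t) * θ ^ 2 / 2 ≤ K * t * (1 - t) * d ^ 2 / 2 := by linarith
  gcongr

theorem dMean_le_of_compareDist (hN : N ≤ 0 ∨ 2 ≤ N) {θ : ℝ} (ht : t ∈ Ioo (0 : ℝ) 1) (hd : 0 ≤ d)
    (hθ : 0 ≤ θ) (hv : Valid K N d) (hvθ : Valid K N θ) (h : CompareDist K θ d) (ha : 0 < a)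
    (hb : 0 < b) : dMean K N t θ a b ≤ dMean K N t d a b := by
  induction N using WithTop.recTopCoe with
  | top => exact top_mean_le_of_compareDist ht hd hθ h ha hb
  | coe n =>
    have hn := (dim_sub_one (coe_le_zero_or_two_le.1 hN)).2
    obtain ⟨h1, h2⟩ := sigma_le_sigma_of_compareDist ht hd hθ hv hvθ h
    obtain ⟨h3, h4⟩ := sigma_le_sigma_of_compareDist (one_sub_mem ht) hd hθ hv hvθ h
    rcases hn.lt_or_gt with hn | hn
    · exact powMean_le_of_le_coeff hn.le (sigma_pos_of_valid (one_sub_mem ht) hd hv)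
        (sigma_pos_of_valid ht hd hv) ha hb (h4 hn) (h2 hn)
    · exact powMean_le_of_coeff_le hn.le (sigma_pos_of_valid (one_sub_mem ht) hθ hvθ)
        (sigma_pos_of_valid ht hθ hvθ) ha hb (h3 hn) (h1 hn)

theorem tau_le_tau {n θ θ' : ℝ} (ht : t ∈ Ioo (0 : ℝ) 1) (hn : n < 0 ∨ 1 ≤ n)
    (hp : 0 < sigma K (n - 1) t θ) (h : sigma K (n - 1) t θ ≤ sigma K (n - 1) t θ') :
    tau K n t θ ≤ tau K n t θ' := by
  unfold tau
  have : 0 ≤ 1 - 1 / n := by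
    rcases hn with h | h
    · have := one_div_neg.2 h; linarith
    · have : 1 / n ≤ 1 := by rw [div_le_one (by linarith)]; exact h
      linarith
  have := ht.1
  gcongr

theorem mMean_le_of_compareDist (hN : N ≤ 0 ∨ 2 ≤ N) {θ : ℝ} (ht : t ∈ Ioo (0 : ℝ) 1) (hd : 0 ≤ d)
    (hθ : 0 ≤ θ) (hv : Valid K N d) (hvθ : Valid K N θ) (h : CompareDist K θ d) (ha : 0 < a)
    (hb : 0 < b) : mMean K N t θ a b ≤ mMean K N t d a b := by
  induction N using WithTop.recTopCoe with
  | top => exact top_mean_le_of_compareDist ht hd hθ h ha hb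
  | coe n =>
    rw [coe_le_zero_or_two_le] at hN
    have hn := (dim_sub_one hN).2
    obtain ⟨h1, h2⟩ := sigma_le_sigma_of_compareDist ht hd hθ hv hvθ h
    obtain ⟨h3, h4⟩ := sigma_le_sigma_of_compareDist (one_sub_mem ht) hd hθ hv hvθ h
    have p1 := sigma_pos_of_valid (one_sub_mem ht) hd hv
    have p2 := sigma_pos_of_valid ht hd hv
    have p3 := sigma_pos_of_valid (one_sub_mem ht) hθ hvθ
    have p4 := sigma_pos_of_valid ht hθ hvθ
    have ht0 := ht.1
    have ht1 := (one_sub_mem ht).1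
    simp only [mMean]
    split_ifs with hn0
    · subst hn0
      rw [zero_sub] at *
      have h2 := h2 (by norm_num)
      have h4 := h4 (by norm_num)
      gcongr
    · rcases hN with hN | hN
      · have hN' := lt_of_le_of_ne hN hn0
        exact powMean_le_of_le_coeff hN (tau_pos_of_valid (one_sub_mem ht) hd hv)
          (tau_pos_of_valid ht hd hv) ha hb
          (tau_le_tau (one_sub_mem ht) (Or.inl hN') p1 (h4 (by linarith)))
          (tau_le_tau ht (Or.inl hN') p2 (h2 (by linarith)))
      · exact powMean_le_of_coeff_le (by linarith) (tau_pos_of_valid (one_sub_mem ht) hθ hvθ)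
          (tau_pos_of_valid ht hθ hvθ) ha hb
          (tau_le_tau (one_sub_mem ht) (Or.inr (by linarith)) p3 (h3 (by linarith)))
          (tau_le_tau ht (Or.inr (by linarith)) p4 (h1 (by linarith)))

theorem dMean_zero_self (hN : N ≤ 0 ∨ 2 ≤ N) (ha : 0 < a) :
    dMean K N t 0 a a = a := by
  induction N using WithTop.recTopCoe with
  | top => simp [dMean, ← Real.rpow_add ha]
  | coe n =>
    have hn := (dim_sub_one (coe_le_zero_or_two_le.1 hN)).2
    simp only [dMean, powMean]
    rw [sigma_of_mul_sq_eq_zero (by simp), sigma_of_mul_sq_eq_zero (by simp), ← add_mul,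
      sub_add_cancel, one_mul, ← Real.rpow_mul ha.le, one_div_mul_cancel hn, Real.rpow_one]

theorem continuousAt_dMean_dist (ht : t ∈ Ioo (0 : ℝ) 1) (hd : 0 < d) (hv : Valid K N d)
    (ha : 0 < a) (hb : 0 < b) : ContinuousAt (fun θ => dMean K N t θ a b) d := by
  induction N using WithTop.recTopCoe with
  | top => simp only [dMean]; fun_prop
  | coe n =>
    simp only [dMean, powMean]
    have p1 := sigma_pos_of_valid (one_sub_mem ht) hd.le hv
    have p2 := sigma_pos_of_valid ht hd.le hv
    refine ContinuousAt.rpow_const ?_ (Or.inl (by positivity))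
    exact ((continuousAt_sigma hd hv).mul_const _).add ((continuousAt_sigma hd hv).mul_const _)

theorem dMean_zero_left (hN : N ≤ 0 ∨ 2 ≤ N) (hd : 0 ≤ d) (hv : Valid K N d)
    (ha : 0 < a) : dMean K N 0 d a b = a := by
  induction N using WithTop.recTopCoe with
  | top => simp [dMean]
  | coe n =>
    have hn := (dim_sub_one (coe_le_zero_or_two_le.1 hN)).2
    simp only [dMean, powMean, sub_zero, sigma_zero_left, sigma_one_left hd hv, one_mul, zero_mul,
      add_zero]
    rw [← Real.rpow_mul ha.le, one_div_mul_cancel hn, Real.rpow_one]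

theorem dMean_one_left (hN : N ≤ 0 ∨ 2 ≤ N) (hd : 0 ≤ d) (hv : Valid K N d)
    (hb : 0 < b) : dMean K N 1 d a b = b := by
  induction N using WithTop.recTopCoe with
  | top => simp [dMean]
  | coe n =>
    have hn := (dim_sub_one (coe_le_zero_or_two_le.1 hN)).2
    simp only [dMean, powMean, sub_self, sigma_zero_left, sigma_one_left hd hv, one_mul, zero_mul,
      zero_add]
    rw [← Real.rpow_mul hb.le, one_div_mul_cancel hn, Real.rpow_one]

theorem tendsto_dMean_left (hN : N ≤ 0 ∨ 2 ≤ N) (hd : 0 ≤ d) (hv : Valid K N d) (ha : 0 < a)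
    (hb : 0 < b) : Tendsto (fun t => dMean K N t d a b) (𝓝 0) (𝓝 a) := by
  induction N using WithTop.recTopCoe with
  | top =>
    have : ContinuousAt (fun t => dMean K ⊤ t d a b) 0 := by
      simp only [dMean]
      refine ContinuousAt.mul (ContinuousAt.mul ?_ ?_) (by fun_prop)
      · exact ContinuousAt.rpow (by fun_prop) (by fun_prop) (Or.inl ha.ne')
      · exact ContinuousAt.rpow (by fun_prop) (by fun_prop) (Or.inl hb.ne')
    have h := this.tendsto
    simpa [dMean] using h
  | coe n =>
    have hn := (dim_sub_one (coe_le_zero_or_two_le.1 hN)).2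
    have hs : Continuous (fun t => sigma K (n - 1) t d) := continuous_sigma_left
    have hval : sigma K (n - 1) (1 - 0) d * a ^ (1 / (n - 1)) +
      sigma K (n - 1) 0 d * b ^ (1 / (n - 1))
        = a ^ (1 / (n - 1)) := by
      rw [sub_zero, sigma_one_left hd hv, sigma_zero_left]; ring
    have : ContinuousAt (fun t => dMean K n t d a b) 0 := by
      simp only [dMean, powMean]
      refine ContinuousAt.rpow_const ?_ (Or.inl (by rw [hval]; positivity))
      exact Continuous.continuousAt (by fun_prop)
    have h := this.tendsto
    simp only [dMean, powMean] at h ⊢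
    rwa [hval, ← Real.rpow_mul ha.le, one_div_mul_cancel hn, Real.rpow_one] at h

/-- Fixing a positive value at one endpoint and letting the other one blow up, the mean is at least
of order `1 / t` near the latter. -/
theorem exists_div_le_dMean (hN : N ≤ 0 ∨ 2 ≤ N) (hd : 0 ≤ d) (hv : Valid K N d) (hb : 0 < b) :
    ∃ c : ℝ, 0 < c ∧ ∀ t ∈ Ioo (0 : ℝ) 1, ∃ A : ℝ, 0 < A ∧ c / t ≤ dMean K N t d A b := by
  induction N using WithTop.recTopCoe with
  | top =>
    refine ⟨1, one_pos, fun t ht => ?_⟩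
    have h1 := (one_sub_mem ht).1
    have : Tendsto (fun A : ℝ => A ^ (1 - t) * (b ^ t * Real.exp (K * t * (1 - t) * d ^ 2 / 2)))
      atTop atTop := (tendsto_rpow_atTop h1).atTop_mul_const (by positivity)
    obtain ⟨A, hA, hA0⟩ := ((this.eventually_ge_atTop (1 / t)).and (eventually_gt_atTop 0)).exists
    refine ⟨A, hA0, ?_⟩
    simp only [dMean]
    rwa [mul_assoc]
  | coe n =>
    rcases coe_le_zero_or_two_le.1 hN with hn | hn
    · obtain ⟨B, hB, hBt⟩ := exists_sigma_le_mul (K := K) (n := n - 1) hd hv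
      refine ⟨(2 * B * b ^ (1 / (n - 1))) ^ (n - 1), by positivity, fun t ht => ?_⟩
      have ht0 := ht.1
      have p1 := sigma_pos_of_valid (one_sub_mem ht) hd hv
      have p2 := sigma_pos_of_valid ht hd hv
      have hneg : 1 / (n - 1) < 0 := one_div_neg.2 (by linarith)
      have h0 : Tendsto (fun A : ℝ => sigma K (n - 1) (1 - t) d * A ^ (1 / (n - 1)))
        atTop (𝓝 0) := by
        have := (tendsto_rpow_neg_atTop (y := -(1 / (n - 1))) (by linarith)).const_mul
          (sigma K (n - 1) (1 - t) d)
        simpa using this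
      obtain ⟨A, hA, hA0⟩ := ((h0.eventually_lt_const
        (show 0 < B * t * b ^ (1 / (n - 1)) by positivity)).and (eventually_gt_atTop 0)).exists
      refine ⟨A, hA0, ?_⟩
      simp only [dMean, powMean]
      have hle : sigma K (n - 1) (1 - t) d * A ^ (1 / (n - 1)) +
          sigma K (n - 1) t d * b ^ (1 / (n - 1)) ≤ 2 * B * b ^ (1 / (n - 1)) * t := by
        have := hBt t ht
        have : sigma K (n - 1) t d * b ^ (1 / (n - 1)) ≤ B * t * b ^ (1 / (n - 1)) := by gcongr
        linarith
      refine le_trans ?_ (Real.rpow_le_rpow_of_nonpos (by positivity) hle (by linarith))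
      rw [Real.mul_rpow (by positivity) ht0.le, div_eq_mul_inv, ← Real.rpow_neg_one t]
      gcongr ?_ * ?_
      exact Real.rpow_le_rpow_of_exponent_ge ht0 ht.2.le (by linarith)
    · refine ⟨1, one_pos, fun t ht => ?_⟩
      have p1 := sigma_pos_of_valid (one_sub_mem ht) hd hv
      have p2 := sigma_pos_of_valid ht hd hv
      have h1 : 0 < 1 / (n - 1) := one_div_pos.2 (by linarith)
      have : Tendsto (fun A : ℝ => (sigma K (n - 1) (1 - t) d * A ^ (1 / (n - 1)) +
          sigma K (n - 1) t d * b ^ (1 / (n - 1))) ^ (n - 1)) atTop atTop :=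
        (tendsto_rpow_atTop (by linarith)).comp (tendsto_atTop_add_const_right _ _
          ((tendsto_rpow_atTop h1).const_mul_atTop p1))
      obtain ⟨A, hA, hA0⟩ := ((this.eventually_ge_atTop (1 / t)).and (eventually_gt_atTop 0)).exists
      exact ⟨A, hA0, hA⟩

/-- For `K > 0` the midpoint mean is unbounded near the conjugate distance. -/
theorem exists_lt_dMean_half (hN : N ≤ 0 ∨ 2 ≤ N) (hK : 0 ≤ K) (hd : 0 ≤ d) (hv : ¬ Valid K N d)
    (ha : 0 < a) (hb : 0 < b) (C : ℝ) :
    ∃ θ, 0 ≤ θ ∧ θ < d ∧ Valid K N θ ∧ C < dMean K N (1 / 2) θ a b := by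
  induction N using WithTop.recTopCoe with
  | top => exact absurd valid_top hv
  | coe n =>
    have ht : (1 / 2 : ℝ) ∈ Ioo (0 : ℝ) 1 := by norm_num
    rw [valid_coe, not_lt] at hv
    have hpos : 0 < K / (n - 1) := by
      by_contra hcon
      have : K / (n - 1) * d ^ 2 ≤ 0 := mul_nonpos_of_nonpos_of_nonneg (not_lt.1 hcon) (sq_nonneg d)
      have : 0 < Real.pi ^ 2 := by positivity
      linarith
    have hn : 1 ≤ n - 1 := by
      rcases coe_le_zero_or_two_le.1 hN with h | h
      · have := div_nonpos_of_nonneg_of_nonpos hK (show n - 1 ≤ 0 by linarith)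
        linarith
      · linarith
    have htend : Tendsto (fun s : ℝ => (s * a ^ (1 / (n - 1))) ^ (n - 1)) atTop atTop :=
      (tendsto_rpow_atTop (by linarith)).comp (tendsto_id.atTop_mul_const (by positivity))
    obtain ⟨s, hs, hs0⟩ := ((htend.eventually_gt_atTop C).and (eventually_gt_atTop 0)).exists
    obtain ⟨θ, h0, h1, h2, h3⟩ := exists_lt_sigma_half hpos hd hv s
    refine ⟨θ, h0, h1, h2, hs.trans_le ?_⟩
    simp only [dMean, powMean]
    have e : (1 - 1 / 2 : ℝ) = 1 / 2 := by norm_num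
    rw [e]
    have p := hs0.trans h3
    have : s * a ^ (1 / (n - 1)) ≤ sigma K (n - 1) (1 / 2) θ * a ^ (1 / (n - 1)) := by gcongr
    have : 0 ≤ sigma K (n - 1) (1 / 2) θ * b ^ (1 / (n - 1)) := by positivity
    refine Real.rpow_le_rpow (by positivity) (by linarith) (by linarith)

end

/-! ### One-dimensional Brunn–Minkowski and Borell–Brascamp–Lieb inequalities -/

theorem volume_image_mul_add {w : ℝ} (hw : 0 < w) (c : ℝ) (S : Set ℝ) :
    volume ((fun x => w * x + c) '' S) = ENNReal.ofReal w * volume S := by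
  have h : (fun x => w * x + c) '' S = (fun x => x + c) '' ((w : ℝ) • S) := by
    rw [← image_smul, image_image]; rfl
  rw [h, image_add_right, measure_preimage_add_right, Measure.addHaar_smul]
  simp [abs_of_pos hw]

/-- For compact sets, two translates of the scaled sets that meet in a single point lie in the
Minkowski combination. -/
theorem brunnMinkowski_of_isCompact {S₀ S₁ C : Set ℝ} (h₀ : IsCompact S₀) (h₁ : IsCompact S₁)
    (hne₀ : S₀.Nonempty) (hne₁ : S₁.Nonempty) {w₀ w₁ : ℝ} (hw₀ : 0 < w₀) (hw₁ : 0 < w₁)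
    (hC : ∀ x ∈ S₀, ∀ y ∈ S₁, w₀ * x + w₁ * y ∈ C) :
    ENNReal.ofReal w₀ * volume S₀ + ENNReal.ofReal w₁ * volume S₁ ≤ volume C := by
  obtain ⟨M, hM, hMmax⟩ := h₀.exists_isGreatest hne₀
  obtain ⟨m, hm, hmmin⟩ := h₁.exists_isLeast hne₁
  rw [← volume_image_mul_add hw₀ (w₁ * m), ← volume_image_mul_add hw₁ (w₀ * M)]
  have hmeas : MeasurableSet ((fun x => w₁ * x + w₀ * M) '' S₁) :=
    (h₁.image (by fun_prop)).measurableSet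
  -- The two translated sets meet only in the point `w₀ M + w₁ m`.
  rw [← measure_union₀ hmeas.nullMeasurableSet]
  · refine measure_mono (union_subset ?_ ?_)
    · rintro _ ⟨x, hx, rfl⟩; exact hC x hx m hm
    · rintro _ ⟨y, hy, rfl⟩
      have := hC M hM y hy
      rwa [add_comm] at this
  · refine measure_mono_null (t := {w₀ * M + w₁ * m}) ?_ (by simp)
    rintro _ ⟨⟨x, hx, rfl⟩, ⟨y, hy, hxy⟩⟩
    have e1 : w₀ * x ≤ w₀ * M := by gcongr; exact hMmax hx
    have e2 : w₁ * m ≤ w₁ * y := by gcongr; exact hmmin hy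
    simp only [mem_singleton_iff] at hxy ⊢
    linarith

theorem exists_isCompact_lt_volume {S : Set ℝ} (hS : NullMeasurableSet S) (hne : S.Nonempty)
    {a : ℝ≥0∞} (ha : a < volume S) : ∃ F ⊆ S, IsCompact F ∧ F.Nonempty ∧ a < volume F := by
  obtain ⟨T, hTS, hT, hae⟩ := hS.exists_measurable_subset_ae_eq
  rw [← measure_congr hae] at ha
  obtain ⟨F, hFT, hF, haF⟩ := hT.exists_lt_isCompact ha
  obtain ⟨s, hs⟩ := hne
  exact ⟨insert s F, insert_subset hs (hFT.trans hTS), hF.insert s, insert_nonempty _ _,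
    haF.trans_le (measure_mono (subset_insert _ _))⟩

/-- The Brunn–Minkowski inequality on the line. -/
theorem brunnMinkowski {S₀ S₁ C : Set ℝ} (h₀ : NullMeasurableSet S₀) (h₁ : NullMeasurableSet S₁)
    (hne₀ : S₀.Nonempty) (hne₁ : S₁.Nonempty) {w₀ w₁ : ℝ} (hw₀ : 0 < w₀) (hw₁ : 0 < w₁)
    (hC : ∀ x ∈ S₀, ∀ y ∈ S₁, w₀ * x + w₁ * y ∈ C) :
    ENNReal.ofReal w₀ * volume S₀ + ENNReal.ofReal w₁ * volume S₁ ≤ volume C := by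
  have main : ∀ {T₀ T₁ : Set ℝ}, T₀ ⊆ S₀ → T₁ ⊆ S₁ → IsCompact T₀ → IsCompact T₁ → T₀.Nonempty →
      T₁.Nonempty → ENNReal.ofReal w₀ * volume T₀ + ENNReal.ofReal w₁ * volume T₁ ≤ volume C :=
    fun hs₀ hs₁ hc₀ hc₁ hn₀ hn₁ => brunnMinkowski_of_isCompact hc₀ hc₁ hn₀ hn₁ hw₀ hw₁
      fun x hx y hy => hC x (hs₀ hx) y (hs₁ hy)
  have step : ∀ {S : Set ℝ}, NullMeasurableSet S → S.Nonempty → ∀ {u v w : ℝ≥0∞}, w ≠ ∞ →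
      (∀ T ⊆ S, IsCompact T → T.Nonempty → w * volume T + u ≤ v) → w * volume S + u ≤ v := by
    intro S hS hne u v w hw h
    have hu : ∀ a < volume S, w * a + u ≤ v := by
      intro a ha
      obtain ⟨F, hFS, hF, hFne, haF⟩ := exists_isCompact_lt_volume hS hne ha
      exact le_trans (by gcongr) (h F hFS hF hFne)
    rcases eq_or_ne (volume S) 0 with h0 | h0
    · obtain ⟨s, hs⟩ := hne
      have := h {s} (singleton_subset_iff.2 hs) isCompact_singleton (singleton_nonempty s)
      simpa [h0] using this
    have : (𝓝[<] (volume S)).NeBot := nhdsLT_neBot_of_exists_lt ⟨0, h0.bot_lt⟩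
    refine le_of_tendsto (f := fun a => w * a + u) (x := 𝓝[<] (volume S)) ?_
      (eventually_nhdsWithin_of_forall fun a ha => hu a ha)
    exact ((ENNReal.continuous_const_mul hw).tendsto _).mono_left nhdsWithin_le_nhds |>.add
      tendsto_const_nhds
  refine step h₀ hne₀ ENNReal.ofReal_ne_top fun T₀ hT₀ hc₀ hn₀ => ?_
  rw [add_comm]
  refine step h₁ hne₁ ENNReal.ofReal_ne_top fun T₁ hT₁ hc₁ hn₁ => ?_
  rw [add_comm]
  exact main hT₀ hT₁ hc₀ hc₁ hn₀ hn₁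

/-- The measure with density `J` with respect to Lebesgue measure. -/
noncomputable def densityMeasure (J : ℝ → ℝ) : Measure ℝ :=
  volume.withDensity (fun x => ENNReal.ofReal (J x))

theorem densityMeasure_apply {J : ℝ → ℝ} {A : Set ℝ} (hA : MeasurableSet A) :
    densityMeasure J A = ∫⁻ x in A, ENNReal.ofReal (J x) := withDensity_apply _ hA

/-- Layer-cake formula for a density truncated at the level `A`. -/
theorem lintegral_ofReal_min_div_one {J : ℝ → ℝ} (hJ0 : ∀ x, 0 ≤ J x) (hJ : AEMeasurable J)
    {S : Set ℝ} (hS : MeasurableSet S) {A : ℝ} (hA : 0 < A) :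
    ∫⁻ x in S, ENNReal.ofReal (min (J x / A) 1) =
      ∫⁻ s in Ioc (0 : ℝ) 1, volume ({x | s ≤ J x / A} ∩ S) := by
  rw [lintegral_eq_lintegral_meas_le _
    (Eventually.of_forall fun x => le_min (div_nonneg (hJ0 x) hA.le) zero_le_one)
    (((hJ.div_const A).min aemeasurable_const).mono_measure Measure.restrict_le_self)]
  have hsplit : (Ioi (0 : ℝ)) = Ioc 0 1 ∪ Ioi 1 := (Ioc_union_Ioi_eq_Ioi zero_le_one).symm
  rw [hsplit, lintegral_union measurableSet_Ioi (Ioc_disjoint_Ioi le_rfl)]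
  have h2 : ∫⁻ s in Ioi (1 : ℝ), (volume.restrict S) {a | s ≤ min (J a / A) 1} = 0 := by
    rw [setLIntegral_congr_fun (g := fun _ => 0) measurableSet_Ioi]
    · simp
    · intro s hs
      have : {a | s ≤ min (J a / A) 1} = ∅ := by
        ext a; simp only [mem_ofPred_eq, le_min_iff, mem_empty_iff_false, iff_false, not_and]
        intro _; exact not_le.2 hs
      simp only [this, measure_empty]
  rw [h2, add_zero]
  refine setLIntegral_congr_fun measurableSet_Ioc fun s hs => ?_
  simp only [Measure.restrict_apply' hS]
  congr 2
  ext a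
  simp [hs.2]

/-- The integral of a density is approximated by truncations at attained levels `A`, for which the
superlevel set is nonempty. -/
theorem exists_lt_lintegral_min {J : ℝ → ℝ} (hJ : AEMeasurable J)
    {S : Set ℝ} {a : ℝ≥0∞} (ha : a < ∫⁻ x in S, ENNReal.ofReal (J x)) (hS : MeasurableSet S) :
    ∃ A : ℝ, 0 < A ∧ (∃ x ∈ S, A ≤ J x) ∧ a < ∫⁻ x in S, ENNReal.ofReal (min (J x) A) := by
  let ι := {q : ℚ // 0 < q ∧ ∃ x ∈ S, (q : ℝ) ≤ J x}
  have hsup : ∫⁻ x in S, ENNReal.ofReal (J x) =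
      ∫⁻ x in S, ⨆ q : ι, ENNReal.ofReal (min (J x) (q.1 : ℝ)) := by
    refine setLIntegral_congr_fun hS fun x hx => ?_
    refine le_antisymm ?_ (iSup_le fun q => ENNReal.ofReal_le_ofReal (min_le_left _ _))
    refine le_of_forall_lt fun c hc => ?_
    obtain ⟨q, hq0, hcq, hqJ⟩ := ENNReal.lt_iff_exists_rat_btwn.1 hc
    have hq' : (q : ℝ) < J x := by
      by_contra hcon
      exact absurd (ENNReal.ofReal_le_ofReal (not_lt.1 hcon)) (not_le.2 hqJ)
    have hqpos : (0 : ℚ) < q := by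
      rcases hq0.eq_or_lt with h | h
      · rw [← h] at hcq; simp at hcq
      · exact h
    refine lt_of_lt_of_le ?_ (le_iSup (fun q : ι => ENNReal.ofReal (min (J x) (q.1 : ℝ)))
      ⟨q, hqpos, x, hx, hq'.le⟩)
    rw [min_eq_right hq'.le]
    exact hcq
  rw [hsup, lintegral_iSup_directed] at ha
  · obtain ⟨q, hq⟩ := lt_iSup_iff.1 ha
    exact ⟨q.1, by exact_mod_cast q.2.1, q.2.2, hq⟩
  · exact fun q => ((hJ.min aemeasurable_const).mono_measure
      Measure.restrict_le_self).ennreal_ofReal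
  · intro q r
    rcases le_total q.1 r.1 with h | h
    · exact ⟨r, fun x => ENNReal.ofReal_le_ofReal (min_le_min le_rfl (by exact_mod_cast h)),
        fun x => le_rfl⟩
    · exact ⟨q, fun x => le_rfl,
        fun x => ENNReal.ofReal_le_ofReal (min_le_min le_rfl (by exact_mod_cast h))⟩

section

variable {K : ℝ} {N : WithTop ℝ} {t θ : ℝ}

/-- Integrating the Brunn–Minkowski inequality over superlevel sets, for densities truncated at
the levels `A` and `B`. -/
theorem truncated_borellBrascampLieb (hN : N ≤ 0 ∨ 2 ≤ N) (ht : t ∈ Ioo (0 : ℝ) 1) (hθ : 0 ≤ θ)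
    (hv : Valid K N θ) {J : ℝ → ℝ} (hJ0 : ∀ x, 0 ≤ J x) (hJ : AEMeasurable J)
    {A₀ A₁ C : Set ℝ} (hA₀ : MeasurableSet A₀) (hA₁ : MeasurableSet A₁) (hC : MeasurableSet C)
    (hsub : ∀ x ∈ A₀, ∀ y ∈ A₁, (1 - t) * x + t * y ∈ C)
    (hineq : ∀ x ∈ A₀, ∀ y ∈ A₁, 0 < J x → 0 < J y →
      dMean K N t θ (J x) (J y) ≤ J ((1 - t) * x + t * y))
    {A B : ℝ} (hA : 0 < A) (hB : 0 < B) (hAx : ∃ x ∈ A₀, A ≤ J x) (hBy : ∃ y ∈ A₁, B ≤ J y) :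
    ENNReal.ofReal (1 - t) * (∫⁻ x in A₀, ENNReal.ofReal (min (J x / A) 1)) +
      ENNReal.ofReal t * (∫⁻ x in A₁, ENNReal.ofReal (min (J x / B) 1)) ≤
      ∫⁻ x in C, ENNReal.ofReal (J x / dMean K N t θ A B) := by
  have hm := dMean_pos ht hθ hv hA hB
  rw [lintegral_ofReal_min_div_one hJ0 hJ hA₀ hA, lintegral_ofReal_min_div_one hJ0 hJ hA₁ hB,
    lintegral_eq_lintegral_meas_le _ (Eventually.of_forall fun x => div_nonneg (hJ0 x) hm.le)
      ((hJ.div_const _).mono_measure Measure.restrict_le_self)]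
  have hanti : ∀ (S : Set ℝ) (E : ℝ), Antitone fun s => volume ({x | s ≤ J x / E} ∩ S) :=
    fun S E s s' h => measure_mono fun x hx => ⟨le_trans h hx.1, hx.2⟩
  rw [← lintegral_const_mul _ (hanti A₀ A).measurable,
    ← lintegral_const_mul _ (hanti A₁ B).measurable,
    ← lintegral_add_left ((hanti A₀ A).measurable.const_mul _)]
  refine le_trans (setLIntegral_mono' measurableSet_Ioc fun s hs => ?_)
    (lintegral_mono_set Ioc_subset_Ioi_self)
  rw [Measure.restrict_apply' hC]
  have hnull : ∀ (S : Set ℝ) (E : ℝ), MeasurableSet S →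
      NullMeasurableSet ({x | s ≤ J x / E} ∩ S) := fun S E hS =>
    (nullMeasurableSet_le aemeasurable_const (hJ.div_const E)).inter hS.nullMeasurableSet
  obtain ⟨x, hx, hAx⟩ := hAx
  obtain ⟨y, hy, hBy⟩ := hBy
  refine brunnMinkowski (hnull A₀ A hA₀) (hnull A₁ B hA₁)
    ⟨x, hs.2.trans ((one_le_div hA).2 hAx), hx⟩ ⟨y, hs.2.trans ((one_le_div hB).2 hBy), hy⟩
    (one_sub_mem ht).1 ht.1 ?_
  rintro x ⟨hx1, hx⟩ y ⟨hy1, hy⟩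
  refine ⟨?_, hsub x hx y hy⟩
  have hx2 : s * A ≤ J x := (le_div_iff₀ hA).1 hx1
  have hy2 : s * B ≤ J y := (le_div_iff₀ hB).1 hy1
  have hsA := mul_pos hs.1 hA
  have hsB := mul_pos hs.1 hB
  show s ≤ _
  rw [le_div_iff₀ hm, ← dMean_smul hN ht hθ hv hA hB hs.1]
  exact (dMean_mono hN ht hθ hv hsA hsB hx2 hy2).trans
    (hineq x hx y hy (hsA.trans_le hx2) (hsB.trans_le hy2))

/-- The one-dimensional Borell–Brascamp–Lieb inequality: the density condition implies the
Brunn–Minkowski condition for measures. -/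
theorem borellBrascampLieb (hN : N ≤ 0 ∨ 2 ≤ N) (ht : t ∈ Ioo (0 : ℝ) 1) (hθ : 0 ≤ θ)
    (hv : Valid K N θ) {J : ℝ → ℝ} (hJ0 : ∀ x, 0 ≤ J x) (hJ : AEMeasurable J)
    [IsFiniteMeasure (densityMeasure J)]
    {A₀ A₁ C : Set ℝ} (hA₀ : MeasurableSet A₀) (hA₁ : MeasurableSet A₁) (hC : MeasurableSet C)
    (hsub : ∀ x ∈ A₀, ∀ y ∈ A₁, (1 - t) * x + t * y ∈ C)
    (hineq : ∀ x ∈ A₀, ∀ y ∈ A₁, 0 < J x → 0 < J y →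
      dMean K N t θ (J x) (J y) ≤ J ((1 - t) * x + t * y))
    (ha : 0 < (densityMeasure J).real A₀) (hb : 0 < (densityMeasure J).real A₁) :
    mMean K N t θ ((densityMeasure J).real A₀) ((densityMeasure J).real A₁) ≤
      (densityMeasure J).real C := by
  set a := (densityMeasure J).real A₀ with ha_def
  set b := (densityMeasure J).real A₁ with hb_def
  have key : ∀ s ∈ Ioo (0 : ℝ) 1, s * mMean K N t θ a b ≤ (densityMeasure J).real C := by
    intro s hs
    have trunc : ∀ {S : Set ℝ}, MeasurableSet S → 0 < (densityMeasure J).real S →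
        ∃ A : ℝ, 0 < A ∧ (∃ x ∈ S, A ≤ J x) ∧ ∃ I : ℝ, 0 < I ∧
          s * (densityMeasure J).real S ≤ I * A ∧
          ∫⁻ x in S, ENNReal.ofReal (min (J x / A) 1) = ENNReal.ofReal I := by
      intro S hS hpos
      have hlt : ENNReal.ofReal (s * (densityMeasure J).real S) <
          ∫⁻ x in S, ENNReal.ofReal (J x) := by
        rw [← densityMeasure_apply hS, ENNReal.ofReal_lt_iff_lt_toReal (by have := hs.1; positivity)
          (measure_ne_top _ _)]
        show _ < (densityMeasure J).real S
        nlinarith [hs.2]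
      obtain ⟨A, hA, hAx, hAlt⟩ := exists_lt_lintegral_min hJ hlt hS
      have heq : ∫⁻ x in S, ENNReal.ofReal (min (J x) A) =
          (∫⁻ x in S, ENNReal.ofReal (min (J x / A) 1)) * ENNReal.ofReal A := by
        rw [← lintegral_mul_const' _ _ ENNReal.ofReal_ne_top]
        congr with x
        rw [← ENNReal.ofReal_mul (le_min (div_nonneg (hJ0 x) hA.le) zero_le_one),
          min_mul_of_nonneg _ _ hA.le, div_mul_cancel₀ _ hA.ne', one_mul]
      have hfin : ∫⁻ x in S, ENNReal.ofReal (min (J x / A) 1) ≠ ∞ := by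
        intro htop
        have h1 : ∫⁻ x in S, ENNReal.ofReal (min (J x) A) ≤ densityMeasure J S := by
          rw [densityMeasure_apply hS]
          exact lintegral_mono fun x => ENNReal.ofReal_le_ofReal (min_le_left _ _)
        rw [heq, htop, ENNReal.top_mul (by simpa using hA)] at h1
        exact measure_ne_top _ _ (top_le_iff.1 h1)
      refine ⟨A, hA, hAx, (∫⁻ x in S, ENNReal.ofReal (min (J x / A) 1)).toReal, ?_, ?_,
        (ENNReal.ofReal_toReal hfin).symm⟩
      · refine ENNReal.toReal_pos ?_ hfin
        intro h0
        rw [heq, h0, zero_mul] at hAlt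
        exact not_lt_zero hAlt
      · rw [heq, ← ENNReal.ofReal_toReal hfin, ← ENNReal.ofReal_mul ENNReal.toReal_nonneg] at hAlt
        exact (ENNReal.ofReal_lt_ofReal_iff_of_nonneg (by have := hs.1; positivity)).1 hAlt |>.le
    obtain ⟨A, hA, hAx, I, hI, hIa, hIeq⟩ := trunc hA₀ ha
    obtain ⟨B, hB, hBx, I', hI', hIb, hIeq'⟩ := trunc hA₁ hb
    have hm := dMean_pos ht hθ hv hA hB
    have hmain := truncated_borellBrascampLieb hN ht hθ hv hJ0 hJ hA₀ hA₁ hC hsub hineq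
      hA hB hAx hBx
    have hC' : ∫⁻ x in C, ENNReal.ofReal (J x / dMean K N t θ A B) =
        ENNReal.ofReal ((densityMeasure J).real C / dMean K N t θ A B) := by
      have : ∀ x, ENNReal.ofReal (J x / dMean K N t θ A B) =
          ENNReal.ofReal (J x) * (ENNReal.ofReal (dMean K N t θ A B))⁻¹ := fun x => by
        rw [ENNReal.ofReal_div_of_pos hm, div_eq_mul_inv]
      simp_rw [this]
      rw [lintegral_mul_const' _ _ (by simpa using hm), ← densityMeasure_apply hC,
        ENNReal.ofReal_div_of_pos hm, div_eq_mul_inv, Measure.real,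
          ENNReal.ofReal_toReal (measure_ne_top _ _)]
    have ht0 := ht.1
    have ht1 := (one_sub_mem ht).1
    rw [hIeq, hIeq', hC', ← ENNReal.ofReal_mul ht1.le, ← ENNReal.ofReal_mul ht0.le,
      ← ENNReal.ofReal_add (by positivity) (by positivity),
      ENNReal.ofReal_le_ofReal_iff (by positivity), le_div_iff₀ hm] at hmain
    have hs0 := hs.1
    calc s * mMean K N t θ a b = mMean K N t θ (s * a) (s * b) :=
          (mMean_smul ht hθ hv ha hb hs0).symm
      _ ≤ mMean K N t θ (I * A) (I' * B) :=
          mMean_mono ht hθ hv (by positivity) (by positivity) hIa hIb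
      _ ≤ dMean K N t θ A B * ((1 - t) * (I * A) / A + t * (I' * B) / B) :=
          mMean_le_dMean_mul hN ht hθ hv (by positivity) (by positivity) hA hB
      _ = ((1 - t) * I + t * I') * dMean K N t θ A B := by field_simp
      _ ≤ _ := hmain
  have hlim : Tendsto (fun s : ℝ => s * mMean K N t θ a b) (𝓝[<] 1) (𝓝 (1 * mMean K N t θ a b)) :=
    (tendsto_id.mul_const _).mono_left nhdsWithin_le_nhds
  rw [one_mul] at hlim
  exact le_of_tendsto hlim (by filter_upwards [Ioo_mem_nhdsLT zero_lt_one] with s hs using key s hs)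

end

/-! ### Curvature-dimension conditions for densities and for measures -/

/-- The pointwise curvature-dimension condition for a density. -/
def IsCDDensity (K : ℝ) (N : WithTop ℝ) (J : ℝ → ℝ) : Prop :=
  (∀ x, 0 ≤ J x) ∧ ∀ x y, 0 < J x → 0 < J y → Valid K N |y - x| ∧
    ∀ t ∈ Ioo (0 : ℝ) 1, dMean K N t |y - x| (J x) (J y) ≤ J ((1 - t) * x + t * y)

/-- The Brunn–Minkowski condition for intervals. Open intervals on the side of the mean and a closed
interval on the other side make the condition stable under weak convergence. -/
def IntervalBM (K : ℝ) (N : WithTop ℝ) (ξ : Measure ℝ) : Prop :=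
  ∀ p₀ q₀ p₁ q₁ t θ : ℝ, t ∈ Ioo (0 : ℝ) 1 → 0 ≤ θ → Valid K N θ →
    (∀ x ∈ Icc p₀ q₀, ∀ y ∈ Icc p₁ q₁, CompareDist K θ |y - x|) →
    0 < ξ.real (Ioo p₀ q₀) → 0 < ξ.real (Ioo p₁ q₁) →
    mMean K N t θ (ξ.real (Ioo p₀ q₀)) (ξ.real (Ioo p₁ q₁)) ≤
      ξ.real (Icc ((1 - t) * p₀ + t * p₁) ((1 - t) * q₀ + t * q₁))

section

variable {K : ℝ} {N : WithTop ℝ} {t d a b : ℝ}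

theorem distortedMean_eq_ofReal (hN : N ≤ 0 ∨ 2 ≤ N) (hv : Valid K N d) (ha : 0 < a) (hb : 0 < b) :
    distortedMean K (N.map fun n => n - 1) t d a b = ENNReal.ofReal (dMean K N t d a b) := by
  have hab : a * b ≠ 0 := by positivity
  induction N using WithTop.recTopCoe with
  | top => simp [distortedMean, dMean, hab]
  | coe n =>
    have hn := (dim_sub_one (coe_le_zero_or_two_le.1 hN)).2
    rw [valid_coe, ← not_le] at hv
    rw [WithTop.map_coe]
    simp only [distortedMean, dMean, hab, hn, hv, if_false, powMean]

theorem distortedMean_of_not_valid (hN : N ≤ 0 ∨ 2 ≤ N) (hv : ¬ Valid K N d) (ha : 0 < a)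
    (hb : 0 < b) :
    distortedMean K (N.map fun n => n - 1) t d a b = if 0 < K then ⊤ else 0 := by
  have hab : a * b ≠ 0 := by positivity
  induction N using WithTop.recTopCoe with
  | top => exact absurd valid_top hv
  | coe n =>
    have hn := (dim_sub_one (coe_le_zero_or_two_le.1 hN)).2
    rw [valid_coe, not_lt] at hv
    rw [WithTop.map_coe]
    simp only [distortedMean, hab, hn, hv, if_false, if_true]

theorem distortedMeasureMean_eq_ofReal (hv : Valid K N d) (ha : 0 < a) (hb : 0 < b) :
    distortedMeasureMean K N t d a b = ENNReal.ofReal (mMean K N t d a b) := by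
  have hab : a * b ≠ 0 := by positivity
  induction N using WithTop.recTopCoe with
  | top => simp [distortedMeasureMean, mMean, hab]
  | coe n =>
    rw [valid_coe, ← not_le] at hv
    by_cases hn : n = 0
    · subst hn
      simp only [distortedMeasureMean, mMean, hab, hv, if_false, if_true]
    · simp [distortedMeasureMean, mMean, hab, hv, hn, powMean]

theorem distortedMeasureMean_of_not_valid (hv : ¬ Valid K N d) (ha : 0 < a) (hb : 0 < b) :
    distortedMeasureMean K N t d a b = if 0 < K then ⊤ else 0 := by
  have hab : a * b ≠ 0 := by positivity
  induction N using WithTop.recTopCoe with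
  | top => exact absurd valid_top hv
  | coe n =>
    rw [valid_coe, not_lt] at hv
    simp [distortedMeasureMean, hab, hv]

theorem distortedMeasureMean_of_mul_eq_zero (h : a * b = 0) :
    distortedMeasureMean K N t d a b = 0 := by
  unfold distortedMeasureMean
  rw [if_pos h]

theorem mMean_zero_le (hd : 0 ≤ d) (hv : Valid K N d) (ha : 0 < a) :
    mMean K N 0 d a b ≤ a := by
  induction N using WithTop.recTopCoe with
  | top => simp [mMean]
  | coe n =>
    simp only [mMean]
    split_ifs with hn
    · refine (min_le_right _ _).trans ?_
      rw [zero_mul, zero_mul]; exact ha.le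
    · rw [powMean, tau, tau, sub_zero, sigma_one_left hd hv, Real.zero_rpow (one_div_ne_zero hn),
        Real.one_rpow, Real.one_rpow, zero_mul, zero_mul, add_zero, one_mul, one_mul,
        ← Real.rpow_mul ha.le, one_div_mul_cancel hn, Real.rpow_one]

theorem mMean_one_le (hd : 0 ≤ d) (hv : Valid K N d) (hb : 0 < b) :
    mMean K N 1 d a b ≤ b := by
  induction N using WithTop.recTopCoe with
  | top => simp [mMean]
  | coe n =>
    simp only [mMean]
    split_ifs with hn
    · refine (min_le_left _ _).trans ?_
      rw [sub_self, zero_mul, zero_mul]; exact hb.le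
    · rw [powMean, tau, tau, sub_self, sigma_one_left hd hv, Real.zero_rpow (one_div_ne_zero hn),
        Real.one_rpow, Real.one_rpow, zero_mul, zero_mul, zero_add, one_mul, one_mul,
        ← Real.rpow_mul hb.le, one_div_mul_cancel hn, Real.rpow_one]

/-- The density condition implies the Brunn–Minkowski condition at every admissible distance. -/
theorem IsCDDensity.measure_ge (hN : N ≤ 0 ∨ 2 ≤ N) {J : ℝ → ℝ} (hJ : IsCDDensity K N J)
    (hJm : AEMeasurable J) [IsFiniteMeasure (densityMeasure J)] {θ : ℝ} (ht : t ∈ Ioo (0 : ℝ) 1)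
    (hθ : 0 ≤ θ) (hv : Valid K N θ) {A₀ A₁ C : Set ℝ} (hA₀ : MeasurableSet A₀)
    (hA₁ : MeasurableSet A₁) (hC : MeasurableSet C)
    (hsub : ∀ x ∈ A₀, ∀ y ∈ A₁, (1 - t) * x + t * y ∈ C)
    (hcomp : ∀ x ∈ A₀, ∀ y ∈ A₁, CompareDist K θ |y - x|)
    (ha : 0 < (densityMeasure J).real A₀) (hb : 0 < (densityMeasure J).real A₁) :
    mMean K N t θ ((densityMeasure J).real A₀) ((densityMeasure J).real A₁) ≤
      (densityMeasure J).real C :=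
  borellBrascampLieb hN ht hθ hv hJ.1 hJm hA₀ hA₁ hC hsub
    (fun x hx y hy hx0 hy0 =>
      (dMean_le_of_compareDist hN ht (abs_nonneg _) hθ (hJ.2 x y hx0 hy0).1 hv
        (hcomp x hx y hy) hx0 hy0).trans ((hJ.2 x y hx0 hy0).2 t ht)) ha hb

theorem combination_mem_Icc {p₀ q₀ p₁ q₁ x y : ℝ} (ht : t ∈ Icc (0 : ℝ) 1) (hx : x ∈ Icc p₀ q₀)
    (hy : y ∈ Icc p₁ q₁) :
    (1 - t) * x + t * y ∈ Icc ((1 - t) * p₀ + t * p₁) ((1 - t) * q₀ + t * q₁) := by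
  have h0 := ht.1
  have h1 : 0 ≤ 1 - t := by linarith [ht.2]
  constructor
  · have := hx.1; have := hy.1; gcongr
  · have := hx.2; have := hy.2; gcongr

theorem IsCDDensity.intervalBM (hN : N ≤ 0 ∨ 2 ≤ N) {J : ℝ → ℝ} (hJ : IsCDDensity K N J)
    (hJm : AEMeasurable J) [IsFiniteMeasure (densityMeasure J)] :
    IntervalBM K N (densityMeasure J) := by
  intro p₀ q₀ p₁ q₁ t θ ht hθ hv hcomp ha hb
  exact hJ.measure_ge hN hJm ht hθ hv measurableSet_Ioo measurableSet_Ioo measurableSet_Icc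
    (fun x hx y hy => combination_mem_Icc ⟨ht.1.le, ht.2.le⟩ (Ioo_subset_Icc_self hx)
      (Ioo_subset_Icc_self hy))
    (fun x hx y hy => hcomp x (Ioo_subset_Icc_self hx) y (Ioo_subset_Icc_self hy)) ha hb

theorem IntervalBM.smul {ξ : Measure ℝ} (h : IntervalBM K N ξ) {c : ℝ≥0∞} (hc0 : c ≠ 0)
    (hc : c ≠ ∞) : IntervalBM K N (c • ξ) := by
  have hpos : 0 < c.toReal := ENNReal.toReal_pos hc0 hc
  intro p₀ q₀ p₁ q₁ t θ ht hθ hv hcomp ha hb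
  simp only [measureReal_ennreal_smul_apply] at ha hb ⊢
  have ha' := pos_of_mul_pos_right ha hpos.le
  have hb' := pos_of_mul_pos_right hb hpos.le
  rw [mMean_smul ht hθ hv ha' hb' hpos]
  gcongr
  exact h p₀ q₀ p₁ q₁ t θ ht hθ hv hcomp ha' hb'

theorem theta_nonneg {A₀ A₁ : Set ℝ} : 0 ≤ theta K A₀ A₁ := by
  have h : ∀ z ∈ image2 (fun x y : ℝ => |x - y|) A₀ A₁, 0 ≤ z := by
    rintro _ ⟨x, -, y, -, rfl⟩; exact abs_nonneg _
  unfold theta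
  split_ifs
  · exact Real.sInf_nonneg h
  · exact Real.sSup_nonneg h

theorem compareDist_theta {A₀ A₁ : Set ℝ} (h₀ : IsCompact A₀) (h₁ : IsCompact A₁) {x y : ℝ}
    (hx : x ∈ A₀) (hy : y ∈ A₁) : CompareDist K (theta K A₀ A₁) |y - x| := by
  have hmem : |y - x| ∈ image2 (fun x y : ℝ => |x - y|) A₀ A₁ := ⟨x, hx, y, hy, abs_sub_comm _ _⟩
  refine ⟨fun hK => ?_, fun hK => ?_⟩
  · rw [theta, if_pos hK]
    exact csInf_le ⟨0, by rintro _ ⟨x, -, y, -, rfl⟩; exact abs_nonneg _⟩ hmem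
  · rw [theta, if_neg (not_le.2 hK)]
    refine le_csSup ?_ hmem
    rw [← image_prod]
    exact ((h₀.prod h₁).image (f := fun z : ℝ × ℝ => |z.1 - z.2|) (by fun_prop)).bddAbove

theorem compareDist_theta_of_forall {A₀ A₁ : Set ℝ} (h₀ : A₀.Nonempty) (h₁ : A₁.Nonempty) {θ : ℝ}
    (h : ∀ x ∈ A₀, ∀ y ∈ A₁, CompareDist K θ |y - x|) : CompareDist K θ (theta K A₀ A₁) := by
  refine ⟨fun hK => ?_, fun hK => ?_⟩
  · rw [theta, if_pos hK]
    refine le_csInf (h₀.image2 h₁) ?_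
    rintro _ ⟨x, hx, y, hy, rfl⟩
    simpa only [abs_sub_comm] using (h x hx y hy).1 hK
  · rw [theta, if_neg (not_le.2 hK)]
    refine csSup_le (h₀.image2 h₁) ?_
    rintro _ ⟨x, hx, y, hy, rfl⟩
    simpa only [abs_sub_comm] using (h x hx y hy).2 hK

theorem valid_of_eq_zero (hK : K = 0) : Valid K N d := by
  have h : delta K N = 0 := by
    induction N using WithTop.recTopCoe with
    | top => rfl
    | coe n => simp [delta, hK]
  have : 0 < Real.pi ^ 2 := by positivity
  simpa [Valid, h] using this

theorem nonempty_of_measureReal_pos {ξ : Measure ℝ} {A : Set ℝ} (h : 0 < ξ.real A) :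
    A.Nonempty := by
  by_contra hne
  rw [not_nonempty_iff_eq_empty] at hne
  simp [hne] at h

/-- Restriction to an interval preserves the condition, since intervals are closed under convex
combinations. -/
theorem intervalBM_restrict_of_mem_measureClass (hN : N ≤ 0 ∨ 2 ≤ N) {D : ℝ≥0∞} {ξ : Measure ℝ}
    (hξ : ξ ∈ measureClass K N D) (l r : ℝ) : IntervalBM K N (ξ.restrict (Icc l r)) := by
  obtain ⟨hfin, hBM, -⟩ := hξ
  intro p₀ q₀ p₁ q₁ t θ ht hθ hv hcomp ha hb
  simp only [measureReal_restrict_apply measurableSet_Ioo,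
    measureReal_restrict_apply measurableSet_Icc] at ha hb ⊢
  set A₀ := Icc p₀ q₀ ∩ Icc l r
  set A₁ := Icc p₁ q₁ ∩ Icc l r
  have hc₀ : IsCompact A₀ := isCompact_Icc.inter_right isClosed_Icc
  have hc₁ : IsCompact A₁ := isCompact_Icc.inter_right isClosed_Icc
  have hle₀ : ξ.real (Ioo p₀ q₀ ∩ Icc l r) ≤ ξ.real A₀ :=
    measureReal_mono (inter_subset_inter_left _ Ioo_subset_Icc_self)
  have hle₁ : ξ.real (Ioo p₁ q₁ ∩ Icc l r) ≤ ξ.real A₁ :=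
    measureReal_mono (inter_subset_inter_left _ Ioo_subset_Icc_self)
  have hpos₀ := ha.trans_le hle₀
  have hpos₁ := hb.trans_le hle₁
  have h := hBM A₀ A₁ hc₀ hc₁ t ⟨ht.1.le, ht.2.le⟩
  have hcd : CompareDist K θ (theta K A₀ A₁) :=
    compareDist_theta_of_forall (nonempty_of_measureReal_pos hpos₀)
      (nonempty_of_measureReal_pos hpos₁) fun x hx y hy => hcomp x hx.1 y hy.1
  have hvθ : Valid K N (theta K A₀ A₁) := by
    rcases lt_trichotomy K 0 with hK | hK | hK
    · exact hv.of_le theta_nonneg (hcd.2 hK)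
    · exact valid_of_eq_zero hK
    · by_contra hcon
      rw [distortedMeasureMean_of_not_valid hcon hpos₀ hpos₁, if_pos hK] at h
      exact measure_ne_top _ _ (top_le_iff.1 h)
  rw [distortedMeasureMean_eq_ofReal hvθ hpos₀ hpos₁] at h
  have hsub : (1 - t) • A₀ + t • A₁ ⊆
      Icc ((1 - t) * p₀ + t * p₁) ((1 - t) * q₀ + t * q₁) ∩ Icc l r := by
    rintro _ ⟨_, ⟨x, hx, rfl⟩, _, ⟨y, hy, rfl⟩, rfl⟩
    have ht' : t ∈ Icc (0 : ℝ) 1 := ⟨ht.1.le, ht.2.le⟩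
    refine ⟨combination_mem_Icc ht' hx.1 hy.1, ?_⟩
    have := combination_mem_Icc ht' hx.2 hy.2
    simpa [← add_mul] using this
  calc _ ≤ mMean K N t θ (ξ.real A₀) (ξ.real A₁) := mMean_mono ht hθ hv ha hb hle₀ hle₁
    _ ≤ mMean K N t (theta K A₀ A₁) (ξ.real A₀) (ξ.real A₁) :=
      mMean_le_of_compareDist hN ht theta_nonneg hθ hvθ hv hcd hpos₀ hpos₁
    _ ≤ ξ.real ((1 - t) • A₀ + t • A₁) :=
      (ENNReal.ofReal_le_iff_le_toReal (measure_ne_top _ _)).1 h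
    _ ≤ _ := measureReal_mono hsub

/-- Model measures belong to the class. The equality at `t = 0` also forces the distances between
interior points of the support to be valid: the mean at an invalid distance is `0` or `∞`. -/
theorem mem_measureClass_of_mem_modelClass (hN : N ≤ 0 ∨ 2 ≤ N) {D : ℝ≥0∞} {ξ : Measure ℝ}
    (hξ : ξ ∈ modelClass K N D) : ξ ∈ measureClass K N D := by
  obtain ⟨hfin, hne, hord, ⟨J, hJm, hJ0, rfl, hJ⟩, hdiam⟩ := hξ
  refine ⟨hfin, ?_, hdiam⟩
  set S := (volume.withDensity fun x => ENNReal.ofReal (J x)).support with hS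
  have hIm : MeasurableSet (interior S) := isOpen_interior.measurableSet
  have hnull : (volume.withDensity fun x => ENNReal.ofReal (J x)) (interior S)ᶜ = 0 := by
    have hsub : (interior S)ᶜ ⊆ Sᶜ ∪ frontier S := by
      intro x hx
      by_cases hxS : x ∈ S
      · exact Or.inr ⟨subset_closure hxS, hx⟩
      · exact Or.inl hxS
    refine measure_mono_null hsub (measure_union_null Measure.measure_compl_support ?_)
    exact withDensity_absolutelyContinuous _ _ (hord.convex.addHaar_frontier volume)
  have hrestr := Measure.restrict_eq_self_of_ae_mem
    (μ := volume.withDensity fun x => ENNReal.ofReal (J x))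
    (s := interior S) (by rw [ae_iff]; exact hnull)
  have hxi : (volume.withDensity fun x => ENNReal.ofReal (J x)) =
      densityMeasure ((interior S).indicator J) := by
    rw [← hrestr, restrict_withDensity hIm, ← withDensity_indicator hIm, densityMeasure]
    congr with x
    by_cases hx : x ∈ interior S <;> simp [hx]
  have hpos : ∀ {x}, 0 < (interior S).indicator J x → x ∈ interior S ∧
    (interior S).indicator J x = J x := by
    intro x hx
    have hmem : x ∈ interior S := by
      by_contra hcon; simp [hcon] at hx
    exact ⟨hmem, indicator_of_mem hmem _⟩
  have hCD : IsCDDensity K N ((interior S).indicator J) := by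
    refine ⟨fun x => indicator_nonneg (fun x _ => hJ0 x) x, fun x y hx hy => ?_⟩
    obtain ⟨hxI, hxe⟩ := hpos hx
    obtain ⟨hyI, hye⟩ := hpos hy
    rw [hxe] at hx
    rw [hye] at hy
    have hv : Valid K N |y - x| := by
      by_contra hcon
      have h := hJ x hxI y hyI 0 (by simp)
      rw [distortedMean_of_not_valid hN hcon hx hy] at h
      simp only [sub_zero, one_mul, zero_mul, add_zero] at h
      split_ifs at h
      · exact ENNReal.ofReal_ne_top h
      · exact absurd (ENNReal.ofReal_eq_zero.1 h) (not_le.2 hx)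
    refine ⟨hv, fun t ht => ?_⟩
    have h := hJ x hxI y hyI t ⟨ht.1.le, ht.2.le⟩
    rw [distortedMean_eq_ofReal hN hv hx hy] at h
    have hmem : (1 - t) * x + t * y ∈ interior S := by
      have := hord.convex.interior hxI hyI (by linarith [ht.2] : 0 ≤ 1 - t) ht.1.le (by ring)
      simpa using this
    rw [indicator_of_mem hmem, hxe, hye]
    rw [ENNReal.ofReal_eq_ofReal_iff (hJ0 _) (dMean_pos ht (abs_nonneg _) hv hx hy).le] at h
    exact h.ge
  have hmeas : Measurable ((interior S).indicator J) := hJm.indicator hIm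
  rw [hxi] at hfin ⊢
  intro A₀ A₁ hA₀ hA₁ t ht
  set ξ := densityMeasure ((interior S).indicator J) with hξdef
  rcases (measureReal_nonneg (μ := ξ) (s := A₀)).eq_or_lt with ha | ha
  · rw [distortedMeasureMean_of_mul_eq_zero (by rw [← ha, zero_mul])]; exact zero_le
  rcases (measureReal_nonneg (μ := ξ) (s := A₁)).eq_or_lt with hb | hb
  · rw [distortedMeasureMean_of_mul_eq_zero (by rw [← hb, mul_zero])]; exact zero_le
  obtain ⟨x₁, hx₁⟩ := nonempty_of_measureReal_pos ha
  obtain ⟨y₁, hy₁⟩ := nonempty_of_measureReal_pos hb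
  by_cases hv : Valid K N (theta K A₀ A₁)
  · rw [distortedMeasureMean_eq_ofReal hv ha hb,
      ENNReal.ofReal_le_iff_le_toReal (measure_ne_top _ _)]
    show _ ≤ ξ.real _
    have hsub : ∀ x ∈ A₀, ∀ y ∈ A₁, (1 - t) * x + t * y ∈ (1 - t) • A₀ + t • A₁ :=
      fun x hx y hy => ⟨_, ⟨x, hx, rfl⟩, _, ⟨y, hy, rfl⟩, rfl⟩
    rcases ht.1.eq_or_lt with rfl | ht0
    · refine (mMean_zero_le theta_nonneg hv ha).trans (measureReal_mono fun x hx => ?_)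
      simpa using hsub x hx y₁ hy₁
    rcases ht.2.eq_or_lt with rfl | ht1
    · refine (mMean_one_le theta_nonneg hv hb).trans (measureReal_mono fun y hy => ?_)
      simpa using hsub x₁ hx₁ y hy
    have hcomp : IsCompact ((1 - t) • A₀ + t • A₁) := (hA₀.smul _).add (hA₁.smul _)
    exact hCD.measure_ge hN hmeas.aemeasurable ⟨ht0, ht1⟩ theta_nonneg hv hA₀.measurableSet
      hA₁.measurableSet hcomp.measurableSet hsub
      (fun x hx y hy => compareDist_theta hA₀ hA₁ hx hy) ha hb
  · rw [distortedMeasureMean_of_not_valid hv ha hb]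
    split_ifs with hK
    · exfalso
      have hex : ∀ {A : Set ℝ}, MeasurableSet A → 0 < ξ.real A →
          ∃ x ∈ A, 0 < (interior S).indicator J x := by
        intro A hA hpos
        by_contra! hcon
        have : ξ A = 0 := by
          rw [hξdef, densityMeasure_apply hA, setLIntegral_congr_fun (g := fun _ => 0) hA]
          · simp
          · intro x hx; exact ENNReal.ofReal_eq_zero.2 (hcon x hx)
        simp [Measure.real, this] at hpos
      obtain ⟨x, hx, hxJ⟩ := hex hA₀.measurableSet ha
      obtain ⟨y, hy, hyJ⟩ := hex hA₁.measurableSet hb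
      exact hv ((hCD.2 x y hxJ hyJ).1.of_le theta_nonneg
        ((compareDist_theta hA₀ hA₁ hx hy).1 hK.le))
    · exact zero_le

end

/-! ### Structure of the measures satisfying the Brunn–Minkowski condition -/

/-- The lower density of a measure on the line with respect to Lebesgue measure. -/
noncomputable def lowerDensity (ξ : Measure ℝ) (x : ℝ) : ℝ≥0∞ :=
  liminf (fun r => ξ (Metric.closedBall x r) / volume (Metric.closedBall x r)) (𝓝[>] 0)

theorem lowerDensity_ae_eq_rnDeriv (ξ : Measure ℝ) [IsFiniteMeasure ξ] :
    lowerDensity ξ =ᵐ[volume] ξ.rnDeriv volume := by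
  filter_upwards [Besicovitch.ae_tendsto_rnDeriv ξ volume] with x hx using hx.liminf_eq

theorem tendsto_const_mul_nhdsGT_zero {s : ℝ} (hs : 0 < s) :
    Tendsto (fun r => s * r) (𝓝[>] 0) (𝓝[>] 0) := by
  refine tendsto_nhdsWithin_iff.2 ⟨?_, ?_⟩
  · have : Tendsto (fun r => s * r) (𝓝 0) (𝓝 (s * 0)) := tendsto_id.const_mul s
    rw [mul_zero] at this
    exact this.mono_left nhdsWithin_le_nhds
  · filter_upwards [self_mem_nhdsWithin] with r hr using mul_pos hs hr

theorem eventually_mul_le_measureReal_Ioo {ξ : Measure ℝ} [IsFiniteMeasure ξ] {x c : ℝ}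
    (hc : 0 < c) (h : ENNReal.ofReal c < lowerDensity ξ x) :
    ∀ᶠ r in 𝓝[>] (0 : ℝ), 2 * r * c ≤ ξ.real (Ioo (x - r) (x + r)) := by
  obtain ⟨c', hc'0, hcc', hc'⟩ := ENNReal.lt_iff_exists_real_btwn.1 h
  have hlt : c < c' := (ENNReal.ofReal_lt_ofReal_iff_of_nonneg hc.le).1 hcc'
  have hcpos := hc.trans hlt
  have hs : 0 < c / c' := div_pos hc hcpos
  have hev := (tendsto_const_mul_nhdsGT_zero hs).eventually (eventually_lt_of_lt_liminf hc')
  filter_upwards [hev, self_mem_nhdsWithin] with r hr hr0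
  have hr0 : 0 < r := hr0
  rw [Real.volume_closedBall, ENNReal.lt_div_iff_mul_lt (Or.inl (by simp; positivity))
    (Or.inl ENNReal.ofReal_ne_top),
    ← ENNReal.ofReal_mul hcpos.le] at hr
  have hsub : Metric.closedBall x (c / c' * r) ⊆ Ioo (x - r) (x + r) := by
    rw [Real.closedBall_eq_Icc]
    have : c / c' * r < r := by
      have : c / c' < 1 := (div_lt_one hcpos).2 hlt
      nlinarith
    intro z hz
    exact ⟨by linarith [hz.1], by linarith [hz.2]⟩
  have h1 := (ENNReal.ofReal_le_iff_le_toReal (measure_ne_top _ _)).1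
    (hr.le.trans (measure_mono hsub))
  refine le_trans (le_of_eq ?_) h1
  field_simp

theorem mem_Icc_of_lowerDensity_ne_zero {ξ : Measure ℝ} {l r x : ℝ} (hlr : ξ (Icc l r)ᶜ = 0)
    (hx : lowerDensity ξ x ≠ 0) : x ∈ Icc l r := by
  by_contra hcon
  refine hx ?_
  obtain ⟨ε, hε, hball⟩ := Metric.isOpen_iff.1 isClosed_Icc.isOpen_compl x hcon
  have : (fun r => ξ (Metric.closedBall x r) / volume (Metric.closedBall x r)) =ᶠ[𝓝[>] 0]
      fun _ => 0 := by
    filter_upwards [Ioo_mem_nhdsGT hε] with ρ hρ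
    rw [measure_mono_null ((Metric.closedBall_subset_ball hρ.2).trans hball) hlr, ENNReal.zero_div]
  rw [lowerDensity, liminf_congr this, liminf_const]

section

variable {K : ℝ} {N : WithTop ℝ} {ξ : Measure ℝ} [IsFiniteMeasure ξ]

/-- The Brunn–Minkowski condition for small intervals around two points, with lengths chosen so that
Hölder's inequality is an equality, gives the density condition for the lower density. -/
theorem IntervalBM.ofReal_dMean_le_lowerDensity (hN : N ≤ 0 ∨ 2 ≤ N) (hξ : IntervalBM K N ξ)
    {x₀ x₁ c₀ c₁ t θ : ℝ} (hc₀ : 0 < c₀) (hc₁ : 0 < c₁)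
    (h₀ : ENNReal.ofReal c₀ < lowerDensity ξ x₀) (h₁ : ENNReal.ofReal c₁ < lowerDensity ξ x₁)
    (ht : t ∈ Ioo (0 : ℝ) 1) (hθ : 0 ≤ θ) (hv : Valid K N θ) (hlt : 0 ≤ K → θ < |x₁ - x₀|)
    (hgt : K < 0 → |x₁ - x₀| < θ) :
    ENNReal.ofReal (dMean K N t θ c₀ c₁) ≤ lowerDensity ξ ((1 - t) * x₀ + t * x₁) := by
  obtain ⟨r₀, r₁, hr₀, hr₁, hr⟩ := exists_mMean_eq_dMean_mul hN ht hθ hv hc₀ hc₁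
  have ht0 := ht.1
  have ht1 := (one_sub_mem ht).1
  set R := (1 - t) * r₀ + t * r₁ with hR
  have hRpos : 0 < R := by positivity
  have e₀ := (tendsto_const_mul_nhdsGT_zero (s := r₀ / R) (by positivity)).eventually
    (eventually_mul_le_measureReal_Ioo hc₀ h₀)
  have e₁ := (tendsto_const_mul_nhdsGT_zero (s := r₁ / R) (by positivity)).eventually
    (eventually_mul_le_measureReal_Ioo hc₁ h₁)
  have hgap : 0 < |θ - (|x₁ - x₀|)| := by
    rw [abs_pos, sub_ne_zero]
    rcases le_or_gt 0 K with hK | hK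
    · exact (hlt hK).ne
    · exact (hgt hK).ne'
  have e₂ : ∀ᶠ ρ in 𝓝[>] (0 : ℝ), (r₀ / R + r₁ / R) * ρ < |θ - (|x₁ - x₀|)| := by
    have := (tendsto_const_mul_nhdsGT_zero (s := r₀ / R + r₁ / R) (by positivity)).mono_right
      nhdsWithin_le_nhds
    exact this.eventually_lt_const hgap
  refine le_liminf_of_le (by isBoundedDefault) ?_
  filter_upwards [e₀, e₁, e₂, self_mem_nhdsWithin] with ρ h₀ h₁ h₂ hρ
  have hρ : 0 < ρ := hρ
  have p₀ : 0 < r₀ / R * ρ := by positivity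
  have p₁ : 0 < r₁ / R * ρ := by positivity
  have q₀ : 0 < 2 * (r₀ / R * ρ) * c₀ := by positivity
  have q₁ : 0 < 2 * (r₁ / R * ρ) * c₁ := by positivity
  have hBM := hξ (x₀ - r₀ / R * ρ) (x₀ + r₀ / R * ρ) (x₁ - r₁ / R * ρ)
    (x₁ + r₁ / R * ρ) t θ ht hθ hv
    (by
      intro x hx y hy
      have hd : |(|y - x|) - (|x₁ - x₀|)| ≤ (r₀ / R + r₁ / R) * ρ := by
        refine (abs_abs_sub_abs_le_abs_sub _ _).trans (abs_le.2 ⟨?_, ?_⟩) <;>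
          linarith [hx.1, hx.2, hy.1, hy.2]
      have hd' := abs_le.1 (hd.trans h₂.le)
      refine ⟨fun hK => ?_, fun hK => ?_⟩
      · rw [abs_of_neg (sub_neg.2 (hlt hK))] at hd'; linarith [hd'.1]
      · rw [abs_of_pos (sub_pos.2 (hgt hK))] at hd'; linarith [hd'.2])
    (q₀.trans_le h₀) (q₁.trans_le h₁)
  have hm := mMean_mono ht hθ hv q₀ q₁ h₀ h₁ |>.trans hBM
  have hsm : mMean K N t θ (2 * (r₀ / R * ρ) * c₀) (2 * (r₁ / R * ρ) * c₁) =
      2 * ρ * dMean K N t θ c₀ c₁ := by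
    rw [show 2 * (r₀ / R * ρ) * c₀ = 2 * ρ / R * (r₀ * c₀) by ring,
      show 2 * (r₁ / R * ρ) * c₁ = 2 * ρ / R * (r₁ * c₁) by ring,
      mMean_smul ht hθ hv (by positivity) (by positivity) (by positivity), hr]
    field_simp
  rw [hsm] at hm
  have hset : Icc ((1 - t) * (x₀ - r₀ / R * ρ) + t * (x₁ - r₁ / R * ρ))
      ((1 - t) * (x₀ + r₀ / R * ρ) + t * (x₁ + r₁ / R * ρ)) =
      Metric.closedBall ((1 - t) * x₀ + t * x₁) ρ := by
    have hRρ : (1 - t) * (r₀ / R * ρ) + t * (r₁ / R * ρ) = ρ := by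
      rw [show (1 - t) * (r₀ / R * ρ) + t * (r₁ / R * ρ) = R / R * ρ by rw [hR]; ring,
        div_self hRpos.ne', one_mul]
    rw [Real.closedBall_eq_Icc]
    congr 1 <;> linarith
  rw [hset] at hm
  have hdp := dMean_pos ht hθ hv hc₀ hc₁
  rw [Real.volume_closedBall, ENNReal.le_div_iff_mul_le (Or.inl (by simp; positivity))
    (Or.inl ENNReal.ofReal_ne_top),
    ← ENNReal.ofReal_mul hdp.le]
  refine ENNReal.ofReal_le_of_le_toReal ?_
  rw [mul_comm]
  exact hm

/-- A valid distance on the strictly admissible side of `|x₁ - x₀|`; the strict inequality leaves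
room for small intervals around the two points. -/
theorem exists_comparison_distance {l r : ℝ} (hD : K < 0 → Valid K N (r - l)) {x₀ x₁ : ℝ}
    (h₀ : x₀ ∈ Icc l r) (h₁ : x₁ ∈ Icc l r) (hne : x₀ ≠ x₁) :
    ∃ θ, 0 ≤ θ ∧ Valid K N θ ∧ (0 ≤ K → θ < |x₁ - x₀|) ∧ (K < 0 → |x₁ - x₀| < θ) := by
  have hpos : 0 < |x₁ - x₀| := abs_pos.2 (sub_ne_zero.2 hne.symm)
  rcases le_or_gt 0 K with hK | hK
  · exact ⟨0, le_rfl, valid_zero, fun _ => hpos, fun h => absurd h (not_lt.2 hK)⟩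
  · have hle : |x₁ - x₀| ≤ r - l := abs_le.2 ⟨by linarith [h₀.2, h₁.1], by linarith [h₀.1, h₁.2]⟩
    have hopen : IsOpen {θ | Valid K N θ} :=
      isOpen_lt (f := fun θ => delta K N * θ ^ 2) (by fun_prop) continuous_const
    have hnear : ∀ᶠ θ in 𝓝[>] (r - l), Valid K N θ :=
      nhdsWithin_le_nhds (hopen.mem_nhds (hD hK))
    obtain ⟨θ, hvθ, hθ⟩ := (hnear.and self_mem_nhdsWithin).exists
    have hθ : r - l < θ := hθ
    exact ⟨θ, by linarith, hvθ, fun h => absurd hK (not_lt.2 h), fun _ => by linarith⟩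

theorem lintegral_lowerDensity_lt_top : ∫⁻ x, lowerDensity ξ x < ∞ := by
  rw [lintegral_congr_ae (lowerDensity_ae_eq_rnDeriv ξ)]
  exact Measure.lintegral_rnDeriv_lt_top ξ volume

/-- At a point of infinite density the density condition would force a non-integrable singularity
of order `1 / |z - x₀|`, unless the density vanishes at all other points. -/
theorem IntervalBM.lowerDensity_eq_zero (hN : N ≤ 0 ∨ 2 ≤ N) (hξ : IntervalBM K N ξ) {l r : ℝ}
    (hlr : ξ (Icc l r)ᶜ = 0) (hD : K < 0 → Valid K N (r - l)) {x₀ x₁ : ℝ}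
    (h₀ : lowerDensity ξ x₀ = ∞) (hne : x₁ ≠ x₀) : lowerDensity ξ x₁ = 0 := by
  by_contra hcon
  have hm₀ := mem_Icc_of_lowerDensity_ne_zero hlr (x := x₀) (by simp [h₀])
  have hm₁ := mem_Icc_of_lowerDensity_ne_zero hlr hcon
  obtain ⟨θ, hθ, hv, hlt, hgt⟩ := exists_comparison_distance hD hm₀ hm₁ hne.symm
  obtain ⟨b, hb0, hb', hb⟩ := ENNReal.lt_iff_exists_real_btwn.1 (pos_iff_ne_zero.2 hcon)
  have hbpos : 0 < b := ENNReal.ofReal_pos.1 hb'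
  obtain ⟨c, hc, hct⟩ := exists_div_le_dMean hN hθ hv hbpos
  have hlow : ∀ t ∈ Ioo (0 : ℝ) 1, ENNReal.ofReal (c / t) ≤
    lowerDensity ξ ((1 - t) * x₀ + t * x₁) := by
    intro t ht
    obtain ⟨A, hA, hAt⟩ := hct t ht
    exact (ENNReal.ofReal_le_ofReal hAt).trans (hξ.ofReal_dMean_le_lowerDensity hN hA hbpos
      (by simp [h₀]) hb ht hθ hv hlt hgt)
  have hsub : x₁ - x₀ ≠ 0 := sub_ne_zero.2 hne
  have hpos : 0 < |x₁ - x₀| := abs_pos.2 hsub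
  have hz : ∀ z ∈ uIoc x₀ x₁, z ≠ x₀ → z ≠ x₁ →
      ENNReal.ofReal (c * |x₁ - x₀|) * ‖(z - x₀)⁻¹‖ₑ ≤ lowerDensity ξ z := by
    intro z hz hz0 hz1
    have ht : (z - x₀) / (x₁ - x₀) ∈ Ioo (0 : ℝ) 1 := by
      rcases hne.lt_or_gt with h | h
      · rw [uIoc_of_ge h.le] at hz
        have hz2 := lt_of_le_of_ne hz.2 hz0
        refine ⟨div_pos_of_neg_of_neg (by linarith) (by linarith), ?_⟩
        rw [div_lt_one_of_neg (by linarith)]; linarith [hz.1]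
      · rw [uIoc_of_le h.le] at hz
        have hz2 := lt_of_le_of_ne hz.2 hz1
        exact ⟨div_pos (by linarith [hz.1]) (by linarith), by
          rw [div_lt_one (by linarith)]; linarith⟩
    have := hlow _ ht
    have e : (1 - (z - x₀) / (x₁ - x₀)) * x₀ + (z - x₀) / (x₁ - x₀) * x₁ = z := by
      field_simp; ring
    rw [e] at this
    refine le_of_eq_of_le ?_ this
    rw [← ofReal_norm, ← ENNReal.ofReal_mul (by positivity), Real.norm_eq_abs, abs_inv]
    congr 1
    rw [← abs_of_pos ht.1, abs_div, div_div_eq_mul_div, div_eq_mul_inv]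
  have hfin : ∫⁻ z in uIoc x₀ x₁, ENNReal.ofReal (c * |x₁ - x₀|) * ‖(z - x₀)⁻¹‖ₑ < ∞ := by
    refine lt_of_le_of_lt ?_ (lintegral_lowerDensity_lt_top (ξ := ξ))
    refine le_trans (lintegral_mono_ae ?_) (setLIntegral_le_lintegral (uIoc x₀ x₁) _)
    have h1 : ∀ᵐ z ∂volume.restrict (uIoc x₀ x₁), z ≠ x₁ :=
      ae_restrict_of_ae (by simp [ae_iff])
    have h0 : ∀ᵐ z ∂volume.restrict (uIoc x₀ x₁), z ≠ x₀ :=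
      ae_restrict_of_ae (by simp [ae_iff])
    filter_upwards [h0, h1, ae_restrict_mem measurableSet_uIoc] with z hz0 hz1 hz2
      using hz z hz2 hz0 hz1
  rw [lintegral_const_mul' _ _ ENNReal.ofReal_ne_top] at hfin
  have hfin' : ∫⁻ z in uIoc x₀ x₁, ‖(z - x₀)⁻¹‖ₑ < ∞ := by
    refine lt_of_mul_lt_mul_left' (a := ENNReal.ofReal (c * |x₁ - x₀|)) (lt_of_lt_of_eq hfin ?_)
    rw [ENNReal.mul_top]; simp; positivity
  have hint : IntervalIntegrable (fun z => (z - x₀)⁻¹) volume x₀ x₁ := by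
    rw [intervalIntegrable_iff]
    exact ⟨(by fun_prop : Measurable fun z : ℝ => (z - x₀)⁻¹).aestronglyMeasurable, hfin'⟩
  rcases intervalIntegrable_sub_inv_iff.1 hint with h | h
  · exact hne h.symm
  · exact h left_mem_uIcc

/-- The singular part is carried by the points of infinite lower density, by differentiation of
Lebesgue measure with respect to it. -/
theorem singularPart_ae_lowerDensity_eq_top :
    ∀ᵐ x ∂(ξ.singularPart volume), lowerDensity ξ x = ∞ := by
  set ν := ξ.singularPart volume with hν
  have hzero : (volume : Measure ℝ).rnDeriv ν =ᵐ[ν] 0 :=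
    Measure.rnDeriv_eq_zero _ _ |>.2 (Measure.mutuallySingular_singularPart ξ volume).symm
  filter_upwards [Besicovitch.ae_tendsto_rnDeriv volume ν, hzero] with x hx hx0
  rw [hx0] at hx
  have hinv := tendsto_inv_iff.2 hx
  simp only [Pi.zero_apply, ENNReal.inv_zero] at hinv
  have hle : liminf (fun r => ν (Metric.closedBall x r) / volume (Metric.closedBall x r)) (𝓝[>] 0) ≤
      lowerDensity ξ x := by
    refine liminf_le_liminf (Eventually.of_forall fun r => ?_)
    gcongr
    exact Measure.singularPart_le ξ volume
  refine top_le_iff.1 (le_trans (le_of_eq ?_) hle)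
  symm
  refine (hinv.congr' ?_).liminf_eq
  filter_upwards [self_mem_nhdsWithin] with r hr
  have hr : 0 < r := hr
  rw [ENNReal.inv_div (Or.inl (measure_ne_top _ _))]
  right
  simpa using hr

/-- A finite measure satisfying the Brunn–Minkowski condition is a point mass or has a density
satisfying the pointwise curvature-dimension condition. -/
theorem IntervalBM.dirac_or_density (hN : N ≤ 0 ∨ 2 ≤ N) (hξ : IntervalBM K N ξ) {l r : ℝ}
    (hlr : ξ (Icc l r)ᶜ = 0) (hD : K < 0 → Valid K N (r - l)) :
    (∃ x, ξ = ξ univ • Measure.dirac x) ∨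
      ∃ J : ℝ → ℝ, IsCDDensity K N J ∧ AEMeasurable J ∧ ξ = densityMeasure J ∧
        ∀ x, 0 < J x → x ∈ Icc l r := by
  have hsing := singularPart_ae_lowerDensity_eq_top (ξ := ξ)
  have hdec := Measure.haveLebesgueDecomposition_add ξ volume
  by_cases hex : ∃ x, lowerDensity ξ x = ∞
  · left
    -- The density vanishes off `x`, so the absolutely continuous part is zero and the
    -- singular part is concentrated at `x`.
    obtain ⟨x, hx⟩ := hex
    refine ⟨x, ?_⟩
    have hzero : ∀ y, y ≠ x → lowerDensity ξ y = 0 := fun y hy =>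
      hξ.lowerDensity_eq_zero hN hlr hD hx hy
    have hrn : ξ.rnDeriv volume =ᵐ[volume] 0 := by
      have h1 : ∀ᵐ z : ℝ, z ≠ x := by simp [ae_iff]
      filter_upwards [lowerDensity_ae_eq_rnDeriv ξ, h1] with z hz hz1
      rw [← hz, hzero z hz1]; rfl
    have heq : ξ = ξ.singularPart volume := by
      conv_lhs => rw [hdec]
      rw [withDensity_congr_ae hrn, withDensity_zero, add_zero]
    have hae : ∀ᵐ y ∂ξ, y = x := by
      rw [heq]
      filter_upwards [hsing] with y hy
      by_contra hne
      rw [hzero y hne] at hy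
      exact ENNReal.zero_ne_top hy
    ext s hs
    rw [Measure.smul_apply, Measure.dirac_apply' _ hs, smul_eq_mul]
    by_cases hxs : x ∈ s
    · rw [indicator_of_mem hxs, Pi.one_apply, mul_one]
      refine measure_congr ?_
      filter_upwards [hae] with y hy
      subst hy
      exact propext ⟨fun _ => trivial, fun _ => hxs⟩
    · rw [indicator_of_notMem hxs, mul_zero]
      refine measure_mono_null (fun y hy => ?_) (ae_iff.1 hae)
      rintro rfl
      exact hxs hy
  · right
    push Not at hex
    have hs0 : ξ.singularPart volume = 0 := by
      rw [← ae_eq_bot, ← Filter.eventually_false_iff_eq_bot]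
      filter_upwards [hsing] with x hx using hex x hx
    have hpos : ∀ {x}, 0 < (lowerDensity ξ x).toReal → x ∈ Icc l r := fun {x} hx =>
      mem_Icc_of_lowerDensity_ne_zero hlr (by rintro h; simp [h] at hx)
    refine ⟨fun x => (lowerDensity ξ x).toReal, ⟨fun x => ENNReal.toReal_nonneg, ?_⟩, ?_, ?_,
      fun x hx => hpos hx⟩
    · intro x y hx hy
      rcases eq_or_ne x y with rfl | hne
      · rw [sub_self, abs_zero]
        refine ⟨valid_zero, fun t ht => ?_⟩
        rw [dMean_zero_self hN hx, ← add_mul, sub_add_cancel, one_mul]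
      have hd : 0 < |y - x| := abs_pos.2 (sub_ne_zero.2 hne.symm)
      have hxI := hpos hx
      have hyI := hpos hy
      have hlt : ∀ {z s : ℝ}, s ∈ Ioo (0 : ℝ) 1 → 0 < (lowerDensity ξ z).toReal →
          ENNReal.ofReal (s * (lowerDensity ξ z).toReal) < lowerDensity ξ z := by
        intro z s hs hz
        rw [ENNReal.ofReal_lt_iff_lt_toReal (mul_nonneg hs.1.le hz.le) (hex z)]
        nlinarith [hs.2]
      have key : ∀ {t θ s : ℝ}, t ∈ Ioo (0 : ℝ) 1 → s ∈ Ioo (0 : ℝ) 1 → 0 ≤ θ → Valid K N θ →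
          (0 ≤ K → θ < |y - x|) → (K < 0 → |y - x| < θ) →
          s * dMean K N t θ (lowerDensity ξ x).toReal (lowerDensity ξ y).toReal ≤
            (lowerDensity ξ ((1 - t) * x + t * y)).toReal := by
        intro t θ s ht hs hθ hv h1 h2
        rw [← dMean_smul hN ht hθ hv hx hy hs.1, ← ENNReal.ofReal_le_iff_le_toReal (hex _)]
        exact hξ.ofReal_dMean_le_lowerDensity hN (mul_pos hs.1 hx) (mul_pos hs.1 hy) (hlt hs hx)
          (hlt hs hy) ht hθ hv h1 h2
      have hv : Valid K N |y - x| := by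
        rcases le_or_gt 0 K with hK | hK
        · by_contra hcon
          obtain ⟨θ, hθ0, hθ, hvθ, hC⟩ := exists_lt_dMean_half hN hK hd.le hcon hx hy
            (2 * (lowerDensity ξ ((1 - 1 / 2) * x + 1 / 2 * y)).toReal)
          have := key (t := 1 / 2) (s := 1 / 2) (by norm_num) (by norm_num) hθ0 hvθ (fun _ => hθ)
            (fun h => absurd h (not_lt.2 hK))
          linarith
        · refine (hD hK).of_le hd.le (abs_le.2 ⟨?_, ?_⟩) <;>
            linarith [hxI.1, hxI.2, hyI.1, hyI.2]
      refine ⟨hv, fun t ht => ?_⟩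
      -- The comparison distance `θ` tends to `|y - x|` from the admissible side.
      have key' : ∀ θ, 0 ≤ θ → Valid K N θ → (0 ≤ K → θ < |y - x|) → (K < 0 → |y - x| < θ) →
          dMean K N t θ (lowerDensity ξ x).toReal (lowerDensity ξ y).toReal ≤
            (lowerDensity ξ ((1 - t) * x + t * y)).toReal := by
        intro θ hθ hvθ h1 h2
        set m := dMean K N t θ (lowerDensity ξ x).toReal (lowerDensity ξ y).toReal
        have hlim : Tendsto (fun s : ℝ => s * m) (𝓝[<] 1) (𝓝 (1 * m)) :=
          (tendsto_id.mul_const _).mono_left nhdsWithin_le_nhds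
        rw [one_mul] at hlim
        exact le_of_tendsto hlim (by
          filter_upwards [Ioo_mem_nhdsLT zero_lt_one] with s hs using key ht hs hθ hvθ h1 h2)
      have hcont := (continuousAt_dMean_dist ht hd hv hx hy).tendsto
      have hopen : IsOpen {θ | Valid K N θ} :=
        isOpen_lt (f := fun θ => delta K N * θ ^ 2) (by fun_prop) continuous_const
      have hnear : ∀ᶠ θ in 𝓝 |y - x|, Valid K N θ := hopen.mem_nhds hv
      rcases le_or_gt 0 K with hK | hK
      · refine le_of_tendsto (hcont.mono_left (nhdsWithin_le_nhds (s := Iio |y - x|))) ?_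
        filter_upwards [nhdsWithin_le_nhds hnear, Ioo_mem_nhdsLT hd] with θ hvθ hθ
        exact key' θ hθ.1.le hvθ (fun _ => hθ.2) fun h => absurd h (not_lt.2 hK)
      · refine le_of_tendsto (hcont.mono_left (nhdsWithin_le_nhds (s := Ioi |y - x|))) ?_
        filter_upwards [nhdsWithin_le_nhds hnear, self_mem_nhdsWithin] with θ hvθ hθ
        exact key' θ (hd.le.trans (le_of_lt hθ)) hvθ (fun h => absurd hK (not_lt.2 h)) fun _ => hθ
    · have : AEMeasurable (lowerDensity ξ) :=
        ⟨_, Measure.measurable_rnDeriv ξ volume, lowerDensity_ae_eq_rnDeriv ξ⟩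
      exact this.ennreal_toReal
    · conv_lhs => rw [hdec]
      rw [hs0, zero_add, densityMeasure, withDensity_congr_ae (lowerDensity_ae_eq_rnDeriv ξ).symm]
      congr with x
      exact (ENNReal.ofReal_toReal (hex x)).symm

end

/-! ### Compactness and extreme points -/

section

variable {K : ℝ} {N : WithTop ℝ}

/-- Probability measures on `[l, r]` satisfying the Brunn–Minkowski condition and the linear
constraint `∫ h dμ = 0`. -/
def constrainedClass (K : ℝ) (N : WithTop ℝ) (l r : ℝ) (h : ℝ →ᵇ ℝ) : Set (ProbabilityMeasure ℝ) :=
  {μ | (μ : Measure ℝ) (Icc l r)ᶜ = 0 ∧ IntervalBM K N (μ : Measure ℝ) ∧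
    ∫ x, h x ∂(μ : Measure ℝ) = 0}

theorem le_measure_of_tendsto_of_isClosed {L : Filter (ProbabilityMeasure ℝ)} [L.NeBot]
    {μ : ProbabilityMeasure ℝ} (hL : L ≤ 𝓝 μ) {F : Set ℝ} (hF : IsClosed F) {c : ℝ}
    (h : ∀ᶠ ν : ProbabilityMeasure ℝ in L, c ≤ (ν : Measure ℝ).real F) :
    c ≤ (μ : Measure ℝ).real F := by
  have h1 := ProbabilityMeasure.limsup_measure_closed_le_of_tendsto (tendsto_id'.2 hL) hF
  have h2 : ENNReal.ofReal c ≤ L.limsup fun ν : ProbabilityMeasure ℝ => (ν : Measure ℝ) F := by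
    refine le_trans (le_liminf_of_le (by isBoundedDefault) ?_) liminf_le_limsup
    filter_upwards [h] with ν hν using ENNReal.ofReal_le_of_le_toReal hν
  exact (ENNReal.ofReal_le_iff_le_toReal (measure_ne_top _ _)).1 (h2.trans h1)

theorem eventually_lt_measure_of_isOpen {L : Filter (ProbabilityMeasure ℝ)}
    {μ : ProbabilityMeasure ℝ} (hL : L ≤ 𝓝 μ) {G : Set ℝ} (hG : IsOpen G) {c : ℝ} (hc : 0 ≤ c)
    (h : c < (μ : Measure ℝ).real G) :
    ∀ᶠ ν : ProbabilityMeasure ℝ in L, c < (ν : Measure ℝ).real G := by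
  have h1 := ProbabilityMeasure.le_liminf_measure_open_of_tendsto (tendsto_id'.2 hL) hG
  have h2 : ENNReal.ofReal c < (μ : Measure ℝ) G :=
    (ENNReal.ofReal_lt_iff_lt_toReal hc (measure_ne_top _ _)).2 h
  filter_upwards [eventually_lt_of_lt_liminf (h2.trans_le h1)] with ν hν
  exact (ENNReal.ofReal_lt_iff_lt_toReal hc (measure_ne_top _ _)).1 hν

/-- The Brunn–Minkowski condition for intervals is weakly closed, by the portmanteau
inequalities. -/
theorem isClosed_setOf_intervalBM :
    IsClosed {μ : ProbabilityMeasure ℝ | IntervalBM K N (μ : Measure ℝ)} := by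
  rw [isClosed_iff_ultrafilter]
  intro μ u hu hmem p₀ q₀ p₁ q₁ t θ ht hθ hv hcomp ha hb
  set a := (μ : Measure ℝ).real (Ioo p₀ q₀)
  set b := (μ : Measure ℝ).real (Ioo p₁ q₁)
  have key : ∀ s ∈ Ioo (0 : ℝ) 1, s * mMean K N t θ a b ≤
      (μ : Measure ℝ).real (Icc ((1 - t) * p₀ + t * p₁) ((1 - t) * q₀ + t * q₁)) := by
    intro s hs
    have hsa : 0 < s * a := mul_pos hs.1 ha
    have hsb : 0 < s * b := mul_pos hs.1 hb
    refine le_measure_of_tendsto_of_isClosed hu isClosed_Icc ?_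
    filter_upwards [hmem, eventually_lt_measure_of_isOpen hu isOpen_Ioo hsa.le
      (by nlinarith [hs.2] : s * a < (μ : Measure ℝ).real (Ioo p₀ q₀)),
      eventually_lt_measure_of_isOpen hu isOpen_Ioo hsb.le
      (by nlinarith [hs.2] : s * b < (μ : Measure ℝ).real (Ioo p₁ q₁))] with ν hν h0 h1
    rw [← mMean_smul ht hθ hv ha hb hs.1]
    exact (mMean_mono ht hθ hv hsa hsb h0.le h1.le).trans
      (hν p₀ q₀ p₁ q₁ t θ ht hθ hv hcomp (hsa.trans h0) (hsb.trans h1))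
  have hlim : Tendsto (fun s : ℝ => s * mMean K N t θ a b) (𝓝[<] 1) (𝓝 (1 * mMean K N t θ a b)) :=
    (tendsto_id.mul_const _).mono_left nhdsWithin_le_nhds
  rw [one_mul] at hlim
  exact le_of_tendsto hlim (by filter_upwards [Ioo_mem_nhdsLT zero_lt_one] with s hs using key s hs)

theorem isClosed_constrainedClass {l r : ℝ} {h : ℝ →ᵇ ℝ} :
    IsClosed (constrainedClass K N l r h) := by
  have h1 : IsClosed {μ : ProbabilityMeasure ℝ | (μ : Measure ℝ) (Icc l r)ᶜ = 0} := by
    rw [isClosed_iff_ultrafilter]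
    intro μ u hu hmem
    by_contra hne
    have hpos : 0 < (μ : Measure ℝ).real (Icc l r)ᶜ := ENNReal.toReal_pos hne (measure_ne_top _ _)
    have hev := eventually_lt_measure_of_isOpen hu isClosed_Icc.isOpen_compl le_rfl hpos
    obtain ⟨ν, hν, hν'⟩ := (hev.and hmem).exists
    have hν' : (ν : Measure ℝ) (Icc l r)ᶜ = 0 := hν'
    simp [Measure.real, hν'] at hν
  have h2 : IsClosed {μ : ProbabilityMeasure ℝ | ∫ x, h x ∂(μ : Measure ℝ) = 0} :=
    isClosed_singleton.preimage
      (ProbabilityMeasure.continuous_integral_boundedContinuousFunction h)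
  exact h1.inter (isClosed_setOf_intervalBM.inter h2)

theorem isCompact_constrainedClass {l r : ℝ} {h : ℝ →ᵇ ℝ} :
    IsCompact (constrainedClass K N l r h) := by
  rw [← (isClosed_constrainedClass (K := K) (N := N) (l := l) (r := r) (h := h)).closure_eq]
  refine isCompact_closure_of_isTightMeasureSet ?_
  rw [isTightMeasureSet_iff_exists_isCompact_measure_compl_le]
  intro ε _
  refine ⟨Icc l r, isCompact_Icc, ?_⟩
  rintro _ ⟨μ, hμ, rfl⟩
  rw [hμ.1]
  exact zero_le

/-- Among the constrained measures that minimize `∫ g`, take an extreme one: it admits no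
nontrivial decomposition into constrained measures. -/
theorem exists_indecomposable {l r : ℝ} {h g : ℝ →ᵇ ℝ} {μ₀ : ProbabilityMeasure ℝ}
    (hμ₀ : μ₀ ∈ constrainedClass K N l r h) :
    ∃ μ ∈ constrainedClass K N l r h, ∫ x, g x ∂(μ : Measure ℝ) ≤ ∫ x, g x ∂(μ₀ : Measure ℝ) ∧
      ∀ μ₁ ∈ constrainedClass K N l r h, ∀ μ₂ ∈ constrainedClass K N l r h, ∀ m₁ m₂ : ℝ, 0 < m₁ →
        0 < m₂ → m₁ + m₂ = 1 →
        (μ : Measure ℝ) = ENNReal.ofReal m₁ • (μ₁ : Measure ℝ) +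
          ENNReal.ofReal m₂ • (μ₂ : Measure ℝ) →
        μ₁ = μ := by
  have hgc : Continuous fun μ : ProbabilityMeasure ℝ => ∫ x, g x ∂(μ : Measure ℝ) :=
    ProbabilityMeasure.continuous_integral_boundedContinuousFunction g
  obtain ⟨ν, hν, hmin⟩ := (isCompact_constrainedClass (K := K) (N := N) (l := l) (r := r)
    (h := h)).exists_isMinOn ⟨μ₀, hμ₀⟩ hgc.continuousOn
  set m := ∫ x, g x ∂(ν : Measure ℝ) with hm
  have hmin' : ∀ μ ∈ constrainedClass K N l r h, m ≤ ∫ x, g x ∂(μ : Measure ℝ) :=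
    fun μ hμ => hmin hμ
  set S := constrainedClass K N l r h ∩ {μ | ∫ x, g x ∂(μ : Measure ℝ) = m} with hS
  have hScomp : IsCompact S := isCompact_constrainedClass.inter_right
    (isClosed_singleton.preimage hgc)
  -- Embed the minimizers in a product of copies of `ℝ`, where extreme points exist.
  let Φ : ProbabilityMeasure ℝ → (ℝ →ᵇ ℝ) → ℝ := fun μ q => ∫ x, q x ∂(μ : Measure ℝ)
  have hΦ : Continuous Φ := continuous_pi fun q =>
    ProbabilityMeasure.continuous_integral_boundedContinuousFunction q
  have hinj : Function.Injective Φ := by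
    intro μ₁ μ₂ heq
    have : (μ₁ : Measure ℝ) = (μ₂ : Measure ℝ) :=
      ext_of_forall_integral_eq_of_IsFiniteMeasure fun q => congrFun heq q
    exact Subtype.ext this
  obtain ⟨z, hz⟩ := (hScomp.image hΦ).extremePoints_nonempty ⟨Φ ν, ν, ⟨hν, rfl⟩, rfl⟩
  rw [mem_extremePoints_iff_left] at hz
  obtain ⟨⟨μ, hμ, rfl⟩, hext⟩ := hz
  refine ⟨μ, hμ.1, hμ.2.le.trans (hmin' μ₀ hμ₀), ?_⟩
  intro μ₁ h₁ μ₂ h₂ m₁ m₂ hm₁ hm₂ hsum hdec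
  have hint : ∀ q : ℝ →ᵇ ℝ, Φ μ q = m₁ * Φ μ₁ q + m₂ * Φ μ₂ q := by
    intro q
    have i₁ : Integrable (fun x => q x) (ENNReal.ofReal m₁ • (μ₁ : Measure ℝ)) :=
      (q.integrable _).smul_measure ENNReal.ofReal_ne_top
    have i₂ : Integrable (fun x => q x) (ENNReal.ofReal m₂ • (μ₂ : Measure ℝ)) :=
      (q.integrable _).smul_measure ENNReal.ofReal_ne_top
    simp only [Φ]
    rw [hdec, integral_add_measure i₁ i₂, integral_smul_measure, integral_smul_measure,
      ENNReal.toReal_ofReal hm₁.le, ENNReal.toReal_ofReal hm₂.le, smul_eq_mul, smul_eq_mul]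
  have e : m = m₁ * Φ μ₁ g + m₂ * Φ μ₂ g := by rw [← hint g]; exact hμ.2.symm
  have l₁ : m ≤ Φ μ₁ g := hmin' μ₁ h₁
  have l₂ : m ≤ Φ μ₂ g := hmin' μ₂ h₂
  have hm' : m = m₁ * m + m₂ * m := by rw [← add_mul, hsum, one_mul]
  have g₁ : Φ μ₁ g = m := by nlinarith
  have g₂ : Φ μ₂ g = m := by nlinarith
  apply hinj
  refine hext (Φ μ₁) ⟨μ₁, ⟨h₁, g₁⟩, rfl⟩ (Φ μ₂) ⟨μ₂, ⟨h₂, g₂⟩, rfl⟩ ⟨m₁, m₂, hm₁, hm₂, hsum, ?_⟩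
  funext q
  exact (hint q).symm

end

/-! ### Model densities and cuts along them -/

/-- A function with values in `[0, ∞]` that satisfies the density condition with equality. The
equality is expressed by two inequalities, so as to include the values `0` and `∞`. -/
def IsCDExact (K : ℝ) (N : WithTop ℝ) (E : ℝ → ℝ≥0∞) : Prop :=
  ∀ x y t c₀ c₁ : ℝ, t ∈ Ioo (0 : ℝ) 1 → Valid K N |y - x| → 0 < c₀ → 0 < c₁ →
    (ENNReal.ofReal c₀ ≤ E x → ENNReal.ofReal c₁ ≤ E y →
      ENNReal.ofReal (dMean K N t |y - x| c₀ c₁) ≤ E ((1 - t) * x + t * y)) ∧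
    (E x ≤ ENNReal.ofReal c₀ → E y ≤ ENNReal.ofReal c₁ →
      E ((1 - t) * x + t * y) ≤ ENNReal.ofReal (dMean K N t |y - x| c₀ c₁))

/-- The solution of `y'' + κ y = 0` with `y(0) = 1` and `y'(0) = 0`. -/
noncomputable def cosK (κ z : ℝ) : ℝ :=
  if 0 < κ then Real.cos (√κ * z) else if κ = 0 then 1 else Real.cosh (√(-κ) * z)

/-- The solution of `y'' + κ y = 0` with `y(0) = 0` and `y'(0) > 0`, up to normalization. -/
noncomputable def sinK (κ z : ℝ) : ℝ :=
  if 0 < κ then Real.sin (√κ * z) else if κ = 0 then z else Real.sinh (√(-κ) * z)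

theorem continuous_cosK {κ : ℝ} : Continuous (cosK κ) := by
  unfold cosK; split_ifs <;> fun_prop

theorem continuous_sinK {κ : ℝ} : Continuous (sinK κ) := by
  unfold sinK; split_ifs <;> fun_prop

theorem cosK_zero {κ : ℝ} : cosK κ 0 = 1 := by unfold cosK; split_ifs <;> simp

theorem sinK_zero {κ : ℝ} : sinK κ 0 = 0 := by unfold sinK; split_ifs <;> simp

theorem sinK_neg {κ z : ℝ} : sinK κ (-z) = -sinK κ z := by unfold sinK; split_ifs <;> simp

theorem sinK_pos {κ z : ℝ} (hz : 0 < z) (hκ : κ * z ^ 2 < Real.pi ^ 2) : 0 < sinK κ z := by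
  unfold sinK
  split_ifs with h1 h2
  · rw [mul_comm]
    obtain ⟨h, h'⟩ := angle_mem_Ioo h1 hz hκ
    exact Real.sin_pos_of_pos_of_lt_pi h h'
  · exact hz
  · have : 0 < √(-κ) := Real.sqrt_pos.2 (by
      have := lt_of_le_of_ne (not_lt.1 h1) h2; linarith)
    exact Real.sinh_pos_iff.2 (by positivity)

theorem sin_add_mul_comb (A B u p q : ℝ) :
    Real.sin (p + q) * (A * Real.cos (u + q) + B * Real.sin (u + q)) =
      Real.sin p * (A * Real.cos u + B * Real.sin u) +
        Real.sin q * (A * Real.cos (u + (p + q)) + B * Real.sin (u + (p + q))) := by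
  simp only [Real.sin_add, Real.cos_add]
  have h := Real.sin_sq_add_cos_sq q
  linear_combination (Real.sin p * (A * Real.cos u + B * Real.sin u)) * h

theorem sinh_add_mul_comb (A B u p q : ℝ) :
    Real.sinh (p + q) * (A * Real.cosh (u + q) + B * Real.sinh (u + q)) =
      Real.sinh p * (A * Real.cosh u + B * Real.sinh u) +
        Real.sinh q * (A * Real.cosh (u + (p + q)) + B * Real.sinh (u + (p + q))) := by
  simp only [Real.sinh_add, Real.cosh_add]
  have h := Real.cosh_sq_sub_sinh_sq q
  linear_combination (Real.sinh p * (A * Real.cosh u + B * Real.sinh u)) * h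

theorem div_sin_abs (w c t : ℝ) :
    Real.sin (t * (|w| * c)) / Real.sin (|w| * c) = Real.sin (t * (w * c)) / Real.sin (w * c) := by
  rcases abs_choice w with h | h <;> rw [h]
  rw [neg_mul, mul_neg, Real.sin_neg, Real.sin_neg, neg_div_neg_eq]

theorem div_sinh_abs (w c t : ℝ) :
    Real.sinh (t * (|w| * c)) / Real.sinh (|w| * c) =
      Real.sinh (t * (w * c)) / Real.sinh (w * c) := by
  rcases abs_choice w with h | h <;> rw [h]
  rw [neg_mul, mul_neg, Real.sinh_neg, Real.sinh_neg, neg_div_neg_eq]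

/-- Solutions of `y'' + κ y = 0` are reproduced by the distortion coefficients. -/
theorem comb_cosK_sinK {K m A B x₀ x y t : ℝ} (hv : K / m * |y - x| ^ 2 < Real.pi ^ 2) :
    A * cosK (K / m) ((1 - t) * x + t * y - x₀) + B * sinK (K / m) ((1 - t) * x + t * y - x₀) =
      sigma K m (1 - t) |y - x| * (A * cosK (K / m) (x - x₀) + B * sinK (K / m) (x - x₀)) +
        sigma K m t |y - x| * (A * cosK (K / m) (y - x₀) + B * sinK (K / m) (y - x₀)) := by
  rcases eq_or_ne x y with rfl | hne
  · rw [sigma_of_mul_sq_eq_zero (by simp), sigma_of_mul_sq_eq_zero (by simp),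
      show (1 - t) * x + t * x - x₀ = x - x₀ by ring]
    ring
  have hd : 0 < |y - x| := abs_pos.2 (sub_ne_zero.2 hne.symm)
  rcases lt_trichotomy (K / m) 0 with hκ | hκ | hκ
  · have hs : 0 < √(-(K / m)) := Real.sqrt_pos.2 (by linarith)
    rw [sigma_of_neg _ hκ hd, sigma_of_neg _ hκ hd, div_sinh_abs, div_sinh_abs]
    simp only [cosK, sinK, hκ.not_gt, hκ.ne, if_false]
    have hne0 : Real.sinh ((y - x) * √(-(K / m))) ≠ 0 := by
      rw [Ne, Real.sinh_eq_zero]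
      exact mul_ne_zero (sub_ne_zero.2 hne.symm) hs.ne'
    have key := sinh_add_mul_comb A B (√(-(K / m)) * (x - x₀))
      ((1 - t) * ((y - x) * √(-(K / m)))) (t * ((y - x) * √(-(K / m))))
    rw [show (1 - t) * ((y - x) * √(-(K / m))) + t * ((y - x) * √(-(K / m))) =
      (y - x) * √(-(K / m)) by ring,
      show √(-(K / m)) * (x - x₀) + t * ((y - x) * √(-(K / m))) =
      √(-(K / m)) * ((1 - t) * x + t * y - x₀) by ring,
      show √(-(K / m)) * (x - x₀) + (y - x) * √(-(K / m)) = √(-(K / m)) * (y - x₀) by ring] at key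
    rw [div_mul_eq_mul_div, div_mul_eq_mul_div, ← add_div, ← key, mul_div_cancel_left₀ _ hne0]
  · rw [sigma_of_mul_sq_eq_zero (by simp [hκ]), sigma_of_mul_sq_eq_zero (by simp [hκ])]
    simp only [cosK, sinK, hκ, lt_irrefl, if_false, if_true]
    ring
  · have hs : 0 < √(K / m) := Real.sqrt_pos.2 hκ
    have hne0 : Real.sin ((y - x) * √(K / m)) ≠ 0 := by
      obtain ⟨h0, h1⟩ := angle_mem_Ioo hκ hd hv
      have hpos := Real.sin_pos_of_pos_of_lt_pi h0 h1
      rcases abs_choice (y - x) with h | h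
      · rw [h] at hpos; exact hpos.ne'
      · rw [h, neg_mul, Real.sin_neg] at hpos; intro h0; rw [h0] at hpos; simp at hpos
    rw [sigma_of_pos _ hκ hd, sigma_of_pos _ hκ hd, div_sin_abs, div_sin_abs]
    simp only [cosK, sinK, hκ, if_true]
    have key := sin_add_mul_comb A B (√(K / m) * (x - x₀))
      ((1 - t) * ((y - x) * √(K / m))) (t * ((y - x) * √(K / m)))
    rw [show (1 - t) * ((y - x) * √(K / m)) + t * ((y - x) * √(K / m)) =
      (y - x) * √(K / m) by ring,
      show √(K / m) * (x - x₀) + t * ((y - x) * √(K / m)) =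
      √(K / m) * ((1 - t) * x + t * y - x₀) by ring,
      show √(K / m) * (x - x₀) + (y - x) * √(K / m) = √(K / m) * (y - x₀) by ring] at key
    rw [div_mul_eq_mul_div, div_mul_eq_mul_div, ← add_div, ← key, mul_div_cancel_left₀ _ hne0]

/-- The model densities through the point `(x₀, e)`, parametrized by a slope `s`. For finite `N`
they are the powers `ℓ^{N-1}` of the solutions `ℓ` of `ℓ'' + K/(N-1) ℓ = 0`, where `0^{N-1} = ∞`
for `N < 1`. -/
noncomputable def modelDensity (K : ℝ) (N : WithTop ℝ) (x₀ e s x : ℝ) : ℝ≥0∞ :=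
  match N with
  | ⊤ => ENNReal.ofReal (e * Real.exp (s * (x - x₀) - K * (x - x₀) ^ 2 / 2))
  | (n : ℝ) => ENNReal.ofReal (e ^ (1 / (n - 1)) * cosK (K / (n - 1)) (x - x₀) +
      s * sinK (K / (n - 1)) (x - x₀)) ^ (n - 1)

theorem ofReal_rpow_inv_rpow {c m : ℝ} (hc : 0 < c) (hm : m ≠ 0) :
    ENNReal.ofReal (c ^ (1 / m)) ^ m = ENNReal.ofReal c := by
  rw [ENNReal.ofReal_rpow_of_pos (by positivity), ← Real.rpow_mul hc.le, one_div_mul_cancel hm,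
    Real.rpow_one]

theorem ofReal_rpow_le_ofReal_rpow {a b m : ℝ} (hm : 0 ≤ m) (hab : a ≤ b) :
    ENNReal.ofReal a ^ m ≤ ENNReal.ofReal b ^ m :=
  ENNReal.rpow_le_rpow (ENNReal.ofReal_le_ofReal hab) hm

theorem ofReal_rpow_le_ofReal_rpow_of_neg {a b m : ℝ} (hm : m ≤ 0) (hab : a ≤ b) :
    ENNReal.ofReal b ^ m ≤ ENNReal.ofReal a ^ m := by
  rw [← neg_neg m, ENNReal.rpow_neg, ENNReal.rpow_neg _ (-m), ENNReal.inv_le_inv]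
  exact ofReal_rpow_le_ofReal_rpow (by linarith) hab

theorem le_of_ofReal_rpow_le {a b m : ℝ} (hm : 0 < m) (ha : 0 < a)
    (h : ENNReal.ofReal a ^ m ≤ ENNReal.ofReal b ^ m) : a ≤ b := by
  rw [ENNReal.rpow_le_rpow_iff hm] at h
  by_contra hcon
  exact absurd ((ENNReal.ofReal_lt_ofReal_iff ha).2 (not_le.1 hcon)) (not_lt.2 h)

theorem le_of_ofReal_rpow_le' {a b m : ℝ} (hm : 0 < m) (hb : 0 < b)
    (h : ENNReal.ofReal a ^ m ≤ ENNReal.ofReal b ^ m) : a ≤ b := by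
  rw [ENNReal.rpow_le_rpow_iff hm] at h
  exact (ENNReal.ofReal_le_ofReal_iff hb.le).1 h

/-- For finite `N`, apply the identity for solutions of `ℓ'' + κ ℓ = 0` and the monotonicity of
`x ^ (N - 1)` on `[0, ∞]`. -/
theorem isCDExact_modelDensity {K : ℝ} {N : WithTop ℝ} (hN : N ≤ 0 ∨ 2 ≤ N) {x₀ e s : ℝ}
    (he : 0 < e) : IsCDExact K N (modelDensity K N x₀ e s) := by
  intro x y t c₀ c₁ ht hv hc₀ hc₁
  induction N using WithTop.recTopCoe with
  | top =>
    simp only [modelDensity]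
    have hx : 0 < e * Real.exp (s * (x - x₀) - K * (x - x₀) ^ 2 / 2) := by positivity
    have hy : 0 < e * Real.exp (s * (y - x₀) - K * (y - x₀) ^ 2 / 2) := by positivity
    have hexact : e * Real.exp (s * ((1 - t) * x + t * y - x₀) -
        K * ((1 - t) * x + t * y - x₀) ^ 2 / 2) = dMean K ⊤ t |y - x|
        (e * Real.exp (s * (x - x₀) - K * (x - x₀) ^ 2 / 2))
        (e * Real.exp (s * (y - x₀) - K * (y - x₀) ^ 2 / 2)) := by
      simp only [dMean]
      rw [Real.mul_rpow he.le (Real.exp_pos _).le, Real.mul_rpow he.le (Real.exp_pos _).le,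
        ← Real.exp_mul, ← Real.exp_mul]
      have : e ^ (1 - t) * e ^ t = e := by rw [← Real.rpow_add he, sub_add_cancel, Real.rpow_one]
      rw [show ∀ a b c d f : ℝ, a * b * (c * d) * f = a * c * (b * d * f) by intros; ring, this,
        ← Real.exp_add, ← Real.exp_add, sq_abs]
      congr 2
      ring
    rw [hexact]
    refine ⟨fun h0 h1 => ?_, fun h0 h1 => ?_⟩
    · rw [ENNReal.ofReal_le_ofReal_iff hx.le] at h0
      rw [ENNReal.ofReal_le_ofReal_iff hy.le] at h1
      exact ENNReal.ofReal_le_ofReal (dMean_mono hN ht (abs_nonneg _) hv hc₀ hc₁ h0 h1)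
    · rw [ENNReal.ofReal_le_ofReal_iff hc₀.le] at h0
      rw [ENNReal.ofReal_le_ofReal_iff hc₁.le] at h1
      exact ENNReal.ofReal_le_ofReal (dMean_mono hN ht (abs_nonneg _) hv hx hy h0 h1)
  | coe n =>
    simp only [modelDensity, dMean, powMean]
    rw [comb_cosK_sinK hv]
    set a := e ^ (1 / (n - 1)) * cosK (K / (n - 1)) (x - x₀) + s * sinK (K / (n - 1)) (x - x₀)
    set b := e ^ (1 / (n - 1)) * cosK (K / (n - 1)) (y - x₀) + s * sinK (K / (n - 1)) (y - x₀)
    have p₀ := sigma_pos_of_valid (one_sub_mem ht) (abs_nonneg _) hv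
    have p₁ := sigma_pos_of_valid ht (abs_nonneg _) hv
    have hm := (dim_sub_one (coe_le_zero_or_two_le.1 hN)).2
    set m := n - 1
    have q₀ : 0 < c₀ ^ (1 / m) := by positivity
    have q₁ : 0 < c₁ ^ (1 / m) := by positivity
    have hsum : ENNReal.ofReal ((sigma K m (1 - t) |y - x| * c₀ ^ (1 / m) +
        sigma K m t |y - x| * c₁ ^ (1 / m)) ^ m) =
        ENNReal.ofReal (sigma K m (1 - t) |y - x| * c₀ ^ (1 / m) +
          sigma K m t |y - x| * c₁ ^ (1 / m)) ^ m :=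
      (ENNReal.ofReal_rpow_of_pos (by positivity)).symm
    rw [hsum, ← ofReal_rpow_inv_rpow hc₀ hm, ← ofReal_rpow_inv_rpow hc₁ hm]
    rcases hm.lt_or_gt with hm | hm
    · have conv : ∀ {u v : ℝ}, ENNReal.ofReal u ^ m ≤ ENNReal.ofReal v ^ m →
          ENNReal.ofReal v ^ (-m) ≤ ENNReal.ofReal u ^ (-m) := by
        intro u v h
        rw [ENNReal.rpow_neg, ENNReal.rpow_neg, ENNReal.inv_le_inv]
        exact h
      refine ⟨fun h0 h1 => ?_, fun h0 h1 => ?_⟩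
      · have h0 := le_of_ofReal_rpow_le' (neg_pos.2 hm) q₀ (conv h0)
        have h1 := le_of_ofReal_rpow_le' (neg_pos.2 hm) q₁ (conv h1)
        exact ofReal_rpow_le_ofReal_rpow_of_neg hm.le (by gcongr)
      · have h0 := le_of_ofReal_rpow_le (neg_pos.2 hm) q₀ (conv h0)
        have h1 := le_of_ofReal_rpow_le (neg_pos.2 hm) q₁ (conv h1)
        exact ofReal_rpow_le_ofReal_rpow_of_neg hm.le (by gcongr)
    · refine ⟨fun h0 h1 => ?_, fun h0 h1 => ?_⟩
      · have h0 := le_of_ofReal_rpow_le hm q₀ h0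
        have h1 := le_of_ofReal_rpow_le hm q₁ h1
        exact ofReal_rpow_le_ofReal_rpow hm.le (by gcongr)
      · have h0 := le_of_ofReal_rpow_le' hm q₀ h0
        have h1 := le_of_ofReal_rpow_le' hm q₁ h1
        exact ofReal_rpow_le_ofReal_rpow hm.le (by gcongr)

theorem continuous_modelDensity {K : ℝ} {N : WithTop ℝ} {x₀ e s : ℝ} :
    Continuous (modelDensity K N x₀ e s) := by
  induction N using WithTop.recTopCoe with
  | top => exact ENNReal.continuous_ofReal.comp (by fun_prop)
  | coe n =>
    have h1 := continuous_cosK (κ := K / (n - 1))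
    have h2 := continuous_sinK (κ := K / (n - 1))
    exact ENNReal.continuous_rpow_const.comp (ENNReal.continuous_ofReal.comp (by fun_prop))

theorem continuous_modelDensity_slope {K : ℝ} {N : WithTop ℝ} {x₀ e x : ℝ} :
    Continuous (fun s => modelDensity K N x₀ e s x) := by
  induction N using WithTop.recTopCoe with
  | top => exact ENNReal.continuous_ofReal.comp (by fun_prop)
  | coe n =>
    exact ENNReal.continuous_rpow_const.comp (ENNReal.continuous_ofReal.comp (by fun_prop))

theorem modelDensity_self {K : ℝ} {N : WithTop ℝ} (hN : N ≤ 0 ∨ 2 ≤ N) {x₀ e s : ℝ} (he : 0 < e) :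
    modelDensity K N x₀ e s x₀ = ENNReal.ofReal e := by
  induction N using WithTop.recTopCoe with
  | top => simp [modelDensity]
  | coe n =>
    simp only [modelDensity, sub_self, cosK_zero, sinK_zero, mul_one, mul_zero, add_zero]
    exact ofReal_rpow_inv_rpow he (dim_sub_one (coe_le_zero_or_two_le.1 hN)).2

/-- As the slope tends to `±∞`, the models degenerate to `0` on one side of `x₀` and to `∞` on the
other side. -/
theorem exists_tendsto_modelDensity {K : ℝ} {N : WithTop ℝ} (hN : N ≤ 0 ∨ 2 ≤ N) {x₀ e : ℝ}
    (he : 0 < e) :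
    ∃ a b : ℝ≥0∞, (a = ∞ ∧ b = 0 ∨ a = 0 ∧ b = ∞) ∧
      (∀ x, x₀ < x → Valid K N |x - x₀| →
        Tendsto (fun s => modelDensity K N x₀ e s x) atTop (𝓝 a) ∧
        Tendsto (fun s => modelDensity K N x₀ e s x) atBot (𝓝 b)) ∧
      (∀ x, x < x₀ → Valid K N |x - x₀| →
        Tendsto (fun s => modelDensity K N x₀ e s x) atTop (𝓝 b) ∧
        Tendsto (fun s => modelDensity K N x₀ e s x) atBot (𝓝 a)) := by
  induction N using WithTop.recTopCoe with
  | top =>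
    have hexp : Tendsto (fun u : ℝ => ENNReal.ofReal (e * Real.exp u)) atTop (𝓝 ∞) :=
      ENNReal.tendsto_ofReal_atTop.comp (Real.tendsto_exp_atTop.const_mul_atTop he)
    have hexp' : Tendsto (fun u : ℝ => ENNReal.ofReal (e * Real.exp u)) atBot (𝓝 0) := by
      have := ENNReal.tendsto_ofReal (Real.tendsto_exp_atBot.const_mul e)
      simpa using this
    refine ⟨∞, 0, Or.inl ⟨rfl, rfl⟩, fun x hx _ => ⟨?_, ?_⟩, fun x hx _ => ⟨?_, ?_⟩⟩
    · exact hexp.comp (tendsto_atTop_add_const_right _ _ (tendsto_id.atTop_mul_const (by linarith)))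
    · exact hexp'.comp (tendsto_atBot_add_const_right _ _
        (tendsto_id.atBot_mul_const (by linarith)))
    · exact hexp'.comp (tendsto_atBot_add_const_right _ _
        (tendsto_id.atTop_mul_const_of_neg (by linarith)))
    · exact hexp.comp (tendsto_atTop_add_const_right _ _
        (tendsto_id.atBot_mul_const_of_neg (by linarith)))
  | coe n =>
    have hm := (dim_sub_one (coe_le_zero_or_two_le.1 hN)).2
    have hup : Tendsto (fun u : ℝ => ENNReal.ofReal u ^ (n - 1)) atTop (𝓝 (∞ ^ (n - 1))) :=
      (ENNReal.continuous_rpow_const.tendsto _).comp ENNReal.tendsto_ofReal_atTop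
    have hdown : Tendsto (fun u : ℝ => ENNReal.ofReal u ^ (n - 1)) atBot (𝓝 (0 ^ (n - 1))) := by
      refine tendsto_const_nhds.congr' ?_
      filter_upwards [eventually_le_atBot 0] with u hu
      rw [ENNReal.ofReal_of_nonpos hu]
    refine ⟨∞ ^ (n - 1), 0 ^ (n - 1), ?_, fun x hx hv => ⟨?_, ?_⟩, fun x hx hv => ⟨?_, ?_⟩⟩
    · rcases hm.lt_or_gt with h | h
      · exact Or.inr ⟨ENNReal.top_rpow_of_neg h, ENNReal.zero_rpow_of_neg h⟩
      · exact Or.inl ⟨ENNReal.top_rpow_of_pos h, ENNReal.zero_rpow_of_pos h⟩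
    · have hS : 0 < sinK (K / (n - 1)) (x - x₀) :=
        sinK_pos (by linarith) (by rw [← sq_abs]; exact hv)
      exact hup.comp (tendsto_atTop_add_const_left _ _ (tendsto_id.atTop_mul_const hS))
    · have hS : 0 < sinK (K / (n - 1)) (x - x₀) :=
        sinK_pos (by linarith) (by rw [← sq_abs]; exact hv)
      exact hdown.comp (tendsto_atBot_add_const_left _ _ (tendsto_id.atBot_mul_const hS))
    · have hS : sinK (K / (n - 1)) (x - x₀) < 0 := by
        rw [← neg_sub x₀ x, sinK_neg, neg_lt_zero]
        exact sinK_pos (by linarith) (by rw [← sq_abs, abs_sub_comm]; exact hv)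
      exact hdown.comp (tendsto_atBot_add_const_left _ _ (tendsto_id.atTop_mul_const_of_neg hS))
    · have hS : sinK (K / (n - 1)) (x - x₀) < 0 := by
        rw [← neg_sub x₀ x, sinK_neg, neg_lt_zero]
        exact sinK_pos (by linarith) (by rw [← sq_abs, abs_sub_comm]; exact hv)
      exact hup.comp (tendsto_atTop_add_const_left _ _ (tendsto_id.atBot_mul_const_of_neg hS))

/-- The part of the subgraph of `J` that lies below `E`. -/
noncomputable def cutBelow (J : ℝ → ℝ) (E : ℝ → ℝ≥0∞) (x : ℝ) : ℝ :=
  (min (ENNReal.ofReal (J x)) (E x)).toReal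

section

variable {K : ℝ} {N : WithTop ℝ} {J : ℝ → ℝ} {E : ℝ → ℝ≥0∞}

theorem ofReal_cutBelow (x : ℝ) :
    ENNReal.ofReal (cutBelow J E x) = min (ENNReal.ofReal (J x)) (E x) :=
  ENNReal.ofReal_toReal (ne_top_of_le_ne_top ENNReal.ofReal_ne_top (min_le_left _ _))

theorem cutBelow_nonneg (x : ℝ) : 0 ≤ cutBelow J E x := ENNReal.toReal_nonneg

theorem cutBelow_le (hJ : ∀ x, 0 ≤ J x) (x : ℝ) : cutBelow J E x ≤ J x := by
  rw [← ENNReal.ofReal_le_ofReal_iff (hJ x), ofReal_cutBelow]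
  exact min_le_left _ _

theorem IsCDDensity.cutBelow (hN : N ≤ 0 ∨ 2 ≤ N) (hJ : IsCDDensity K N J)
    (hE : IsCDExact K N E) : IsCDDensity K N (cutBelow J E) := by
  refine ⟨cutBelow_nonneg, fun x y hx hy => ?_⟩
  have hxJ := cutBelow_le (E := E) hJ.1 x
  have hyJ := cutBelow_le (E := E) hJ.1 y
  obtain ⟨hv, h⟩ := hJ.2 x y (hx.trans_le hxJ) (hy.trans_le hyJ)
  refine ⟨hv, fun t ht => ?_⟩
  rw [← ENNReal.ofReal_le_ofReal_iff (cutBelow_nonneg _), ofReal_cutBelow]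
  refine le_min (ENNReal.ofReal_le_ofReal ?_) ?_
  · exact (dMean_mono hN ht (abs_nonneg _) hv hx hy hxJ hyJ).trans (h t ht)
  · exact (hE x y t _ _ ht hv hx hy).1 (by rw [ofReal_cutBelow]; exact min_le_right _ _)
      (by rw [ofReal_cutBelow]; exact min_le_right _ _)

/-- The part of the subgraph of `J` above a model is again a density with the curvature-dimension
condition, because the density mean is superadditive. -/
theorem IsCDDensity.sub_cutBelow (hN : N ≤ 0 ∨ 2 ≤ N) (hJ : IsCDDensity K N J)
    (hE : IsCDExact K N E) : IsCDDensity K N (fun x => J x - CDD.cutBelow J E x) := by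
  have hle := cutBelow_le (E := E) hJ.1
  have hElt : ∀ {x}, 0 < J x - CDD.cutBelow J E x → E x = ENNReal.ofReal (CDD.cutBelow J E x) := by
    intro x hx
    have h1 : ENNReal.ofReal (CDD.cutBelow J E x) < ENNReal.ofReal (J x) :=
      (ENNReal.ofReal_lt_ofReal_iff_of_nonneg (cutBelow_nonneg x)).2 (by linarith)
    rw [ofReal_cutBelow] at h1 ⊢
    rcases min_lt_iff.1 h1 with h | h
    · exact absurd h (lt_irrefl _)
    · rw [min_eq_right h.le]
  refine ⟨fun x => sub_nonneg.2 (hle x), fun x y hx hy => ?_⟩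
  have hx0 := cutBelow_nonneg (J := J) (E := E) x
  have hy0 := cutBelow_nonneg (J := J) (E := E) y
  obtain ⟨hv, h⟩ := hJ.2 x y (by linarith) (by linarith)
  refine ⟨hv, fun t ht => ?_⟩
  set a := J x - CDD.cutBelow J E x
  set b := J y - CDD.cutBelow J E y
  -- Enlarging the model values slightly makes them positive; the enlargement tends to zero.
  have key : ∀ s ∈ Ioo (0 : ℝ) 1, s * dMean K N t |y - x| a b ≤
      J ((1 - t) * x + t * y) - CDD.cutBelow J E ((1 - t) * x + t * y) := by
    intro s hs
    have hs1 : 0 < 1 - s := by linarith [hs.2]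
    have ea : 0 < CDD.cutBelow J E x + (1 - s) * a := by positivity
    have eb : 0 < CDD.cutBelow J E y + (1 - s) * b := by positivity
    have hadd := dMean_add_le hN ht (abs_nonneg _) hv (mul_pos hs.1 hx) (mul_pos hs.1 hy) ea eb
    rw [dMean_smul hN ht (abs_nonneg _) hv hx hy hs.1,
      show s * a + (CDD.cutBelow J E x + (1 - s) * a) = J x by ring,
      show s * b + (CDD.cutBelow J E y + (1 - s) * b) = J y by ring] at hadd
    have hup := (hE x y t _ _ ht hv ea eb).2
      (by rw [hElt hx]; exact ENNReal.ofReal_le_ofReal (by linarith [mul_pos hs1 hx]))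
      (by rw [hElt hy]; exact ENNReal.ofReal_le_ofReal (by linarith [mul_pos hs1 hy]))
    have hcut : CDD.cutBelow J E ((1 - t) * x + t * y) ≤
        dMean K N t |y - x| (CDD.cutBelow J E x + (1 - s) * a)
          (CDD.cutBelow J E y + (1 - s) * b) := by
      rw [← ENNReal.ofReal_le_ofReal_iff (dMean_pos ht (abs_nonneg _) hv ea eb).le, ofReal_cutBelow]
      exact (min_le_right _ _).trans hup
    have := h t ht
    linarith
  have hlim : Tendsto (fun s : ℝ => s * dMean K N t |y - x| a b) (𝓝[<] 1)
      (𝓝 (1 * dMean K N t |y - x| a b)) := (tendsto_id.mul_const _).mono_left nhdsWithin_le_nhds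
  rw [one_mul] at hlim
  exact le_of_tendsto hlim (by filter_upwards [Ioo_mem_nhdsLT zero_lt_one] with s hs using key s hs)

end

/-! ### Indecomposable measures have model densities -/

section

variable {K : ℝ} {N : WithTop ℝ} {J J₁ J₂ : ℝ → ℝ}

theorem integral_densityMeasure (hJ : ∀ x, 0 ≤ J x) (hJm : AEMeasurable J) (h : ℝ → ℝ) :
    ∫ x, h x ∂(densityMeasure J) = ∫ x, h x * J x := by
  rw [densityMeasure, integral_withDensity_eq_integral_toReal_smul₀ hJm.ennreal_ofReal
    (ae_of_all _ fun x => ENNReal.ofReal_lt_top)]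
  refine integral_congr_ae (ae_of_all _ fun x => ?_)
  simp only [ENNReal.toReal_ofReal (hJ x), smul_eq_mul, mul_comm]

theorem densityMeasure_univ (hJ : ∀ x, 0 ≤ J x) (hJi : Integrable J) :
    densityMeasure J univ = ENNReal.ofReal (∫ x, J x) := by
  rw [densityMeasure_apply MeasurableSet.univ, Measure.restrict_univ,
    ofReal_integral_eq_lintegral_ofReal hJi (ae_of_all _ hJ)]

theorem integrable_of_isFiniteMeasure_densityMeasure (hJ : ∀ x, 0 ≤ J x) (hJm : AEMeasurable J)
    [IsFiniteMeasure (densityMeasure J)] : Integrable J := by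
  refine ⟨hJm.aestronglyMeasurable, ?_⟩
  rw [hasFiniteIntegral_iff_ofReal (ae_of_all _ hJ)]
  have := measure_lt_top (densityMeasure J) univ
  rwa [densityMeasure_apply MeasurableSet.univ, Measure.restrict_univ] at this

theorem densityMeasure_add (hJ₁ : ∀ x, 0 ≤ J₁ x) (hJ₂ : ∀ x, 0 ≤ J₂ x) (hm : AEMeasurable J₁)
    (hadd : ∀ x, J x = J₁ x + J₂ x) :
    densityMeasure J = densityMeasure J₁ + densityMeasure J₂ := by
  ext s hs
  rw [Measure.add_apply, densityMeasure_apply hs, densityMeasure_apply hs, densityMeasure_apply hs,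
    ← lintegral_add_left' hm.ennreal_ofReal.restrict]
  exact lintegral_congr fun x => by rw [hadd, ENNReal.ofReal_add (hJ₁ x) (hJ₂ x)]

theorem densityMeasure_const_mul {c : ℝ} (hc : 0 ≤ c) :
    densityMeasure (fun x => c * J x) = ENNReal.ofReal c • densityMeasure J := by
  rw [densityMeasure, densityMeasure, ← withDensity_smul' _ _ ENNReal.ofReal_ne_top]
  congr with x
  rw [ENNReal.ofReal_mul hc, Pi.smul_apply, smul_eq_mul]

theorem integral_pos_of_eventually_pos {f : ℝ → ℝ} (hf : ∀ x, 0 ≤ f x) (hfi : Integrable f) {x₀ : ℝ}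
    (h : ∀ᶠ x in 𝓝 x₀, 0 < f x) : 0 < ∫ x, f x := by
  rw [integral_pos_iff_support_of_nonneg hf hfi]
  exact Measure.measure_pos_of_mem_nhds volume (h.mono fun x hx => hx.ne')

theorem IsCDDensity.convex_setOf_pos (hJ : IsCDDensity K N J) : Convex ℝ {x | 0 < J x} := by
  refine convex_iff_forall_pos.2 fun x hx y hy a b ha hb hab => ?_
  obtain ⟨hv, h⟩ := hJ.2 x y hx hy
  have h' := h b ⟨hb, by linarith⟩
  rw [show 1 - b = a by linarith] at h'
  exact (dMean_pos ⟨hb, by linarith⟩ (abs_nonneg _) hv hx hy).trans_le h'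

theorem IsCDDensity.indicator (hJ : IsCDDensity K N J) {S : Set ℝ} (hS : Convex ℝ S) :
    IsCDDensity K N (S.indicator J) := by
  refine ⟨fun x => indicator_nonneg (fun x _ => hJ.1 x) x, fun x y hx hy => ?_⟩
  have mem : ∀ {z}, 0 < S.indicator J z → z ∈ S := fun {z} hz => by
    by_contra hcon; simp [hcon] at hz
  have hxS := mem hx
  have hyS := mem hy
  rw [indicator_of_mem hxS] at hx ⊢
  rw [indicator_of_mem hyS] at hy ⊢
  obtain ⟨hv, h⟩ := hJ.2 x y hx hy
  refine ⟨hv, fun t ht => ?_⟩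
  have hmem : (1 - t) * x + t * y ∈ S := hS hxS hyS (by linarith [ht.2]) ht.1.le (by ring)
  rw [indicator_of_mem hmem]
  exact h t ht

/-- A density with the curvature-dimension condition is lower semicontinuous in the interior of its
positivity set. -/
theorem IsCDDensity.eventually_lt (hN : N ≤ 0 ∨ 2 ≤ N) (hJ : IsCDDensity K N J) {x₀ a : ℝ}
    (hx₀ : x₀ ∈ interior {x | 0 < J x}) (ha : a < J x₀) : ∀ᶠ x in 𝓝 x₀, a < J x := by
  obtain ⟨ρ, hρ, hball⟩ := Metric.mem_nhds_iff.1 (mem_interior_iff_mem_nhds.1 hx₀)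
  have h0 : 0 < J x₀ := interior_subset (s := {x | 0 < J x}) hx₀
  have ray : ∀ w : ℝ, |w| < ρ → ∀ᶠ t in 𝓝[>] (0 : ℝ), a < J (x₀ + t * w) := by
    intro w hw
    have hy : 0 < J (x₀ + w) := hball (by simpa [Real.dist_eq] using hw)
    obtain ⟨hv, h⟩ := hJ.2 x₀ (x₀ + w) h0 hy
    have hlim := (tendsto_dMean_left hN (abs_nonneg _) hv h0 hy).mono_left
      (nhdsWithin_le_nhds (s := Ioi (0 : ℝ)))
    filter_upwards [hlim.eventually_const_lt ha, Ioo_mem_nhdsGT zero_lt_one] with t ht ht'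
    have := h t ht'
    rw [show (1 - t) * x₀ + t * (x₀ + w) = x₀ + t * w by ring] at this
    exact ht.trans_le this
  have hside : ∀ w : ℝ, |w| < ρ → ∃ ε > 0, ∀ t ∈ Ioo (0 : ℝ) ε, a < J (x₀ + t * w) := by
    intro w hw
    obtain ⟨ε, hε, hsub⟩ := mem_nhdsGT_iff_exists_Ioo_subset.1 (ray w hw)
    exact ⟨ε, hε, fun t ht => hsub ht⟩
  obtain ⟨ε₁, hε₁, h₁⟩ := hside (ρ / 2)
    (by rw [abs_of_pos (by positivity)]; linarith)
  obtain ⟨ε₂, hε₂, h₂⟩ := hside (-(ρ / 2))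
    (by rw [abs_neg, abs_of_pos (by positivity)]; linarith)
  have hm : 0 < min ε₁ ε₂ * (ρ / 2) := by positivity
  filter_upwards [Ioo_mem_nhds (show x₀ - min ε₁ ε₂ * (ρ / 2) < x₀ by linarith)
    (show x₀ < x₀ + min ε₁ ε₂ * (ρ / 2) by linarith)] with x hx
  rcases lt_trichotomy x x₀ with hlt | rfl | hlt
  · have := h₂ ((x₀ - x) / (ρ / 2)) ⟨by apply div_pos <;> linarith, by
      rw [div_lt_iff₀ (by positivity)]
      have : min ε₁ ε₂ * (ρ / 2) ≤ ε₂ * (ρ / 2) := by gcongr; exact min_le_right _ _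
      linarith [hx.1]⟩
    rw [mul_neg, div_mul_cancel₀ _ (by positivity)] at this
    simpa using this
  · exact ha
  · have := h₁ ((x - x₀) / (ρ / 2)) ⟨by apply div_pos <;> linarith, by
      rw [div_lt_iff₀ (by positivity)]
      have : min ε₁ ε₂ * (ρ / 2) ≤ ε₁ * (ρ / 2) := by gcongr; exact min_le_left _ _
      linarith [hx.2]⟩
    rw [div_mul_cancel₀ _ (by positivity)] at this
    simpa using this

/-- If the measure with density `J` is indecomposable, then every splitting `J = J₁ + J₂` into
constrained densities of positive mass is trivial. -/
theorem exists_ae_eq_const_mul_of_indecomposable (hN : N ≤ 0 ∨ 2 ≤ N) {l r : ℝ} {h : ℝ →ᵇ ℝ}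
    {μ : ProbabilityMeasure ℝ} (hμ : μ ∈ constrainedClass K N l r h)
    (hind : ∀ μ₁ ∈ constrainedClass K N l r h, ∀ μ₂ ∈ constrainedClass K N l r h, ∀ m₁ m₂ : ℝ,
      0 < m₁ → 0 < m₂ → m₁ + m₂ = 1 →
      (μ : Measure ℝ) = ENNReal.ofReal m₁ • (μ₁ : Measure ℝ) +
        ENNReal.ofReal m₂ • (μ₂ : Measure ℝ) →
      μ₁ = μ)
    (hJ : ∀ x, 0 ≤ J x) (hJi : Integrable J) (hμJ : (μ : Measure ℝ) = densityMeasure J)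
    (hJ₁ : IsCDDensity K N J₁) (hJ₂ : IsCDDensity K N J₂) (hm₁ : AEMeasurable J₁)
    (hm₂ : AEMeasurable J₂) (hadd : ∀ x, J x = J₁ x + J₂ x) (hh : ∫ x, h x * J₁ x = 0)
    (hpos₁ : 0 < ∫ x, J₁ x) (hpos₂ : 0 < ∫ x, J₂ x) :
    ∃ c ∈ Ioo (0 : ℝ) 1, J₁ =ᵐ[volume] fun x => c * J x := by
  have hi₁ : Integrable J₁ := hJi.mono' hm₁.aestronglyMeasurable
    (ae_of_all _ fun x => by rw [Real.norm_of_nonneg (hJ₁.1 x), hadd]; linarith [hJ₂.1 x])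
  have hi₂ : Integrable J₂ := hJi.mono' hm₂.aestronglyMeasurable
    (ae_of_all _ fun x => by rw [Real.norm_of_nonneg (hJ₂.1 x), hadd]; linarith [hJ₁.1 x])
  have htot : ∫ x, J x = 1 := by
    have h1 : (μ : Measure ℝ) univ = 1 := measure_univ
    rw [hμJ, densityMeasure_univ hJ hJi, ENNReal.ofReal_eq_one] at h1
    exact h1
  have hsum : (∫ x, J₁ x) + ∫ x, J₂ x = 1 := by
    rw [← integral_add hi₁ hi₂, ← htot]
    exact integral_congr_ae (ae_of_all _ fun x => (hadd x).symm)
  set m₁ := ∫ x, J₁ x with hm₁def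
  set m₂ := ∫ x, J₂ x with hm₂def
  have hdec := densityMeasure_add hJ₁.1 hJ₂.1 hm₁ hadd
  have hhJ : ∫ x, h x * J x = 0 := by
    rw [← integral_densityMeasure hJ hJi.1.aemeasurable, ← hμJ]
    exact hμ.2.2
  have bdd : ∀ {f : ℝ → ℝ}, Integrable f → Integrable fun x => h x * f x := fun hf =>
    hf.bdd_mul h.continuous.aestronglyMeasurable (ae_of_all _ h.norm_coe_le_norm)
  have hh₂ : ∫ x, h x * J₂ x = 0 := by
    have : ∫ x, h x * J x = (∫ x, h x * J₁ x) + ∫ x, h x * J₂ x := by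
      rw [← integral_add (bdd hi₁) (bdd hi₂)]
      exact integral_congr_ae (ae_of_all _ fun x => by simp only [hadd, mul_add])
    linarith
  -- The normalized parts are constrained probability measures.
  have normalize : ∀ {G : ℝ → ℝ}, IsCDDensity K N G → Integrable G →
      densityMeasure G ≤ densityMeasure J → 0 < ∫ x, G x → ∫ x, h x * G x = 0 →
      ∃ ν ∈ constrainedClass K N l r h,
        ENNReal.ofReal (∫ x, G x) • (ν : Measure ℝ) = densityMeasure G := by
    intro G hG hGi hle hGpos hGh
    have hne : ENNReal.ofReal (∫ x, G x) ≠ 0 := (ENNReal.ofReal_pos.2 hGpos).ne'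
    have hprob : IsProbabilityMeasure ((ENNReal.ofReal (∫ x, G x))⁻¹ • densityMeasure G) := ⟨by
      rw [Measure.smul_apply, densityMeasure_univ hG.1 hGi, smul_eq_mul,
        ENNReal.inv_mul_cancel hne ENNReal.ofReal_ne_top]⟩
    have hfin : IsFiniteMeasure (densityMeasure G) := ⟨by
      rw [densityMeasure_univ hG.1 hGi]; exact ENNReal.ofReal_lt_top⟩
    refine ⟨⟨_, hprob⟩, ⟨?_, ?_, ?_⟩, ?_⟩
    · have h0 : densityMeasure G (Icc l r)ᶜ = 0 :=
        le_antisymm ((hle _).trans_eq (by rw [← hμJ]; exact hμ.1)) zero_le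
      simp [h0]
    · exact (hG.intervalBM hN hGi.1.aemeasurable).smul (ENNReal.inv_ne_zero.2 ENNReal.ofReal_ne_top)
        (ENNReal.inv_ne_top.2 hne)
    · simp only [ProbabilityMeasure.coe_mk]
      rw [integral_smul_measure, integral_densityMeasure hG.1 hGi.1.aemeasurable, hGh, smul_zero]
    · simp only [ProbabilityMeasure.coe_mk]
      rw [smul_smul, ENNReal.mul_inv_cancel hne ENNReal.ofReal_ne_top, one_smul]
  obtain ⟨μ₁, hμ₁, e₁⟩ := normalize hJ₁ hi₁
    (by rw [hdec]; exact Measure.le_add_right le_rfl) hpos₁ hh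
  obtain ⟨μ₂, hμ₂, e₂⟩ := normalize hJ₂ hi₂
    (by rw [hdec]; exact Measure.le_add_left le_rfl) hpos₂ hh₂
  have heq := hind μ₁ hμ₁ μ₂ hμ₂ m₁ m₂ hpos₁ hpos₂ hsum (by rw [e₁, e₂, hμJ, hdec])
  refine ⟨m₁, ⟨hpos₁, by linarith⟩, ?_⟩
  rw [heq, hμJ, ← densityMeasure_const_mul hpos₁.le, densityMeasure, densityMeasure,
    withDensity_eq_iff (hJi.1.aemeasurable.const_mul m₁).ennreal_ofReal hm₁.ennreal_ofReal] at e₁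
  · filter_upwards [e₁] with x hx
    rw [ENNReal.ofReal_eq_ofReal_iff (mul_nonneg hpos₁.le (hJ x)) (hJ₁.1 x)] at hx
    exact hx.symm
  · rw [← ofReal_integral_eq_lintegral_ofReal (hJi.const_mul m₁)
      (ae_of_all _ fun x => mul_nonneg hpos₁.le (hJ x))]
    exact ENNReal.ofReal_ne_top

end

section

variable {K : ℝ} {N : WithTop ℝ} {J : ℝ → ℝ} {h : ℝ →ᵇ ℝ}

theorem aemeasurable_cutBelow (hJm : AEMeasurable J) {E : ℝ → ℝ≥0∞} (hE : Measurable E) :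
    AEMeasurable (cutBelow J E) :=
  (hJm.ennreal_ofReal.min hE.aemeasurable).ennreal_toReal

theorem tendsto_integral_mul_cutBelow (hJ : ∀ x, 0 ≤ J x) (hJi : Integrable J) {L : Filter ℝ}
    [L.IsCountablyGenerated] {E : ℝ → ℝ → ℝ≥0∞} {F : ℝ → ℝ≥0∞} (hE : ∀ s, Measurable (E s))
    (hlim : ∀ᵐ x, 0 < J x → Tendsto (fun s => E s x) L (𝓝 (F x))) :
    Tendsto (fun s => ∫ x, h x * cutBelow J (E s) x) L (𝓝 (∫ x, h x * cutBelow J F x)) := by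
  refine tendsto_integral_filter_of_dominated_convergence (fun x => ‖h‖ * J x)
    (Eventually.of_forall fun s => ?_) (Eventually.of_forall fun s => ae_of_all _ fun x => ?_)
    (hJi.const_mul _) ?_
  · exact h.continuous.aestronglyMeasurable.mul
      (aemeasurable_cutBelow hJi.1.aemeasurable (hE s)).aestronglyMeasurable
  · rw [norm_mul, Real.norm_of_nonneg (cutBelow_nonneg x)]
    exact mul_le_mul (h.norm_coe_le_norm x) (cutBelow_le hJ x) (cutBelow_nonneg x) (norm_nonneg _)
  · filter_upwards [hlim] with x hx
    refine Tendsto.const_mul _ ?_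
    rcases (hJ x).eq_or_lt with h0 | h0
    · simp only [cutBelow, ← h0, ENNReal.ofReal_zero, zero_min]
      exact tendsto_const_nhds
    · exact (ENNReal.tendsto_toReal
        (ne_top_of_le_ne_top ENNReal.ofReal_ne_top (min_le_left _ _))).comp
        (tendsto_const_nhds.min (hx h0))

theorem cutBelow_indicator_top (hJ : ∀ x, 0 ≤ J x) (S : Set ℝ) :
    cutBelow J (S.indicator fun _ => ∞) = S.indicator J := by
  funext x
  by_cases hx : x ∈ S <;> simp [cutBelow, hx, hJ x]

/-- A constrained density that admits no nontrivial splitting is proportional to a model. The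
splittings considered are those along the models through a fixed point strictly inside the
subgraph, with varying slope. Between the extreme slopes, which give the two vertical cuts, some
slope satisfies the constraint. -/
theorem exists_isCDExact_ae_eq (hN : N ≤ 0 ∨ 2 ≤ N) (hJ : IsCDDensity K N J) (hJi : Integrable J)
    (hh : ∫ x, h x * J x = 0) {x₀ : ℝ} (hx₀ : x₀ ∈ interior {x | 0 < J x})
    (hsplit : ∀ J₁ J₂ : ℝ → ℝ, IsCDDensity K N J₁ → IsCDDensity K N J₂ → AEMeasurable J₁ →
      AEMeasurable J₂ → (∀ x, J x = J₁ x + J₂ x) → ∫ x, h x * J₁ x = 0 → 0 < ∫ x, J₁ x →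
      0 < ∫ x, J₂ x → ∃ c ∈ Ioo (0 : ℝ) 1, J₁ =ᵐ[volume] fun x => c * J x) :
    ∃ E : ℝ → ℝ≥0∞, IsCDExact K N E ∧ Continuous E ∧ ∃ c : ℝ, 0 < c ∧
      ∀ᵐ x, 0 < J x → E x = ENNReal.ofReal (c * J x) := by
  have hJm := hJi.1.aemeasurable
  have h0 : 0 < J x₀ := interior_subset (s := {x | 0 < J x}) hx₀
  have hpos : ∀ᶠ x in 𝓝 x₀, 0 < J x := mem_interior_iff_mem_nhds.1 hx₀
  -- The vertical cut at `x₀` is not a multiple of `J`, so it violates the constraint.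
  have hA : ∫ x, h x * (Ioi x₀).indicator J x ≠ 0 := by
    intro hA0
    obtain ⟨ε, hε, hball⟩ := Metric.mem_nhds_iff.1 hpos
    have side : ∀ {S : Set ℝ}, MeasurableSet S → 0 < volume (Metric.ball x₀ ε ∩ S) →
        0 < ∫ x, S.indicator J x := by
      intro S hS hSpos
      rw [integral_pos_iff_support_of_nonneg (fun x => indicator_nonneg (fun x _ => hJ.1 x) x)
        (hJi.indicator hS)]
      refine hSpos.trans_le (measure_mono fun x hx => ?_)
      rw [Function.mem_support, indicator_of_mem hx.2]
      exact (hball hx.1).ne'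
    have hright : 0 < volume (Metric.ball x₀ ε ∩ Ioi x₀) := by
      have hsub : Ioo x₀ (x₀ + ε) ⊆ Metric.ball x₀ ε ∩ Ioi x₀ := fun x hx => ⟨by
        rw [Real.ball_eq_Ioo]; exact ⟨by linarith [hx.1], hx.2⟩, hx.1⟩
      exact lt_of_lt_of_le (by simp [hε]) (measure_mono hsub)
    have hleft : 0 < volume (Metric.ball x₀ ε ∩ Iic x₀) := by
      have hsub : Ioo (x₀ - ε) x₀ ⊆ Metric.ball x₀ ε ∩ Iic x₀ := fun x hx => ⟨by
        rw [Real.ball_eq_Ioo]; exact ⟨hx.1, by linarith [hx.2]⟩, hx.2.le⟩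
      exact lt_of_lt_of_le (by simp [hε]) (measure_mono hsub)
    obtain ⟨c, hc, hae⟩ := hsplit _ _ (hJ.indicator (convex_Ioi x₀)) (hJ.indicator (convex_Iic x₀))
      (hJm.indicator measurableSet_Ioi) (hJm.indicator measurableSet_Iic)
      (fun x => by by_cases hx : x₀ < x <;> simp [hx, not_lt.1, not_le.2]) hA0
      (side measurableSet_Ioi hright) (side measurableSet_Iic hleft)
    have hnull : volume (Metric.ball x₀ ε ∩ Iic x₀) = 0 := by
      refine measure_mono_null (fun x hx => ?_) hae
      intro hcon
      have hcon : (Ioi x₀).indicator J x = c * J x := hcon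
      rw [indicator_of_notMem (by simpa using hx.2)] at hcon
      have : 0 < c * J x := mul_pos hc.1 (hball hx.1)
      linarith
    exact hleft.ne' hnull
  -- Any value strictly between `0` and `J x₀` serves as the height of the cuts at `x₀`.
  set e := J x₀ / 2 with he_def
  have he : 0 < e := by positivity
  set E : ℝ → ℝ → ℝ≥0∞ := fun s => modelDensity K N x₀ e s with hEdef
  have hEc : ∀ s, Continuous (E s) := fun s => continuous_modelDensity
  have hEm : ∀ s, Measurable (E s) := fun s => (hEc s).measurable
  have hEx : ∀ s, IsCDExact K N (E s) := fun s => isCDExact_modelDensity hN he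
  set Γ : ℝ → ℝ := fun s => ∫ x, h x * cutBelow J (E s) x with hΓ
  have hΓc : Continuous Γ := continuous_iff_continuousAt.2 fun s =>
    tendsto_integral_mul_cutBelow hJ.1 hJi hEm
      (ae_of_all _ fun x _ => continuous_modelDensity_slope.tendsto s)
  have hne : ∀ᵐ x : ℝ, x ≠ x₀ := by simp [ae_iff]
  have hopp : ∫ x, h x * (Iio x₀).indicator J x = -∫ x, h x * (Ioi x₀).indicator J x := by
    have bdd : ∀ {f : ℝ → ℝ}, Integrable f → Integrable fun x => h x * f x := fun hf =>
      hf.bdd_mul h.continuous.aestronglyMeasurable (ae_of_all _ h.norm_coe_le_norm)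
    rw [eq_neg_iff_add_eq_zero, ← integral_add (bdd (hJi.indicator measurableSet_Iio))
      (bdd (hJi.indicator measurableSet_Ioi)), ← hh]
    refine integral_congr_ae ?_
    filter_upwards [hne] with x hx
    rcases lt_or_gt_of_ne hx with hlt | hlt
    · simp [hlt, hlt.not_gt]
    · simp [hlt, hlt.not_gt]
  have hends : ∃ s₁ s₂, Γ s₁ ≤ 0 ∧ 0 ≤ Γ s₂ := by
    set A := ∫ x, h x * (Ioi x₀).indicator J x
    -- Along each end of the slope parameter, the cuts tend to one of the two vertical cuts.
    have hright : ∀ L : Filter ℝ, L.IsCountablyGenerated →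
        (∀ x, x₀ < x → Valid K N |x - x₀| → Tendsto (fun s => E s x) L (𝓝 ∞)) →
        (∀ x, x < x₀ → Valid K N |x - x₀| → Tendsto (fun s => E s x) L (𝓝 0)) →
        Tendsto Γ L (𝓝 A) := by
      intro L hL hr hl
      have := tendsto_integral_mul_cutBelow (h := h) (F := (Ioi x₀).indicator fun _ => ∞) hJ.1 hJi
        hEm (L := L) (by
          filter_upwards [hne] with x hx hJx
          have hv := (hJ.2 x₀ x h0 hJx).1
          rcases lt_or_gt_of_ne hx with hlt | hlt
          · simpa [hlt.not_gt] using hl x hlt hv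
          · simpa [hlt] using hr x hlt hv)
      rwa [cutBelow_indicator_top hJ.1] at this
    have hleft : ∀ L : Filter ℝ, L.IsCountablyGenerated →
        (∀ x, x₀ < x → Valid K N |x - x₀| → Tendsto (fun s => E s x) L (𝓝 0)) →
        (∀ x, x < x₀ → Valid K N |x - x₀| → Tendsto (fun s => E s x) L (𝓝 ∞)) →
        Tendsto Γ L (𝓝 (-A)) := by
      intro L hL hr hl
      have := tendsto_integral_mul_cutBelow (h := h) (F := (Iio x₀).indicator fun _ => ∞) hJ.1 hJi
        hEm (L := L) (by
          filter_upwards [hne] with x hx hJx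
          have hv := (hJ.2 x₀ x h0 hJx).1
          rcases lt_or_gt_of_ne hx with hlt | hlt
          · simpa [hlt] using hl x hlt hv
          · simpa [hlt.not_gt] using hr x hlt hv)
      rwa [cutBelow_indicator_top hJ.1, hopp] at this
    have hsigns : ∀ L₁ L₂ : Filter ℝ, L₁.NeBot → L₂.NeBot → Tendsto Γ L₁ (𝓝 A) →
        Tendsto Γ L₂ (𝓝 (-A)) → ∃ s₁ s₂, Γ s₁ ≤ 0 ∧ 0 ≤ Γ s₂ := by
      intro L₁ L₂ _ _ h1 h2
      rcases lt_or_gt_of_ne hA with hneg | hposA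
      · obtain ⟨s₁, hs₁⟩ := (h1.eventually_lt_const hneg).exists
        obtain ⟨s₂, hs₂⟩ := (h2.eventually_const_lt (neg_pos.2 hneg)).exists
        exact ⟨s₁, s₂, hs₁.le, hs₂.le⟩
      · obtain ⟨s₁, hs₁⟩ := (h2.eventually_lt_const (neg_lt_zero.2 hposA)).exists
        obtain ⟨s₂, hs₂⟩ := (h1.eventually_const_lt hposA).exists
        exact ⟨s₁, s₂, hs₁.le, hs₂.le⟩
    obtain ⟨a, b, hab, hr, hl⟩ := exists_tendsto_modelDensity hN (K := K) (x₀ := x₀) he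
    rcases hab with ⟨rfl, rfl⟩ | ⟨rfl, rfl⟩
    · exact hsigns atTop atBot inferInstance inferInstance
        (hright _ inferInstance (fun x hx hv => (hr x hx hv).1) fun x hx hv => (hl x hx hv).1)
        (hleft _ inferInstance (fun x hx hv => (hr x hx hv).2) fun x hx hv => (hl x hx hv).2)
    · exact hsigns atBot atTop inferInstance inferInstance
        (hright _ inferInstance (fun x hx hv => (hr x hx hv).2) fun x hx hv => (hl x hx hv).2)
        (hleft _ inferInstance (fun x hx hv => (hr x hx hv).1) fun x hx hv => (hl x hx hv).1)
  obtain ⟨s₁, s₂, hs₁, hs₂⟩ := hends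
  obtain ⟨s, hs⟩ := mem_range_of_exists_le_of_exists_ge hΓc ⟨s₁, hs₁⟩ ⟨s₂, hs₂⟩
  have hEx₀ : E s x₀ = ENNReal.ofReal e := modelDensity_self hN he
  have hElow : ∀ᶠ x in 𝓝 x₀, 0 < E s x := (hEc s).continuousAt.eventually_const_lt (by
    rw [hEx₀]; exact ENNReal.ofReal_pos.2 he)
  have hEup : ∀ᶠ x in 𝓝 x₀, E s x < ENNReal.ofReal (3 / 4 * J x₀) :=
    (hEc s).continuousAt.eventually_lt_const (by
      rw [hEx₀]; exact (ENNReal.ofReal_lt_ofReal_iff (by positivity)).2 (by linarith))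
  have hJlow := hJ.eventually_lt hN hx₀ (show 3 / 4 * J x₀ < J x₀ by linarith)
  have hcm := aemeasurable_cutBelow hJm (hEm s)
  have hci : Integrable (cutBelow J (E s)) := hJi.mono' hcm.aestronglyMeasurable
    (ae_of_all _ fun x => by
      rw [Real.norm_of_nonneg (cutBelow_nonneg x)]; exact cutBelow_le hJ.1 x)
  obtain ⟨c, hc, hae⟩ := hsplit (cutBelow J (E s)) (fun x => J x - cutBelow J (E s) x)
    (hJ.cutBelow hN (hEx s)) (hJ.sub_cutBelow hN (hEx s)) hcm (hJm.sub hcm) (fun x => by ring) hs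
    (integral_pos_of_eventually_pos cutBelow_nonneg hci (by
      filter_upwards [hElow, hpos] with x h1 h2
      rw [← ENNReal.ofReal_pos, ofReal_cutBelow]
      exact lt_min (ENNReal.ofReal_pos.2 h2) h1))
    (integral_pos_of_eventually_pos (fun x => sub_nonneg.2 (cutBelow_le hJ.1 x)) (hJi.sub hci) (by
      filter_upwards [hEup, hJlow] with x h1 h2
      rw [sub_pos, ← ENNReal.ofReal_lt_ofReal_iff_of_nonneg (cutBelow_nonneg x), ofReal_cutBelow]
      exact (min_le_right _ _).trans_lt (h1.trans_le (ENNReal.ofReal_le_ofReal h2.le))))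
  refine ⟨E s, hEx s, hEc s, c, hc.1, ?_⟩
  filter_upwards [hae] with x hx hJx
  rw [← hx, ofReal_cutBelow]
  -- Since `c < 1`, the minimum in the cut is attained by the model.
  have hlt : min (ENNReal.ofReal (J x)) (E s x) < ENNReal.ofReal (J x) := by
    rw [← ofReal_cutBelow, hx, ENNReal.ofReal_lt_ofReal_iff hJx]
    nlinarith [hc.2]
  rcases min_lt_iff.1 hlt with h' | h'
  · exact absurd h' (lt_irrefl _)
  · rw [min_eq_right h'.le]

/-- A measure whose density agrees almost everywhere with a multiple of an exact density on its
positivity set is a model measure. -/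
theorem densityMeasure_mem_modelClass (hN : N ≤ 0 ∨ 2 ≤ N) (hJ : IsCDDensity K N J)
    [IsFiniteMeasure (densityMeasure J)] {E : ℝ → ℝ≥0∞} (hE : IsCDExact K N E) (hEc : Continuous E)
    {c : ℝ} (hc : 0 < c) (hae : ∀ᵐ x, 0 < J x → E x = ENNReal.ofReal (c * J x))
    (hne : (interior {x | 0 < J x}).Nonempty) {D : ℝ≥0∞} (hD : Metric.ediam {x | 0 < J x} ≤ D) :
    densityMeasure J ∈ modelClass K N D := by
  have hIconv := hJ.convex_setOf_pos
  set U := interior {x | 0 < J x} with hU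
  have hUo : IsOpen U := isOpen_interior
  have hUconv : Convex ℝ U := hIconv.interior
  have hUJ : ∀ x ∈ U, 0 < J x := fun x hx => interior_subset (s := {x | 0 < J x}) hx
  have hgood : ∀ a b : ℝ, a < b → Ioo a b ⊆ U →
      ∃ y ∈ Ioo a b, E y = ENNReal.ofReal (c * J y) ∧ 0 < J y := by
    intro a b hab hsub
    by_contra! hcon
    have : volume (Ioo a b) = 0 := by
      refine measure_mono_null (fun y hy => ?_) hae
      intro hy'
      exact absurd (hUJ y (hsub hy)) (not_lt.2 (hcon y hy (hy' (hUJ y (hsub hy)))))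
    rw [Real.volume_Ioo, ENNReal.ofReal_eq_zero] at this
    linarith
  have hmean : ∀ x y a b t : ℝ, 0 < J x → 0 < J y → t ∈ Ioo (0 : ℝ) 1 → 0 < a → 0 < b →
      E x = ENNReal.ofReal a → E y = ENNReal.ofReal b →
      E ((1 - t) * x + t * y) = ENNReal.ofReal (dMean K N t |y - x| a b) := by
    intro x y a b t hx hy ht ha hb hxa hyb
    have h := hE x y t a b ht (hJ.2 x y hx hy).1 ha hb
    exact le_antisymm (h.2 hxa.le hyb.le) (h.1 hxa.ge hyb.ge)
  -- The almost everywhere equality makes `E` positive and finite at almost every point; exactness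
  -- between two such points extends this to all points of `U`.
  have hEpos : ∀ x ∈ U, ∃ a : ℝ, 0 < a ∧ E x = ENNReal.ofReal a := by
    intro x hx
    obtain ⟨ε, hε, hball⟩ := Metric.isOpen_iff.1 hUo x hx
    rw [Real.ball_eq_Ioo] at hball
    obtain ⟨y, hy, hyE, hyJ⟩ := hgood (x - ε) x (by linarith)
      ((Ioo_subset_Ioo_right (by linarith)).trans hball)
    obtain ⟨z, hz, hzE, hzJ⟩ := hgood x (x + ε) (by linarith)
      ((Ioo_subset_Ioo_left (by linarith)).trans hball)
    have hyz : 0 < z - y := by linarith [hy.2, hz.1]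
    have ht : (x - y) / (z - y) ∈ Ioo (0 : ℝ) 1 :=
      ⟨div_pos (by linarith [hy.2]) hyz, by rw [div_lt_one hyz]; linarith [hz.1]⟩
    have hm := hmean y z _ _ _ hyJ hzJ ht (mul_pos hc hyJ) (mul_pos hc hzJ) hyE hzE
    rw [show (1 - (x - y) / (z - y)) * y + (x - y) / (z - y) * z = x by field_simp; ring] at hm
    exact ⟨_, dMean_pos ht (abs_nonneg _) (hJ.2 y z hyJ hzJ).1 (mul_pos hc hyJ)
      (mul_pos hc hzJ), hm⟩
  set G : ℝ → ℝ := U.indicator fun x => c⁻¹ * (E x).toReal with hG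
  have hGm : Measurable G := (hEc.measurable.ennreal_toReal.const_mul _).indicator hUo.measurableSet
  have hG0 : ∀ x, 0 ≤ G x := fun x => indicator_nonneg (fun x _ => by positivity) x
  have hGU : ∀ x ∈ U, ∃ a : ℝ, 0 < a ∧ E x = ENNReal.ofReal a ∧ G x = c⁻¹ * a := by
    intro x hx
    obtain ⟨a, ha, hxa⟩ := hEpos x hx
    exact ⟨a, ha, hxa, by rw [hG, indicator_of_mem hx, hxa, ENNReal.toReal_ofReal ha.le]⟩
  have hfr : ∀ᵐ x, x ∉ frontier {x | 0 < J x} := by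
    rw [ae_iff]; simpa using hIconv.addHaar_frontier volume
  have hJG : densityMeasure J = volume.withDensity fun x => ENNReal.ofReal (G x) := by
    refine withDensity_congr_ae ?_
    filter_upwards [hae, hfr] with x hx hxf
    by_cases hxU : x ∈ U
    · rw [hG, indicator_of_mem hxU, hx (hUJ x hxU),
        ENNReal.toReal_ofReal (mul_nonneg hc.le (hJ.1 x)), inv_mul_cancel_left₀ hc.ne']
    · have hJx : ¬ 0 < J x := fun hpos => hxf ⟨subset_closure hpos, hxU⟩
      rw [hG, indicator_of_notMem hxU, le_antisymm (not_lt.1 hJx) (hJ.1 x)]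
  have hsupp : (densityMeasure J).support = closure U := by
    refine subset_antisymm (Measure.support_subset_of_isClosed isClosed_closure ?_)
      (closure_minimal (fun x hx => ?_) Measure.isClosed_support)
    · rw [mem_ae_iff, hJG, withDensity_apply _ isClosed_closure.measurableSet.compl]
      rw [setLIntegral_congr_fun (g := fun _ => 0) isClosed_closure.measurableSet.compl
        (fun x hx => by
          have hx' : x ∉ U := fun hxU => hx (subset_closure hxU)
          simp only [hG, indicator_of_notMem hx', ENNReal.ofReal_zero])]
      simp
    · rw [Measure.mem_support_iff_forall]
      intro V hV
      obtain ⟨W, hWV, hWo, hxW⟩ := mem_nhds_iff.1 (inter_mem hV (hUo.mem_nhds hx))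
      refine lt_of_lt_of_le ?_ (measure_mono (hWV.trans inter_subset_left))
      rw [hJG, withDensity_apply _ hWo.measurableSet, setLIntegral_pos_iff hGm.ennreal_ofReal]
      refine (hWo.measure_pos volume ⟨x, hxW⟩).trans_le (measure_mono fun y hy => ⟨?_, hy⟩)
      obtain ⟨a, ha, -, hGy⟩ := hGU y (hWV hy).2
      rw [Function.mem_support, hGy]
      exact (ENNReal.ofReal_pos.2 (by positivity)).ne'
  have hint : interior (densityMeasure J).support = U := by
    rw [hsupp, hUconv.interior_closure_eq_interior_of_nonempty_interior
      (by rwa [hUo.interior_eq]), hUo.interior_eq]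
  refine ⟨inferInstance, ?_, ?_, ⟨G, hGm, hG0, hJG, ?_⟩, ?_⟩
  · rw [← Measure.nonempty_support_iff, hsupp]
    exact hne.closure
  · rw [hsupp]
    exact hUconv.closure.ordConnected
  · rw [hint]
    intro x hx y hy t ht
    obtain ⟨a, ha, hxa, hGx⟩ := hGU x hx
    obtain ⟨b, hb, hyb, hGy⟩ := hGU y hy
    have hv := (hJ.2 x y (hUJ x hx) (hUJ y hy)).1
    rw [hGx, hGy, distortedMean_eq_ofReal hN hv (by positivity) (by positivity)]
    congr 1
    rcases ht.1.eq_or_lt with rfl | h0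
    · rw [dMean_zero_left hN (abs_nonneg _) hv (by positivity)]
      simpa using hGx
    rcases ht.2.eq_or_lt with rfl | h1
    · rw [dMean_one_left hN (abs_nonneg _) hv (by positivity)]
      simpa using hGy
    have hmem : (1 - t) * x + t * y ∈ U := hUconv hx hy (by linarith) h0.le (by ring)
    rw [dMean_smul hN ⟨h0, h1⟩ (abs_nonneg _) hv ha hb (by positivity), hG, indicator_of_mem hmem,
      hmean x y a b t (hUJ x hx) (hUJ y hy) ⟨h0, h1⟩ ha hb hxa hyb,
      ENNReal.toReal_ofReal (dMean_pos ⟨h0, h1⟩ (abs_nonneg _) hv ha hb).le]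
  · rw [hsupp, Metric.ediam_closure]
    exact (Metric.ediam_mono interior_subset).trans hD

end

/-! ### Localization to model measures -/

section

variable {K : ℝ} {N : WithTop ℝ}

/-- Localization for measures on a compact interval. Dirac masses are excluded by the relation
between the zeros of `h` and the sign of `g`. -/
theorem exists_model_of_mem_constrainedClass (hN : N ≤ 0 ∨ 2 ≤ N) {l r : ℝ} {D : ℝ≥0∞}
    (hv : K < 0 → Valid K N (r - l)) (hD : Metric.ediam (Icc l r) ≤ D) {h g : ℝ →ᵇ ℝ}
    (hhg : ∀ x, h x = 0 → 0 ≤ g x) {μ₀ : ProbabilityMeasure ℝ}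
    (hμ₀ : μ₀ ∈ constrainedClass K N l r h) (hg : ∫ x, g x ∂(μ₀ : Measure ℝ) < 0) :
    ∃ ν ∈ modelClass K N D, ∫ x, h x ∂ν = 0 ∧ ∫ x, g x ∂ν < 0 := by
  obtain ⟨μ, hμ, hle, hind⟩ := exists_indecomposable (g := g) hμ₀
  have hgμ := hle.trans_lt hg
  refine ⟨μ, ?_, hμ.2.2, hgμ⟩
  rcases hμ.2.1.dirac_or_density hN hμ.1 hv with ⟨x, hx⟩ | ⟨J, hJ, hJm, hμJ, hJlr⟩
  · rw [measure_univ, one_smul] at hx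
    have h1 := hμ.2.2
    rw [hx, integral_dirac] at h1
    rw [hx, integral_dirac] at hgμ
    exact absurd (hhg x h1) (not_le.2 hgμ)
  · have hfin : IsFiniteMeasure (densityMeasure J) := by rw [← hμJ]; infer_instance
    have hJi := integrable_of_isFiniteMeasure_densityMeasure hJ.1 hJm
    have hhJ : ∫ x, h x * J x = 0 := by
      rw [← integral_densityMeasure hJ.1 hJm, ← hμJ]
      exact hμ.2.2
    have hne : (interior {x | 0 < J x}).Nonempty := by
      by_contra hempty
      rw [not_nonempty_iff_eq_empty] at hempty
      have hnull : volume {x | 0 < J x} = 0 := by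
        refine measure_mono_null (fun x hx => ?_) (hJ.convex_setOf_pos.addHaar_frontier volume)
        exact ⟨subset_closure hx, by rw [hempty]; exact notMem_empty x⟩
      have h1 : (μ : Measure ℝ) univ = 1 := measure_univ
      have h0 : ∫ x, J x = 0 := by
        refine integral_eq_zero_of_ae ?_
        refine measure_mono_null (fun x hx => ?_) hnull
        exact lt_of_le_of_ne (hJ.1 x) (Ne.symm hx)
      rw [hμJ, densityMeasure_univ hJ.1 hJi, h0, ENNReal.ofReal_zero] at h1
      exact zero_ne_one h1
    obtain ⟨x₀, hx₀⟩ := hne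
    obtain ⟨E, hE, hEc, c, hc, hae⟩ := exists_isCDExact_ae_eq hN hJ hJi hhJ hx₀
      (fun J₁ J₂ h₁ h₂ m₁ m₂ hadd h0 p₁ p₂ => exists_ae_eq_const_mul_of_indecomposable hN hμ hind
        hJ.1 hJi hμJ h₁ h₂ m₁ m₂ hadd h0 p₁ p₂)
    rw [hμJ]
    exact densityMeasure_mem_modelClass hN hJ hE hEc hc hae ⟨x₀, hx₀⟩
      ((Metric.ediam_mono hJlr).trans hD)

theorem valid_of_delta_nonpos {d : ℝ} (h : delta K N ≤ 0) : Valid K N d := by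
  have h1 : 0 < Real.pi ^ 2 := by positivity
  have h2 : delta K N * d ^ 2 ≤ 0 := mul_nonpos_of_nonpos_of_nonneg h (sq_nonneg d)
  exact h2.trans_lt h1

theorem valid_of_lt_lDelta {d : ℝ} (hd : 0 ≤ d) (h : ENNReal.ofReal d < lDelta K N) :
    Valid K N d := by
  rcases le_or_gt (delta K N) 0 with h0 | h0
  · exact valid_of_delta_nonpos h0
  rw [lDelta, if_pos h0, ENNReal.ofReal_lt_ofReal_iff_of_nonneg hd] at h
  have hs : 0 < √(delta K N) := Real.sqrt_pos.2 h0
  rw [lt_div_iff₀ hs] at h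
  have := pow_lt_pow_left₀ h (by positivity) two_ne_zero
  rw [mul_pow, Real.sq_sqrt h0.le, mul_comm] at this
  exact this

/-- Outside a suitable compact interval of admissible length, a measure of the class carries no
mass, or, if `D = ∞`, the test functions vanish. -/
theorem exists_Icc_of_mem_measureClass {D : ℝ≥0∞} {ξ : Measure ℝ} (hξ : ξ ∈ measureClass K N D)
    (hne : ξ ≠ 0) (hproviso : 0 < delta K N → K < 0 → D < lDelta K N) {S : Set ℝ}
    (hS : IsCompact S) :
    ∃ l r : ℝ, (K < 0 → Valid K N (r - l)) ∧ Metric.ediam (Icc l r) ≤ D ∧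
      ∀ f : ℝ → ℝ, (∀ x ∉ S, f x = 0) → ∫ x in Icc l r, f x ∂ξ = ∫ x, f x ∂ξ := by
  -- For `D = ∞` the support of `ξ` may be unbounded, but `δ ≤ 0` if `K < 0`, so every distance is
  -- valid then and any interval containing `S` will do.
  by_cases hD : D = ∞
  · subst hD
    obtain ⟨R, hR⟩ := hS.isBounded.subset_closedBall 0
    rw [Real.closedBall_eq_Icc] at hR
    refine ⟨0 - R, 0 + R, fun hK => ?_, le_top, fun f hf => ?_⟩
    · refine valid_of_delta_nonpos (not_lt.1 fun h0 => ?_)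
      exact not_top_lt (hproviso h0 hK)
    · exact setIntegral_eq_integral_of_forall_compl_eq_zero fun x hx => hf x fun hxS => hx (hR hxS)
  · have hb : Bornology.IsBounded ξ.support :=
      Metric.isBounded_iff_ediam_ne_top.2 (ne_top_of_le_ne_top hD hξ.2.2)
    obtain ⟨x, hx⟩ := Measure.nonempty_support hne
    have hle : sInf ξ.support ≤ sSup ξ.support :=
      (csInf_le hb.bddBelow hx).trans (le_csSup hb.bddAbove hx)
    have hdiam : ENNReal.ofReal (sSup ξ.support - sInf ξ.support) ≤ D := by
      rw [← Real.ediam_eq hb]; exact hξ.2.2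
    refine ⟨sInf ξ.support, sSup ξ.support, fun hK => ?_, by rwa [Real.ediam_Icc], fun f _ => ?_⟩
    · rcases le_or_gt (delta K N) 0 with h0 | h0
      · exact valid_of_delta_nonpos h0
      · exact valid_of_lt_lDelta (sub_nonneg.2 hle) (hdiam.trans_lt (hproviso h0 hK))
    · refine setIntegral_eq_integral_of_ae_compl_eq_zero ?_
      filter_upwards [Measure.support_mem_ae (μ := ξ)] with y hy hy'
      exact absurd ⟨csInf_le hb.bddBelow hy, le_csSup hb.bddAbove hy⟩ hy'

/-- Localization in the class: a continuous linear constraint and a strict inequality carry over to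
some model measure. -/
theorem exists_model_of_mem_measureClass (hN : N ≤ 0 ∨ 2 ≤ N) {D : ℝ≥0∞} {ξ : Measure ℝ}
    (hξ : ξ ∈ measureClass K N D) (hne : ξ ≠ 0)
    (hproviso : 0 < delta K N → K < 0 → D < lDelta K N) {h g : ℝ → ℝ} (hc : Continuous h)
    (hs : HasCompactSupport h) (gc : Continuous g) (gs : HasCompactSupport g)
    (hhg : ∀ x, h x = 0 → 0 ≤ g x) (hh : ∫ x, h x ∂ξ = 0) (hg : ∫ x, g x ∂ξ < 0) :
    ∃ ν ∈ modelClass K N D, ∫ x, h x ∂ν = 0 ∧ ∫ x, g x ∂ν < 0 := by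
  have hfin : IsFiniteMeasure ξ := hξ.1
  obtain ⟨l, r, hv, hD, hint⟩ := exists_Icc_of_mem_measureClass hξ hne hproviso
    (hs.isCompact.union gs.isCompact)
  have hhi := hint h fun x hx => image_eq_zero_of_notMem_tsupport fun hx' => hx (Or.inl hx')
  have hgi := hint g fun x hx => image_eq_zero_of_notMem_tsupport fun hx' => hx (Or.inr hx')
  set ξ' := ξ.restrict (Icc l r) with hξ'
  have hmass : ξ' univ ≠ 0 := by
    intro h0
    rw [Measure.measure_univ_eq_zero] at h0
    rw [h0, integral_zero_measure] at hgi
    linarith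
  have hc0 : (ξ' univ)⁻¹ ≠ 0 := ENNReal.inv_ne_zero.2 (measure_ne_top _ _)
  have hct : (ξ' univ)⁻¹ ≠ ∞ := ENNReal.inv_ne_top.2 hmass
  have hprob : IsProbabilityMeasure ((ξ' univ)⁻¹ • ξ') := ⟨by
    rw [Measure.smul_apply, smul_eq_mul, ENNReal.inv_mul_cancel hmass (measure_ne_top _ _)]⟩
  obtain ⟨Ch, hCh⟩ := hs.exists_bound_of_continuous hc
  obtain ⟨Cg, hCg⟩ := gs.exists_bound_of_continuous gc
  refine exists_model_of_mem_constrainedClass hN hv hD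
    (h := BoundedContinuousFunction.ofNormedAddCommGroup h hc Ch hCh)
    (g := BoundedContinuousFunction.ofNormedAddCommGroup g gc Cg hCg) hhg
    (μ₀ := ⟨_, hprob⟩) ⟨?_, ?_, ?_⟩ ?_
  · simp [hξ', measurableSet_Icc.compl]
  · exact (intervalBM_restrict_of_mem_measureClass hN hξ l r).smul hc0 hct
  · simp only [ProbabilityMeasure.coe_mk, BoundedContinuousFunction.coe_ofNormedAddCommGroup]
    rw [integral_smul_measure, hhi, hh, smul_zero]
  · simp only [ProbabilityMeasure.coe_mk, BoundedContinuousFunction.coe_ofNormedAddCommGroup]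
    rw [integral_smul_measure, hgi, smul_eq_mul]
    exact mul_neg_of_pos_of_neg (ENNReal.toReal_pos hc0 hct) hg

end

/-! ### The integrands of the functional inequalities -/

/-- The properties of the integrands that the localization uses. The lower bound for `v_f` by a
multiple of `h_f` makes `∫ v_f` nonnegative under the constraint `∫ h_f = 0`. -/
structure Problem.IsLocalizable (P : Problem) (f : ℝ → ℝ) : Prop where
  continuous_u : Continuous (P.u f)
  continuous_v : Continuous (P.v f)
  hasCompactSupport_u : HasCompactSupport (P.u f)
  hasCompactSupport_v : HasCompactSupport (P.v f)
  u_nonneg : ∀ x, 0 ≤ P.u f x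
  exists_mul_h_le_v : ∃ a : ℝ, ∀ x, a * P.h f x ≤ P.v f x
  v_eq_zero : ∀ x, P.h f x = 0 → P.v f x = 0

theorem isLocalizable_pPoincare {p : ℝ} (hp : 1 < p) {f : ℝ → ℝ}
    (hf : ContDiff ℝ ((⊤ : ℕ∞) : WithTop ℕ∞) f)
    (hs : HasCompactSupport ((Problem.pPoincare p).h f)) :
    (Problem.pPoincare p).IsLocalizable f := by
  have hp0 : 0 < p := by linarith
  have hz : ∀ x, (Problem.pPoincare p).h f x = 0 → f x = 0 := by
    intro x hx
    rcases mul_eq_zero.1 hx with h | h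
    · exact h
    · exact abs_eq_zero.1 ((Real.rpow_eq_zero_iff_of_nonneg (abs_nonneg _)).1 h).1
  have hfs : HasCompactSupport f := HasCompactSupport.intro hs.isCompact fun x hx =>
    hz x (image_eq_zero_of_notMem_tsupport hx)
  have hfd : Continuous (deriv f) := hf.continuous_deriv (by exact_mod_cast le_top)
  refine ⟨hfd.abs.rpow_const fun x => Or.inr hp0.le, hf.continuous.abs.rpow_const fun x =>
    Or.inr hp0.le, ?_, ?_, fun x => by simp only [Problem.u]; positivity,
    ⟨0, fun x => by simp only [Problem.v, zero_mul]; positivity⟩, fun x hx => ?_⟩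
  · refine HasCompactSupport.intro hfs.deriv.isCompact fun x hx => ?_
    simp [Problem.u, image_eq_zero_of_notMem_tsupport hx, hp0.ne']
  · refine HasCompactSupport.intro hfs.isCompact fun x hx => ?_
    simp [Problem.v, image_eq_zero_of_notMem_tsupport hx, hp0.ne']
  · simp [Problem.v, hz x hx, hp0.ne']

theorem isLocalizable_logSobolev {f : ℝ → ℝ} (hf : ContDiff ℝ ((⊤ : ℕ∞) : WithTop ℕ∞) f)
    (hs : HasCompactSupport (Problem.logSobolev.h f)) : Problem.logSobolev.IsLocalizable f := by
  have hfd : Continuous (deriv f) := hf.continuous_deriv (by exact_mod_cast le_top)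
  have hv : ∀ x, Problem.logSobolev.h f x = 0 → Problem.logSobolev.v f x = 0 := by
    intro x hx
    have : f x ^ 2 = 1 := sub_eq_zero.1 hx
    simp [Problem.v, this]
  refine ⟨by unfold Problem.u; fun_prop, Real.continuous_mul_log.comp (hf.continuous.pow 2), ?_, ?_,
    fun x => by simp only [Problem.u]; positivity, ⟨1, fun x => ?_⟩, hv⟩
  · refine HasCompactSupport.intro hs.isCompact fun x hx => ?_
    -- Off the support of `f² - 1`, differentiating `f² = 1` gives `f f' = 0`.
    have hev : Problem.logSobolev.h f =ᶠ[𝓝 x] 0 := notMem_tsupport_iff_eventuallyEq.1 hx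
    have hdiff : DifferentiableAt ℝ f x := (hf.differentiable (by simp)) x
    have hd : HasDerivAt (Problem.logSobolev.h f) (2 * f x * deriv f x) x := by
      have := (hdiff.hasDerivAt.pow 2).sub_const 1
      rwa [Nat.cast_two, pow_one] at this
    have h0 : 2 * f x * deriv f x = 0 := by
      rw [← hd.deriv, hev.deriv_eq]; simp
    have h1 : f x ^ 2 = 1 := sub_eq_zero.1
      (image_eq_zero_of_notMem_tsupport hx : Problem.logSobolev.h f x = 0)
    have hfx : f x ≠ 0 := by rintro h; simp [h] at h1
    have hdf : deriv f x = 0 := by simpa [hfx] using h0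
    simp [Problem.u, hdf]
  · exact HasCompactSupport.intro hs.isCompact fun x hx =>
      hv x (image_eq_zero_of_notMem_tsupport hx)
  · simp only [Problem.h, Problem.v, one_mul]
    rcases (sq_nonneg (f x)).eq_or_lt with h | h
    · rw [← h]; norm_num
    · have hlog := Real.one_sub_inv_le_log_of_pos h
      have := mul_le_mul_of_nonneg_left hlog h.le
      rwa [mul_sub, mul_one, mul_inv_cancel₀ h.ne'] at this

/-- The localization argument for any problem with localizable integrands: a quotient below `c` for
some measure of the class gives a quotient below `c` for some model. -/
theorem Problem.alpha_eq_iInf_modelClass (P : Problem) {K : ℝ} {N : WithTop ℝ} {D : ℝ≥0∞}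
    (hN : N ≤ 0 ∨ 2 ≤ N) (hproviso : 0 < delta K N → K < 0 → D < lDelta K N)
    (hP : ∀ f, ContDiff ℝ ((⊤ : ℕ∞) : WithTop ℕ∞) f → HasCompactSupport (P.h f) →
      P.IsLocalizable f) :
    P.alpha K N D = ⨅ ξ ∈ modelClass K N D, P.Lambda ξ := by
  refine le_antisymm (le_iInf₂ fun ξ hξ => iInf₂_le ξ ⟨mem_measureClass_of_mem_modelClass hN hξ,
    hξ.2.1⟩) (le_iInf₂ fun ξ hξ => le_iInf₂ fun f hf => ?_)
  obtain ⟨hξ, hne⟩ := hξ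
  have hfin : IsFiniteMeasure ξ := hξ.1
  have hloc := hP f hf.1 hf.2.2.2.1
  have hui : ∀ ν : Measure ℝ, IsFiniteMeasure ν → Integrable (P.u f) ν := fun ν _ =>
    hloc.continuous_u.integrable_of_hasCompactSupport hloc.hasCompactSupport_u
  have hvi : ∀ ν : Measure ℝ, IsFiniteMeasure ν → Integrable (P.v f) ν := fun ν _ =>
    hloc.continuous_v.integrable_of_hasCompactSupport hloc.hasCompactSupport_v
  have hu0 : ∀ ν : Measure ℝ, 0 ≤ ∫ x, P.u f x ∂ν := fun ν => integral_nonneg hloc.u_nonneg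
  have hv0 : ∀ ν : Measure ℝ, IsFiniteMeasure ν → ∫ x, P.h f x ∂ν = 0 → 0 ≤ ∫ x, P.v f x ∂ν := by
    intro ν hν hh
    obtain ⟨a, ha⟩ := hloc.exists_mul_h_le_v
    have := integral_mono ((hf.2.2.1.integrable_of_hasCompactSupport hf.2.2.2.1).const_mul a)
      (hvi ν hν) ha
    rwa [integral_const_mul, hh, mul_zero] at this
  have hgint : ∀ ν : Measure ℝ, IsFiniteMeasure ν → ∀ c : ℝ,
      ∫ x, (P.u f x - c * P.v f x) ∂ν = (∫ x, P.u f x ∂ν) - c * ∫ x, P.v f x ∂ν := by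
    intro ν hν c
    rw [integral_sub (hui ν hν) ((hvi ν hν).const_mul c), integral_const_mul]
  by_contra! hlt
  obtain ⟨c, hc₁, hc₂⟩ := EReal.lt_iff_exists_real_btwn.1 hlt
  unfold Problem.quotient at hc₁
  split_ifs at hc₁ with hv
  · exact not_top_lt hc₁
  have hvpos : 0 < ∫ x, P.v f x ∂ξ := lt_of_le_of_ne (hv0 ξ hfin hf.2.2.2.2) (Ne.symm hv)
  rw [EReal.coe_lt_coe_iff, div_lt_iff₀ hvpos] at hc₁
  obtain ⟨ν, hν, hhν, hgν⟩ := exists_model_of_mem_measureClass hN hξ hne hproviso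
    (h := P.h f) (g := fun x => P.u f x - c * P.v f x) hf.2.2.1 hf.2.2.2.1
    (hloc.continuous_u.sub (hloc.continuous_v.const_mul c))
    (hloc.hasCompactSupport_u.sub (hloc.hasCompactSupport_v.mul_left))
    (fun x hx => by simp only [hloc.v_eq_zero x hx, mul_zero, sub_zero]; exact hloc.u_nonneg x)
    hf.2.2.2.2 (by rw [hgint ξ hfin]; linarith)
  rw [hgint ν hν.1] at hgν
  have hvν : 0 < ∫ x, P.v f x ∂ν := by
    refine lt_of_le_of_ne (hv0 ν hν.1 hhν) fun h0 => ?_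
    rw [← h0] at hgν
    linarith [hu0 ν]
  have hq : P.quotient f ν < c := by
    rw [Problem.quotient, if_neg hvν.ne', EReal.coe_lt_coe_iff, div_lt_iff₀ hvν]
    linarith
  have hmem : f ∈ P.functionSpace ν := ⟨hf.1, hf.2.1, hf.2.2.1, hf.2.2.2.1, hhν⟩
  exact absurd ((iInf₂_le ν hν).trans (iInf₂_le f hmem)) (not_le.2 (hq.trans hc₂))

end CDD

theorem mainTheorem3 (K : ℝ) (N : WithTop ℝ) (D : ℝ≥0∞)
    (hN : N ≤ 0 ∨ 2 ≤ N) (hD : 0 < D)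
    (hproviso : 0 < CDD.delta K N → K < 0 → D < CDD.lDelta K N) :
    (∀ p : ℝ, 1 < p →
      (CDD.Problem.pPoincare p).alpha K N D =
        ⨅ ξ ∈ CDD.modelClass K N D, (CDD.Problem.pPoincare p).Lambda ξ) ∧
    CDD.Problem.logSobolev.alpha K N D =
      ⨅ ξ ∈ CDD.modelClass K N D, CDD.Problem.logSobolev.Lambda ξ :=
  ⟨fun _ hp => CDD.Problem.alpha_eq_iInf_modelClass _ hN hproviso fun _ hf hs =>
    CDD.isLocalizable_pPoincare hp hf hs,
    CDD.Problem.alpha_eq_iInf_modelClass _ hN hproviso fun _ hf hs =>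
      CDD.isLocalizable_logSobolev hf hs⟩
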